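/- Let $\mathbb K=\mathbb R$ or $\mathbb C$; "smooth" means $C^\infty$ if $\mathbb K=\mathbb R$ and holomorphic if $\mathbb K=\mathbb C$. Let $\pi\colon PT^*\mathbb K^{n+1}\to\mathbb K^{n+1}$ be the projectivised cotangent bundle, with points $(z,[\omega])$ and the contact structure given by $\alpha=\omega_1\,dz^1+\dots+\omega_{n+1}\,dz^{n+1}$. A smooth map $F$ into $PT^*\mathbb K^{n+1}$ is integral if $F^*\alpha=0$. A smooth map germ $g$ into $\mathbb K^{n+1}$ is frontal if $g=\pi\circ F$ for some integral germ $F$. A smooth germ $f\colon(\mathbb K^n,0)\to(\mathbb K^{n+1},0)$ is a proper frontal if it is frontal and its set of non-immersive points is nowhere dense near $0$; then the integral germ $\tilde f$ with $\pi\circ\tilde f=f$ is unique and is called the Nash lift of $f$. For a smooth one-parameter family $g_t$ write $v_0(g_t)=\frac{d g_t}{dt}\big|_{t=0}$. All families below are germs of families, smooth in $t$ as well, defined for $t\in\mathbb K$ near $0$. Put - $\theta_I(\tilde f)=\{v_0(\tilde f_t):\tilde f_0=\tilde f,\ \tilde f_t\text{ integral for every } t\}$; - $\mathscr F(f)=\{v_0(f_t):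 f_0=f,\ \text{the germ } (x,t)\mapsto(f_t(x),t)\text{ at } (0,0) \text{ is frontal}\}$; - $T\mathscr A_ef=\{df\circ a+b\circ f\}$, where $a$ and $b$ run over the germs at $0$ of smooth vector fields on $\mathbb K^n$ and $\mathbb K^{n+1}$; - $T\mathscr L_e\tilde f=\{v_0(\Psi_t\circ\tilde f\circ\phi_t^{-1})\}$, where $\phi_t$ and $\Psi_t$ are smooth families of local diffeomorphisms of $\mathbb K^n$ near $0$ and of $PT^*\mathbb K^{n+1}$ near $\tilde f(0)$, with $\phi_0=\mathrm{id}$, $\Psi_0=\mathrm{id}$, such that every $\Psi_t$ preserves the contact structure and covers a diffeomorphism $\psi_t$ of the base, $\pi\circ\Psi_t=\psi_t\circ\pi$ (with $\psi_t$ smooth in $t$ too). Neither $\phi_t$ nor $\Psi_t$ is required to fix the base point. **Theorem.** Let $f\colon(\mathbb K^n,0)\to(\mathbb K^{n+1},0)$ be a proper frontal map germ of integral corank at most $1$, that is, $n-\operatorname{rank} d\tilde f_0\le 1$. Then $\theta_I(\tilde f)$ and $\mathscr F(f)$ are $\mathbb K$-vector spaces (linear subspaces of the spaces of vector field germs along $\tilde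 f$ and along $f$), $T\mathscr L_e\tilde f\subseteq\theta_I(\tilde f)$ and $T\mathscr A_ef\subseteq\mathscr F(f)$ are linear subspaces, and the map $$t\pi\colon\theta_I(\tilde f)\to\mathscr F(f),\qquad \xi\mapsto d\pi\circ\xi,$$ is a $\mathbb K$-linear isomorphism. It induces a $\mathbb K$-linear isomorphism $$\Pi\colon\frac{\mathscr F(f)}{T\mathscr A_ef}\longrightarrow\frac{\theta_I(\tilde f)}{T\mathscr L_e\tilde f},\qquad [t\pi(\xi)]\mapsto[\xi].$$ In particular the frontal codimension $\dim_{\mathbb K}\mathscr F(f)/T\mathscr A_ef$ equals the Legendrian codimension $\dim_{\mathbb K}\theta_I(\tilde f)/T\mathscr L_e\tilde f$. -/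

import Mathlib

open Set Filter Topology Manifold
open scoped ContDiff LinearAlgebra.Projectivization

/-! ### Projective space as a manifold -/

/-- The quotient topology on a projective space. -/
instance Projectivization.instQuotientTopology {K V : Type*} [DivisionRing K] [AddCommGroup V]
    [Module K V] [TopologicalSpace V] : TopologicalSpace (ℙ K V) :=
  inferInstanceAs (TopologicalSpace (Quotient (projectivizationSetoid K V)))

theorem Projectivization.isQuotientMap_mk' {K V : Type*} [DivisionRing K] [AddCommGroup V]
    [Module K V] [TopologicalSpace V] :
    IsQuotientMap (Projectivization.mk' K : {v : V // v ≠ 0} → ℙ K V) :=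
  isQuotientMap_quotient_mk'

namespace ProjChart

variable {𝕜 : Type*} [NontriviallyNormedField 𝕜] {m : ℕ}

/-- The vector obtained from the affine coordinates `p` by inserting `1` as the `i`-th entry. -/
def vec (i : Fin (m + 1)) (p : Fin m → 𝕜) : Fin (m + 1) → 𝕜 := i.insertNth (1 : 𝕜) p

theorem vec_ne_zero (i : Fin (m + 1)) (p : Fin m → 𝕜) : vec i p ≠ 0 := by
  intro h
  have := congrFun h i
  simp [vec] at this

/-- The `i`-th affine coordinates `w_j / w_i` (`j ≠ i`) of the point `[w]`. -/
def coord (i : Fin (m + 1)) : ℙ 𝕜 (Fin (m + 1) → 𝕜) → (Fin m → 𝕜) :=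
  Projectivization.lift (fun w => fun j => w.1 (i.succAbove j) / w.1 i) (by
    rintro ⟨a, ha⟩ ⟨b, hb⟩ t (rfl : a = t • b)
    have ht : t ≠ 0 := by rintro rfl; simp at ha
    funext j
    simp [mul_div_mul_left, ht])

/-- The set of points `[w]` with `w_i ≠ 0`. -/
def dom (i : Fin (m + 1)) : Set (ℙ 𝕜 (Fin (m + 1) → 𝕜)) := {q | q.rep i ≠ 0}

theorem mk_mem_dom (i : Fin (m + 1)) (w : Fin (m + 1) → 𝕜) (h : w ≠ 0) :
    Projectivization.mk 𝕜 w h ∈ dom i ↔ w i ≠ 0 := by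
  obtain ⟨a, ha⟩ := Projectivization.exists_smul_eq_mk_rep 𝕜 w h
  simp only [dom, mem_ofPred_eq, ← ha]
  simp [Units.smul_def]

theorem coord_mk (i : Fin (m + 1)) (w : Fin (m + 1) → 𝕜) (h : w ≠ 0) :
    coord i (Projectivization.mk 𝕜 w h) = fun j => w (i.succAbove j) / w i := rfl

theorem mk_vec_coord (i : Fin (m + 1)) (q : ℙ 𝕜 (Fin (m + 1) → 𝕜)) (hq : q ∈ dom i) :
    Projectivization.mk 𝕜 (vec i (coord i q)) (vec_ne_zero _ _) = q := by
  induction q using Projectivization.ind with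
  | h w h =>
    rw [mk_mem_dom] at hq
    rw [Projectivization.mk_eq_mk_iff']
    refine ⟨(w i)⁻¹, ?_⟩
    funext k
    rw [coord_mk]
    refine i.succAboveCases ?_ (fun j => ?_) k
    · simp [vec, hq]
    · simp [vec, div_eq_inv_mul]

theorem isOpen_dom (i : Fin (m + 1)) : IsOpen (dom i : Set (ℙ 𝕜 (Fin (m + 1) → 𝕜))) := by
  rw [← Projectivization.isQuotientMap_mk'.isOpen_preimage]
  have : Projectivization.mk' 𝕜 ⁻¹' (dom i) =
      {w : {v : Fin (m + 1) → 𝕜 // v ≠ 0} | w.1 i ≠ 0} := by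
    ext ⟨w, h⟩
    simp [mk_mem_dom]
  rw [this]
  exact isOpen_ne_fun ((continuous_apply i).comp continuous_subtype_val) continuous_const

/-- The `i`-th affine chart of projective space. -/
def chart (i : Fin (m + 1)) :
    OpenPartialHomeomorph (ℙ 𝕜 (Fin (m + 1) → 𝕜)) (Fin m → 𝕜) where
  toFun := coord i
  invFun p := Projectivization.mk 𝕜 (vec i p) (vec_ne_zero i p)
  source := dom i
  target := univ
  map_source' _ _ := mem_univ _
  map_target' p _ := by rw [mk_mem_dom]; simp [vec]
  left_inv' q hq := mk_vec_coord i q hq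
  right_inv' p _ := by rw [coord_mk]; simp [vec]
  open_target := isOpen_univ
  open_source := isOpen_dom i
  continuousOn_toFun := by
    rw [Projectivization.isQuotientMap_mk'.continuousOn_isOpen_iff (isOpen_dom i)]
    refine continuousOn_pi.2 fun j => ?_
    refine ContinuousOn.div (f := fun w : {v : Fin (m + 1) → 𝕜 // v ≠ 0} => w.1 (i.succAbove j))
      (g := fun w => w.1 i) 
      ((continuous_apply (i.succAbove j)).comp continuous_subtype_val).continuousOn
      ((continuous_apply i).comp continuous_subtype_val).continuousOn ?_
    rintro ⟨w, h⟩ hw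
    exact (mk_mem_dom i w h).1 hw
  continuousOn_invFun := by
    refine Continuous.continuousOn ?_
    have h1 : Continuous fun p : Fin m → 𝕜 =>
        (⟨vec i p, vec_ne_zero i p⟩ : {v : Fin (m + 1) → 𝕜 // v ≠ 0}) :=
      (Continuous.finInsertNth (A := fun _ => 𝕜) i continuous_const continuous_id).subtype_mk _
    exact Projectivization.isQuotientMap_mk'.continuous.comp h1

theorem exists_mem_dom (q : ℙ 𝕜 (Fin (m + 1) → 𝕜)) : ∃ i, q ∈ dom i := by
  by_contra! h
  exact q.rep_nonzero (funext fun i => not_not.1 (h i))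

/-- Projective space with its affine charts. -/
noncomputable instance instChartedSpace :
    ChartedSpace (Fin m → 𝕜) (ℙ 𝕜 (Fin (m + 1) → 𝕜)) where
  atlas := range chart
  chartAt q := chart (exists_mem_dom q).choose
  mem_chart_source q := (exists_mem_dom q).choose_spec
  chart_mem_atlas _ := mem_range_self _

instance instIsManifold (k : ℕ∞ω) :
    IsManifold 𝓘(𝕜, Fin m → 𝕜) k (ℙ 𝕜 (Fin (m + 1) → 𝕜)) := by
  refine isManifold_of_contDiffOn _ _ _ ?_
  rintro _ _ ⟨i, rfl⟩ ⟨j, rfl⟩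
  simp only [modelWithCornersSelf_coe, modelWithCornersSelf_coe_symm, Function.comp_id,
    Function.id_comp, preimage_id, range_id, inter_univ]
  have hv : ∀ a, ContDiff 𝕜 k fun p : Fin m → 𝕜 => vec i p a := by
    intro a
    refine i.succAboveCases ?_ (fun b => ?_) a
    · simpa [vec] using contDiff_const
    · simpa [vec] using contDiff_apply 𝕜 𝕜 b
  refine contDiffOn_pi.2 fun b => ?_
  have h : ContDiffOn 𝕜 k (fun p : Fin m → 𝕜 => vec i p (j.succAbove b) / vec i p j)
      ((chart i).symm ≫ₕ chart j).source := by
    refine ContDiffOn.fun_div (hv _).contDiffOn (hv _).contDiffOn ?_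
    intro p hp
    have : Projectivization.mk 𝕜 (vec i p) (vec_ne_zero i p) ∈ dom j := by
      simpa [chart] using hp
    exact (mk_mem_dom _ _ _).1 this
  exact h

end ProjChart

namespace FrontalGerm

/-! ### The projectivised cotangent bundle and its contact structure -/

section Contact

variable (𝕜 : Type*) [RCLike 𝕜] (n : ℕ)

/-- The projectivised cotangent bundle `PT^*𝕜^{n+1}`. A point is a pair `(z, [w])`, where `[w]` is
the class of the nonzero covector `w_1 dz^1 + ... + w_{n+1} dz^{n+1}` at `z`. -/
abbrev PTCot : Type _ := (Fin (n + 1) → 𝕜) × ℙ 𝕜 (Fin (n + 1) → 𝕜)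

/-- The model of the `(2n+1)`-dimensional manifold `PTCot 𝕜 n`. -/
noncomputable abbrev PTModel :
    ModelWithCorners 𝕜 ((Fin (n + 1) → 𝕜) × (Fin n → 𝕜))
      (ModelProd (Fin (n + 1) → 𝕜) (Fin n → 𝕜)) :=
  𝓘(𝕜, Fin (n + 1) → 𝕜).prod 𝓘(𝕜, Fin n → 𝕜)

variable {𝕜 n}

/-- The canonical bundle projection `π`. -/
def proj (q : PTCot 𝕜 n) : Fin (n + 1) → 𝕜 := q.1

/-- The differential `dπ` at `q`. -/
noncomputable def dproj (q : PTCot 𝕜 n) :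
    TangentSpace (PTModel 𝕜 n) q →L[𝕜] (Fin (n + 1) → 𝕜) :=
  mfderiv (PTModel 𝕜 n) 𝓘(𝕜, Fin (n + 1) → 𝕜) proj q

/-- The contact form `w_1 dz^1 + ... + w_{n+1} dz^{n+1}` at `q = (z, [w])`, for a chosen
representative `w` of `[w]`; another representative changes it by a nonzero factor. -/
noncomputable def contactForm (q : PTCot 𝕜 n) : TangentSpace (PTModel 𝕜 n) q →ₗ[𝕜] 𝕜 :=
  (∑ i, q.2.rep i • (LinearMap.proj i : (Fin (n + 1) → 𝕜) →ₗ[𝕜] 𝕜)) ∘ₗ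
    (dproj q).toLinearMap

/-- The contact hyperplane at `q`. -/
noncomputable def contactPlane (q : PTCot 𝕜 n) : Submodule 𝕜 (TangentSpace (PTModel 𝕜 n) q) :=
  LinearMap.ker (contactForm q)

/-! ### Integral and frontal germs -/

variable {V : Type*} [NormedAddCommGroup V] [NormedSpace 𝕜 V]

/-- The pull-back of the contact form by `F` vanishes at `x`. -/
def IsIntegralAt (F : V → PTCot 𝕜 n) (x : V) : Prop :=
  ∀ v : TangentSpace 𝓘(𝕜, V) x, mfderiv 𝓘(𝕜, V) (PTModel 𝕜 n) F x v ∈ contactPlane (F x)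

/-- The germ of `F` at `x` is smooth: `C^∞` on a neighbourhood of `x` if `𝕜 = ℝ`, holomorphic if
`𝕜 = ℂ`. -/
def IsSmoothGerm {W : Type*} [NormedAddCommGroup W] [NormedSpace 𝕜 W] (g : V → W) (x : V) : Prop :=
  ∀ᶠ y in 𝓝 x, ContDiffAt 𝕜 ∞ g y

/-- The germ of `F` at `x`, with values in `PTCot 𝕜 n`, is smooth. -/
def IsSmoothGermPT (F : V → PTCot 𝕜 n) (x : V) : Prop :=
  ∀ᶠ y in 𝓝 x, ContMDiffAt 𝓘(𝕜, V) (PTModel 𝕜 n) ∞ F y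

/-- `F` is a smooth integral germ at `x` with `π ∘ F = g` as germs. -/
structure IsLegendrianLift (F : V → PTCot 𝕜 n) (g : V → Fin (n + 1) → 𝕜) (x : V) : Prop where
  smooth : IsSmoothGermPT F x
  integral : ∀ᶠ y in 𝓝 x, IsIntegralAt F y
  proj_eq : ∀ᶠ y in 𝓝 x, proj (F y) = g y

/-- The germ of `g` at `x` is frontal. -/
def IsFrontalGerm (g : V → Fin (n + 1) → 𝕜) (x : V) : Prop :=
  ∃ F : V → PTCot 𝕜 n, IsLegendrianLift F g x

/-- The germ of `g` at `x` is a proper frontal: it is frontal, and its singular set (the points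
where `g` is not immersive) is nowhere dense. -/
def IsProperFrontalGerm (g : V → Fin (n + 1) → 𝕜) (x : V) : Prop :=
  IsFrontalGerm g x ∧
    ∃ U ∈ 𝓝 x, IsNowhereDense {y ∈ U | ¬ Function.Injective (fderiv 𝕜 g y)}

/-- The corank at `0` of the germ `F`. -/
noncomputable def corank (F : (Fin n → 𝕜) → PTCot 𝕜 n) : ℕ :=
  n - Module.finrank 𝕜
    (LinearMap.range (mfderiv 𝓘(𝕜, Fin n → 𝕜) (PTModel 𝕜 n) F 0).toLinearMap)

end Contact

/-! ### Vector fields along a germ -/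

section Fields

variable {𝕜 : Type*} [RCLike 𝕜] {n : ℕ}

/-- The sections along `F` that vanish near `0`. -/
def zeroGerms (F : (Fin n → 𝕜) → PTCot 𝕜 n) :
    Submodule 𝕜 (∀ x, TangentSpace (PTModel 𝕜 n) (F x)) where
  carrier := {s | ∀ᶠ x in 𝓝 0, s x = 0}
  zero_mem' := Eventually.of_forall fun _ => rfl
  add_mem' := by
    intro s t hs ht
    filter_upwards [hs, ht] with x h1 h2
    simp [h1, h2]
  smul_mem' := by
    intro c s hs
    filter_upwards [hs] with x h1
    simp [h1]

/-- The space of germs at `0` of vector fields along `F`. -/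
abbrev FieldGerm (F : (Fin n → 𝕜) → PTCot 𝕜 n) : Type _ :=
  (∀ x, TangentSpace (PTModel 𝕜 n) (F x)) ⧸ zeroGerms F

/-- The map `ξ ↦ dπ ∘ ξ` from germs of vector fields along `F` to germs of `𝕜^{n+1}`-valued maps,
that is, of vector fields along `π ∘ F`. -/
noncomputable def tProj (F : (Fin n → 𝕜) → PTCot 𝕜 n) :
    FieldGerm F →ₗ[𝕜] Germ (𝓝 (0 : Fin n → 𝕜)) (Fin (n + 1) → 𝕜) :=
  (zeroGerms F).liftQ
    { toFun := fun s => ((fun x => dproj (F x) (s x) : (Fin n → 𝕜) → Fin (n + 1) → 𝕜) :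
        Germ (𝓝 (0 : Fin n → 𝕜)) (Fin (n + 1) → 𝕜))
      map_add' := by
        intro s t
        rw [← Germ.coe_add]
        congr 1
        funext x
        simp
      map_smul' := by
        intro c s
        rw [RingHom.id_apply, ← Germ.coe_smul]
        congr 1
        funext x
        simp }
    (by
      intro s hs
      refine Germ.coe_eq.2 ?_
      have hs' : ∀ᶠ x in 𝓝 (0 : Fin n → 𝕜), s x = 0 := hs
      filter_upwards [hs'] with x hx
      simp [hx])

/-- The germ of vector field `v_0(G) = dG_t/dt|_{t=0}` along `F` of a one-parameter deformation
`G(x, t) = G_t(x)` of the germ of `F` at `0`, so that `G(x, 0) = F(x)` for `x` near `0`. -/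
noncomputable def velocity (F : (Fin n → 𝕜) → PTCot 𝕜 n) (G : (Fin n → 𝕜) × 𝕜 → PTCot 𝕜 n) :
    FieldGerm F :=
  (zeroGerms F).mkQ fun x =>
    (mfderiv 𝓘(𝕜, 𝕜) (PTModel 𝕜 n) (fun t : 𝕜 => G (x, t)) 0 (1 : 𝕜) :
      TangentSpace (PTModel 𝕜 n) (G (x, 0)))

/-! ### Infinitesimal deformations -/

/-- `θ_I(F)`: the velocities of the integral one-parameter deformations of the germ of `F`
at `0`. -/
def integralDeformations (F : (Fin n → 𝕜) → PTCot 𝕜 n) : Set (FieldGerm F) :=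
  {ξ | ∃ G : (Fin n → 𝕜) × 𝕜 → PTCot 𝕜 n,
    IsSmoothGermPT G 0 ∧
    (∀ᶠ x in 𝓝 (0 : Fin n → 𝕜), G (x, 0) = F x) ∧
    (∀ᶠ p in 𝓝 (0 : (Fin n → 𝕜) × 𝕜), IsIntegralAt (fun x => G (x, p.2)) p.1) ∧
    ξ = velocity F G}

/-- The germ at `(q₀, 0)` of `Ψ(q, t) = Ψ_t(q)` is a smooth one-parameter family of Legendrian
diffeomorphisms with `Ψ_0 = id`: every `Ψ_t` preserves the contact structure and covers some `ψ_t`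
on the base. (Since `Ψ_0 = id`, the `Ψ_t` and `ψ_t` are local diffeomorphisms for small `t`;
`q₀` need not be fixed.) -/
structure IsLegendrianFamily (Ψ : PTCot 𝕜 n × 𝕜 → PTCot 𝕜 n) (q₀ : PTCot 𝕜 n) : Prop where
  smooth : ∀ᶠ p in 𝓝 (q₀, (0 : 𝕜)),
    ContMDiffAt ((PTModel 𝕜 n).prod 𝓘(𝕜, 𝕜)) (PTModel 𝕜 n) ∞ Ψ p
  start : ∀ᶠ q in 𝓝 q₀, Ψ (q, 0) = q
  contact : ∀ᶠ p in 𝓝 (q₀, (0 : 𝕜)),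
    (contactPlane p.1).map
      (mfderiv (PTModel 𝕜 n) (PTModel 𝕜 n) (fun q => Ψ (q, p.2)) p.1).toLinearMap =
      contactPlane (Ψ p)
  covers : ∃ ψ : (Fin (n + 1) → 𝕜) × 𝕜 → Fin (n + 1) → 𝕜,
    IsSmoothGerm (𝕜 := 𝕜) ψ (proj q₀, 0) ∧
    ∀ᶠ p in 𝓝 (q₀, (0 : 𝕜)), proj (Ψ p) = ψ (proj p.1, p.2)

/-- `Tℒ_e(F)`: the velocities of the trivial Legendrian deformations `Ψ_t ∘ F ∘ σ_t`, where `Ψ_t`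
are Legendrian diffeomorphisms and `σ_t` are diffeomorphisms of the source (the inverses of the
reparametrisations `φ_t`), both starting at the identity. -/
def legendrianTangent (F : (Fin n → 𝕜) → PTCot 𝕜 n) : Set (FieldGerm F) :=
  {ξ | ∃ (σ : (Fin n → 𝕜) × 𝕜 → Fin n → 𝕜) (Ψ : PTCot 𝕜 n × 𝕜 → PTCot 𝕜 n),
    IsSmoothGerm (𝕜 := 𝕜) σ 0 ∧
    (∀ᶠ x in 𝓝 (0 : Fin n → 𝕜), σ (x, 0) = x) ∧
    IsLegendrianFamily Ψ (F 0) ∧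
    ξ = velocity F fun p => Ψ (F (σ p), p.2)}

/-- `ℱ(f)`: the velocities of the one-parameter deformations `f_t` of the germ of `f` at `0` whose
associated unfolding `(x, t) ↦ (f_t(x), t)` is frontal. -/
def frontalDeformations (f : (Fin n → 𝕜) → Fin (n + 1) → 𝕜) :
    Set (Germ (𝓝 (0 : Fin n → 𝕜)) (Fin (n + 1) → 𝕜)) :=
  {ξ | ∃ g : (Fin n → 𝕜) × 𝕜 → Fin (n + 1) → 𝕜,
    IsSmoothGerm (𝕜 := 𝕜) g 0 ∧
    (∀ᶠ x in 𝓝 (0 : Fin n → 𝕜), g (x, 0) = f x) ∧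
    IsFrontalGerm (𝕜 := 𝕜) (n := n + 1)
      (fun p : (Fin n → 𝕜) × 𝕜 => (Fin.snoc (g p) p.2 : Fin (n + 2) → 𝕜)) 0 ∧
    ξ = ((fun x => deriv (fun t : 𝕜 => g (x, t)) 0 : (Fin n → 𝕜) → Fin (n + 1) → 𝕜) :
      Germ (𝓝 (0 : Fin n → 𝕜)) (Fin (n + 1) → 𝕜))}

/-- `T𝒜_e f = tf(θ_n) + ωf(θ_{n+1})`: the germs `df ∘ a + b ∘ f` for germs of smooth vector fields
`a` on the source and `b` on the target. -/
def extendedTangent (f : (Fin n → 𝕜) → Fin (n + 1) → 𝕜) :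
    Set (Germ (𝓝 (0 : Fin n → 𝕜)) (Fin (n + 1) → 𝕜)) :=
  {ξ | ∃ (a : (Fin n → 𝕜) → Fin n → 𝕜) (b : (Fin (n + 1) → 𝕜) → Fin (n + 1) → 𝕜),
    IsSmoothGerm (𝕜 := 𝕜) a 0 ∧ IsSmoothGerm (𝕜 := 𝕜) b (f 0) ∧
    ξ = ((fun x => fderiv 𝕜 f x (a x) + b (f x) : (Fin n → 𝕜) → Fin (n + 1) → 𝕜) :
      Germ (𝓝 (0 : Fin n → 𝕜)) (Fin (n + 1) → 𝕜))}

end Fields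

end FrontalGerm

/-!
In the affine chart `w_i = 1` of `PT^*𝕜^{n+1}`, with `u = z_i` and with `q_j`, `p_j` the remaining
base coordinates and covector components, a germ `F` is integral when `du + ∑ p_j dq_j = 0`. The
velocities of integral deformations of `F` solve the linearisation
`du' + ∑ (p'_j dq_j + p_j dq'_j) = 0` of this equation. The solutions form a linear space
`infinitesimalDeformations`, and everything rests on four facts.

*In corank at most one, every solution of the linearised equation is a velocity*
(`infinitesimalDeformations_eq`), so `θ_I` is a linear space. The image of `dF_0` is isotropic.
Exchanging `q_j` and `p_j` for suitable `j` by a Legendre transformation therefore brings the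
equation into the form `dU = ∑ x_j dy_j`, where `dy` has the same kernel as `dF` at `0`, of
dimension at most one. Then all `y_j` but one, `y_k`, form part of a coordinate system of the
source. A reparametrisation `s ↦ s + t a(s)` of the source reduces to solutions `(U', x', y')` of
the linearised equation with `y'_j = 0` for `j ≠ k`. For these the affine family `U + t U'`,
`x + t x'`, `y + t y'` solves the equation up to the error `-t² x'_k dy'_k`. Integration of
`x'_k dy'_k` in the remaining coordinate gives a function `W` and germs `c_j`, `j ≠ k`, with
`dW = x'_k dy'_k + ∑ c_j dy_j`. The corrections `t² W` of `U` and `t² c_j` of `x_j` remove the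
error, without a new one in order `t³` because `c_k = 0` and `dy'_j = 0` for `j ≠ k`.

*`tπ` is injective on `θ_I`* (`eq_zero_of_tProj_eq_zero`): if `z' = 0`, the linearised equation
reads `∑ p'_j dq_j = 0`, and the `dq_j` are independent at the immersive points of `f`, which are
dense.

*`tπ` maps `θ_I` onto `ℱ(f)`* (`image_tProj_integralDeformations`). The lifts `[w]` of a family
`f_t` extend to the lift `[w, -w(∂f_t/∂t)]` of the unfolding. In the other direction a lift
`[w, c]` of the unfolding restricts to lifts `[w]` of the `f_t`. Here `w ≠ 0` near `0`: by density
of the immersive points `w` is at `t = 0` a multiple of the Nash lift, normalised to have `i`-th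
component `1`, by the function `w_i`. If `w_i` vanished at `0`, so would `w`, and integrality in the
direction of `∂/∂t` would give `c = 0` too.

*`tπ` maps `Tℒ_e` onto `T𝒜_e f`* (`image_tProj_legendrianTangent`), because the diffeomorphisms
`z ↦ z + t b(z)` of the base lift to `PT^*𝕜^{n+1}` through `[w] ↦ [w ∘ (dψ_t)⁻¹]`. By injectivity
of `tπ`, `Tℒ_e` is the preimage of `T𝒜_e f` in `θ_I`; hence it is a linear space as well, and `tπ`
induces an isomorphism of the quotients.
-/

namespace FrontalGerm

/-! ### Integrals and primitives depending smoothly on parameters -/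

section ParametricIntegral

universe u

variable {𝕜 : Type u} [RCLike 𝕜]

/-- Differentiation under the integral sign, over `𝕜`, for an integral over the real segment from
`0` to `1` in `𝕜`. -/
theorem hasFDerivAt_integral_of_contDiffOn {V E : Type*} [NormedAddCommGroup V] [NormedSpace 𝕜 V]
    [ProperSpace V] [NormedAddCommGroup E] [NormedSpace 𝕜 E] [NormedSpace ℝ E]
    {U : Set V} {O : Set (V × 𝕜)} (hU : IsOpen U) (hO : IsOpen O)
    (hUO : ∀ s ∈ U, ∀ r ∈ Icc (0 : ℝ) 1, (s, (r : 𝕜)) ∈ O) {φ : V × 𝕜 → E}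
    (hφ : ContDiffOn 𝕜 1 φ O) {s₀ : V} (hs₀ : s₀ ∈ U) :
    HasFDerivAt (fun s => ∫ r in (0 : ℝ)..1, φ (s, (r : 𝕜)))
      (∫ r in (0 : ℝ)..1, (fderiv 𝕜 φ (s₀, (r : 𝕜))).comp (ContinuousLinearMap.inl 𝕜 V 𝕜)) s₀ := by
  obtain ⟨ε, hε, hεU⟩ := Metric.isOpen_iff.1 hU s₀ hs₀
  have hsub : Metric.closedBall s₀ (ε / 2) ⊆ U :=
    (Metric.closedBall_subset_ball (by linarith)).trans hεU
  have hcφ : ContinuousOn φ O := hφ.continuousOn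
  have hcD : ContinuousOn (fun p => (fderiv 𝕜 φ p).comp (ContinuousLinearMap.inl 𝕜 V 𝕜)) O :=
    (hφ.continuousOn_fderiv_of_isOpen hO le_rfl).clm_comp continuousOn_const
  have hmap : ContinuousOn (fun p : V × ℝ => (p.1, (p.2 : 𝕜)))
      (Metric.closedBall s₀ (ε / 2) ×ˢ Icc (0 : ℝ) 1) :=
    (continuous_fst.prodMk (RCLike.continuous_ofReal.comp continuous_snd)).continuousOn
  obtain ⟨C, hC⟩ := (((isCompact_closedBall s₀ (ε / 2)).prod
    (isCompact_Icc (a := (0 : ℝ)) (b := 1))).exists_bound_of_continuousOn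
    (hcD.comp hmap fun p hp => hUO _ (hsub hp.1) _ hp.2))
  have huI : uIoc (0 : ℝ) 1 ⊆ Icc 0 1 := by
    rw [uIoc_of_le zero_le_one]; exact Ioc_subset_Icc_self
  have hline : ∀ s ∈ U, ContinuousOn (fun r : ℝ => (s, (r : 𝕜))) (Icc 0 1) := fun s _ =>
    (continuous_const.prodMk RCLike.continuous_ofReal).continuousOn
  have hint : ∀ s ∈ U, ContinuousOn (fun r : ℝ => φ (s, (r : 𝕜))) (Icc 0 1) := fun s hs =>
    hcφ.comp (hline s hs) fun r hr => hUO s hs r hr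
  refine intervalIntegral.hasFDerivAt_integral_of_dominated_of_fderiv_le
    (F' := fun s r => (fderiv 𝕜 φ (s, (r : 𝕜))).comp (ContinuousLinearMap.inl 𝕜 V 𝕜))
    (s := Metric.ball s₀ (ε / 2)) (bound := fun _ => C)
    (Metric.ball_mem_nhds s₀ (by linarith)) ?_ ?_ ?_ ?_ ?_ ?_
  · filter_upwards [hU.mem_nhds hs₀] with s hs
    exact ((hint s hs).mono huI).aestronglyMeasurable measurableSet_uIoc
  · exact ContinuousOn.intervalIntegrable (by simpa using hint s₀ hs₀)
  · exact ((hcD.comp (hline s₀ hs₀) fun r hr => hUO s₀ hs₀ r hr).mono huI).aestronglyMeasurable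
      measurableSet_uIoc
  · refine Eventually.of_forall fun r hr s hs => ?_
    exact hC (s, r) ⟨Metric.ball_subset_closedBall hs, huI hr⟩
  · exact intervalIntegrable_const
  · refine Eventually.of_forall fun r hr s hs => ?_
    have h1 : HasFDerivAt φ (fderiv 𝕜 φ (s, (r : 𝕜))) (s, (r : 𝕜)) :=
      ((hφ.contDiffAt (hO.mem_nhds (hUO s (hsub (Metric.ball_subset_closedBall hs)) r
        (huI hr)))).differentiableAt one_ne_zero).hasFDerivAt
    exact h1.comp s (hasFDerivAt_prodMk_left s (r : 𝕜))

/-- The space `E` varies in the induction on `m`, since the derivative of the integral is the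
integral of an operator-valued map; hence the common universe. -/
theorem contDiffOn_integral {V : Type u} [NormedAddCommGroup V] [NormedSpace 𝕜 V]
    [ProperSpace V] {U : Set V} {O : Set (V × 𝕜)} (hU : IsOpen U) (hO : IsOpen O)
    (hUO : ∀ s ∈ U, ∀ r ∈ Icc (0 : ℝ) 1, (s, (r : 𝕜)) ∈ O) (m : ℕ) :
    ∀ {E : Type u} [NormedAddCommGroup E] [NormedSpace 𝕜 E] [NormedSpace ℝ E]
      [SMulCommClass 𝕜 ℝ E] {φ : V × 𝕜 → E}, ContDiffOn 𝕜 ∞ φ O →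
      ContDiffOn 𝕜 m (fun s => ∫ r in (0 : ℝ)..1, φ (s, (r : 𝕜))) U := by
  induction m with
  | zero =>
    intro E _ _ _ _ φ hφ
    refine contDiffOn_zero.2 fun s hs => ?_
    exact (hasFDerivAt_integral_of_contDiffOn hU hO hUO (hφ.of_le (by simp))
      hs).continuousAt.continuousWithinAt
  | succ m ih =>
    intro E _ _ _ _ φ hφ
    have hd := fun s hs => hasFDerivAt_integral_of_contDiffOn hU hO hUO
      (hφ.of_le (show (1 : ℕ∞ω) ≤ ∞ by simp)) (s₀ := s) hs
    rw [Nat.cast_succ, contDiffOn_succ_iff_fderiv_of_isOpen hU]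
    refine ⟨fun s hs => (hd s hs).differentiableAt.differentiableWithinAt, by simp, ?_⟩
    have h2 : ContDiffOn 𝕜 ∞
        (fun p => (fderiv 𝕜 φ p).comp (ContinuousLinearMap.inl 𝕜 V 𝕜)) O :=
      ((hφ.fderiv_of_isOpen hO (by simp)).clm_comp contDiffOn_const)
    exact (ih h2).congr fun s hs => (hd s hs).fderiv

end ParametricIntegral

/-- A smooth function has a smooth primitive in the `k`-th variable. It is the integral along the
segment in the direction of the `k`-th axis, which for `𝕜 = ℂ` is holomorphic because the integrand
depends holomorphically on all its variables. -/
theorem exists_contDiffOn_partial_primitive {𝕜 : Type*} [RCLike 𝕜] {n : ℕ} (k : Fin n)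
    {s₀ : Fin n → 𝕜} {φ : (Fin n → 𝕜) → 𝕜} {δ : ℝ}
    (hφ : ContDiffOn 𝕜 ∞ φ (Metric.ball s₀ δ)) :
    ∃ W : (Fin n → 𝕜) → 𝕜, ContDiffOn 𝕜 ∞ W (Metric.ball s₀ δ) ∧
      ∀ s ∈ Metric.ball s₀ δ, fderiv 𝕜 W s (Pi.single k 1) = φ s := by
  -- `γ (s, r)` runs, for `r` from `0` to `1`, parallel to the `k`-th axis up to `s`, starting at
  -- the point with `k`-th coordinate `s₀ k`.
  set γ : (Fin n → 𝕜) × 𝕜 → (Fin n → 𝕜) := fun p =>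
    p.1 - ((1 - p.2) * (p.1 k - s₀ k)) • (Pi.single k 1 : Fin n → 𝕜) with hγ
  have hγs : ContDiff 𝕜 ∞ γ := by
    have : ContDiff 𝕜 ∞ fun p : (Fin n → 𝕜) × 𝕜 => p.1 k :=
      (contDiff_apply 𝕜 𝕜 k).comp contDiff_fst
    fun_prop
  set Φ : (Fin n → 𝕜) × 𝕜 → 𝕜 := fun p => (p.1 k - s₀ k) * φ (γ p) with hΦ
  have hO : IsOpen (γ ⁻¹' Metric.ball s₀ δ) := Metric.isOpen_ball.preimage hγs.continuous
  have hUO : ∀ s ∈ Metric.ball s₀ δ, ∀ r ∈ Icc (0 : ℝ) 1,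
      (s, (r : 𝕜)) ∈ γ ⁻¹' Metric.ball s₀ δ := by
    intro s hs r hr
    have hδ : 0 < δ := Metric.pos_of_mem_ball hs
    rw [mem_preimage, mem_ball_iff_norm, pi_norm_lt_iff hδ]
    rw [mem_ball_iff_norm, pi_norm_lt_iff hδ] at hs
    intro j
    by_cases hj : j = k
    · subst hj
      have h1 : (γ (s, (r : 𝕜)) - s₀) j = (r : 𝕜) * (s - s₀) j := by
        simp [hγ]; ring
      rw [h1, norm_mul, RCLike.norm_ofReal, abs_of_nonneg hr.1]
      exact (mul_le_of_le_one_left (norm_nonneg _) hr.2).trans_lt (hs j)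
    · have h1 : (γ (s, (r : 𝕜)) - s₀) j = (s - s₀) j := by
        simp [hγ, hj]
      rw [h1]; exact hs j
  have hΦs : ContDiffOn 𝕜 ∞ Φ (γ ⁻¹' Metric.ball s₀ δ) := by
    have h1 : ContDiff 𝕜 ∞ fun p : (Fin n → 𝕜) × 𝕜 => p.1 k - s₀ k :=
      ((contDiff_apply 𝕜 𝕜 k).comp contDiff_fst).sub contDiff_const
    exact h1.contDiffOn.mul (hφ.comp hγs.contDiffOn fun p hp => hp)
  refine ⟨fun s => ∫ r in (0 : ℝ)..1, Φ (s, (r : 𝕜)), ?_, ?_⟩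
  · rw [contDiffOn_infty]
    exact fun m => contDiffOn_integral Metric.isOpen_ball hO hUO m hΦs
  intro s hs
  have h0 := hasFDerivAt_integral_of_contDiffOn Metric.isOpen_ball hO hUO
    (hΦs.of_le (show (1 : ℕ∞ω) ≤ ∞ by simp)) hs
  -- The derivative of the integrand is the derivative of `r ↦ r φ(γ(s, r))`.
  have hder : ∀ r ∈ Icc (0 : ℝ) 1, HasDerivAt (fun r : ℝ => (r : 𝕜) * φ (γ (s, (r : 𝕜))))
      (fderiv 𝕜 Φ (s, (r : 𝕜)) (Pi.single k 1, 0)) r := by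
    intro r hr
    have hφd : HasFDerivAt φ (fderiv 𝕜 φ (γ (s, (r : 𝕜)))) (γ (s, (r : 𝕜))) :=
      ((hφ.contDiffAt (Metric.isOpen_ball.mem_nhds (hUO s hs r hr))).differentiableAt
        (by simp)).hasFDerivAt
    have hγ1 : HasFDerivAt γ (fderiv 𝕜 γ (s, (r : 𝕜))) (s, (r : 𝕜)) :=
      (hγs.differentiable (by simp) _).hasFDerivAt
    have hk : HasFDerivAt (fun p : (Fin n → 𝕜) × 𝕜 => p.1 k - s₀ k)
        ((ContinuousLinearMap.proj k).comp (ContinuousLinearMap.fst 𝕜 (Fin n → 𝕜) 𝕜))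
        (s, (r : 𝕜)) :=
      ((ContinuousLinearMap.proj k).comp
        (ContinuousLinearMap.fst 𝕜 (Fin n → 𝕜) 𝕜)).hasFDerivAt.sub_const _
    have hΦd := hk.mul (hφd.comp _ hγ1)
    have hγk : fderiv 𝕜 γ (s, (r : 𝕜)) (Pi.single k 1, 0) = (r : 𝕜) • Pi.single k 1 := by
      have h2 : HasDerivAt (fun t : 𝕜 => γ ((s, (r : 𝕜)) + t • (Pi.single k 1, 0)))
          ((r : 𝕜) • (Pi.single k 1 : Fin n → 𝕜)) 0 := by
        have h3 : (fun t : 𝕜 => γ ((s, (r : 𝕜)) + t • (Pi.single k 1, 0))) =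
            fun t => γ (s, (r : 𝕜)) + t • ((r : 𝕜) • (Pi.single k 1 : Fin n → 𝕜)) := by
          funext t
          simp only [hγ, Prod.fst_add, Prod.smul_fst, Prod.snd_add, Prod.smul_snd,
            Pi.add_apply, Pi.smul_apply, Pi.single_eq_same, smul_eq_mul, mul_one]
          module
        rw [h3]
        simpa using ((hasDerivAt_id (0 : 𝕜)).smul_const
          ((r : 𝕜) • (Pi.single k 1 : Fin n → 𝕜))).const_add (γ (s, (r : 𝕜)))
      exact (HasFDerivAt.hasLineDerivAt hγ1 _).unique h2
    have hγr : fderiv 𝕜 γ (s, (r : 𝕜)) (0, 1) = (s k - s₀ k) • Pi.single k 1 := by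
      have h2 : HasDerivAt (fun t : 𝕜 => γ ((s, (r : 𝕜)) + t • (0, 1)))
          ((s k - s₀ k) • (Pi.single k 1 : Fin n → 𝕜)) 0 := by
        have h3 : (fun t : 𝕜 => γ ((s, (r : 𝕜)) + t • (0, 1))) =
            fun t => γ (s, (r : 𝕜)) + t • ((s k - s₀ k) • (Pi.single k 1 : Fin n → 𝕜)) := by
          funext t
          simp only [hγ, Prod.fst_add, Prod.smul_fst, Prod.snd_add, Prod.smul_snd, smul_zero,
            add_zero, smul_eq_mul, mul_one]
          module
        rw [h3]
        simpa using ((hasDerivAt_id (0 : 𝕜)).smul_const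
          ((s k - s₀ k) • (Pi.single k 1 : Fin n → 𝕜))).const_add (γ (s, (r : 𝕜)))
      exact (HasFDerivAt.hasLineDerivAt hγ1 _).unique h2
    have hr1 : HasDerivAt (fun r : ℝ => (s, (r : 𝕜))) ((0, 1) : (Fin n → 𝕜) × 𝕜) r :=
      (hasDerivAt_const r s).prodMk
        (by simpa using (RCLike.ofRealCLM (K := 𝕜)).hasDerivAt (x := r))
    have hr2 : HasDerivAt (fun r : ℝ => φ (γ (s, (r : 𝕜))))
        (((fderiv 𝕜 φ (γ (s, (r : 𝕜)))).comp (fderiv 𝕜 γ (s, (r : 𝕜)))) (0, 1)) r := by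
      have h2 : HasFDerivAt (φ ∘ γ) _ (s, (r : 𝕜)) := hφd.comp _ hγ1
      exact (h2.restrictScalars ℝ).comp_hasDerivAt r hr1
    have hr3 : HasDerivAt (fun r : ℝ => (r : 𝕜)) 1 r := by
      simpa using (RCLike.ofRealCLM (K := 𝕜)).hasDerivAt (x := r)
    refine (hr3.mul hr2).congr_deriv ?_
    rw [show fderiv 𝕜 Φ (s, (r : 𝕜)) = _ from hΦd.fderiv]
    simp only [ContinuousLinearMap.comp_apply, hγr, map_smul, _root_.add_apply,
      _root_.smul_apply, hγk, smul_eq_mul, ContinuousLinearMap.coe_fst',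
      ContinuousLinearMap.proj_apply, Pi.single_eq_same, Function.comp_apply]
    ring
  have hcont : ContinuousOn
      (fun r : ℝ => (fderiv 𝕜 Φ (s, (r : 𝕜))).comp (ContinuousLinearMap.inl 𝕜 (Fin n → 𝕜) 𝕜))
      (Icc 0 1) :=
    ((hΦs.continuousOn_fderiv_of_isOpen hO (by simp)).clm_comp continuousOn_const).comp
      (continuous_const.prodMk RCLike.continuous_ofReal).continuousOn fun r hr => hUO s hs r hr
  have hI : IntervalIntegrable
      (fun r : ℝ => (fderiv 𝕜 Φ (s, (r : 𝕜))).comp (ContinuousLinearMap.inl 𝕜 (Fin n → 𝕜) 𝕜))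
      MeasureTheory.volume 0 1 := ContinuousOn.intervalIntegrable (by simpa using hcont)
  rw [h0.fderiv, ContinuousLinearMap.intervalIntegral_apply hI]
  have hI' : IntervalIntegrable (fun r : ℝ => fderiv 𝕜 Φ (s, (r : 𝕜)) (Pi.single k 1, 0))
      MeasureTheory.volume 0 1 :=
    ContinuousOn.intervalIntegrable (by simpa using hcont.clm_apply continuousOn_const)
  have := intervalIntegral.integral_eq_sub_of_hasDerivAt
    (fun r hr => hder r (by simpa using hr)) hI'
  simpa [hγ] using this

/-! ### Linear algebra -/

/-- The image of `v ↦ (P v, Q v)` is assumed isotropic for the standard symplectic form. Then some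
coordinate Lagrangian subspace is transverse to it: the coordinates `Q_j`, `j ∈ I`, and
`P_j`, `j ∉ I`, are injective on the image. The set `I` indexes a basis among the restrictions of
the `Q_j` to the kernel of `P`. -/
theorem exists_coordinate_lagrangian {K V : Type*} [Field K] [AddCommGroup V] [Module K V] {n : ℕ}
    (P Q : V →ₗ[K] (Fin n → K))
    (h : ∀ v w, ∑ j, P w j * Q v j = ∑ j, P v j * Q w j) :
    ∃ I : Set (Fin n), ∀ v, (∀ j ∈ I, Q v j = 0) → (∀ j ∉ I, P v j = 0) → Q v = 0 ∧ P v = 0 := by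
  classical
  set e : Fin n → (LinearMap.ker P →ₗ[K] K) := fun j =>
    (LinearMap.proj j ∘ₗ Q) ∘ₗ (LinearMap.ker P).subtype with he
  obtain ⟨κ, a, ha, hspan, hli⟩ := exists_linearIndependent' K e
  refine ⟨range a, fun v hQ hP => ?_⟩
  have hPv : P v = 0 := by
    have : Finite κ := Finite.of_injective a ha
    have := Fintype.ofFinite κ
    have h0 : ∑ i, P v (a i) • (e ∘ a) i = 0 := by
      ext ⟨u, hu⟩
      have hu' : P u = 0 := hu
      have h1 := h v u
      simp only [hu', Pi.zero_apply, zero_mul, Finset.sum_const_zero] at h1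
      have h2 : ∑ j, P v j * Q u j = ∑ i, P v (a i) * Q u (a i) := by
        rw [← Finset.sum_image (s := Finset.univ) (g := a) (f := fun j => P v j * Q u j)
          (fun _ _ _ _ hij => ha hij)]
        refine (Finset.sum_subset (Finset.subset_univ _) fun j _ hj => ?_).symm
        rw [hP j (by simpa using hj), zero_mul]
      rw [h2] at h1
      simpa [he, LinearMap.sum_apply] using h1.symm
    funext j
    by_cases hj : j ∈ range a
    · obtain ⟨i, rfl⟩ := hj
      exact Fintype.linearIndependent_iff.1 hli _ h0 i
    · exact hP j hj
  refine ⟨?_, hPv⟩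
  have hle : Submodule.span K (range e) ≤
      LinearMap.ker (LinearMap.applyₗ (R := K) (M₂ := K) (⟨v, hPv⟩ : LinearMap.ker P)) := by
    rw [← hspan, Submodule.span_le]
    rintro _ ⟨i, rfl⟩
    exact hQ (a i) ⟨i, rfl⟩
  funext j
  exact hle (Submodule.subset_span ⟨j, rfl⟩)

/-- If the kernel of `A` is at most one-dimensional, all components of `A` but one can be completed
to a coordinate system by a single linear functional `l`. -/
theorem exists_complementing_functional {K : Type*} [Field K] {m : ℕ}
    (A : (Fin (m + 1) → K) →ₗ[K] (Fin (m + 1) → K))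
    (hA : Module.finrank K (LinearMap.ker A) ≤ 1) :
    ∃ (k : Fin (m + 1)) (l : (Fin (m + 1) → K) →ₗ[K] K),
      ∀ v, (∀ j ≠ k, A v j = 0) → l v = 0 → v = 0 := by
  by_cases hbot : LinearMap.ker A = ⊥
  · refine ⟨0, LinearMap.proj 0 ∘ₗ A, fun v h1 h2 => ?_⟩
    refine LinearMap.ker_eq_bot'.1 hbot v (funext fun j => ?_)
    by_cases hj : j = 0
    · rw [hj]; exact h2
    · exact h1 j hj
  have hr : LinearMap.range A < ⊤ := by
    refine lt_top_iff_ne_top.2 fun h => hbot ?_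
    exact LinearMap.ker_eq_bot.2 (LinearMap.injective_iff_surjective.2 (LinearMap.range_eq_top.1 h))
  -- A relation `lam` between the components of `A` expresses the `k`-th one through the others.
  obtain ⟨lam, hlam, hle⟩ := Submodule.exists_le_ker_of_lt_top _ hr
  have hk : ∃ k, lam (Pi.single k 1) ≠ 0 := by
    by_contra! hc
    refine hlam (LinearMap.pi_ext' fun k => LinearMap.ext_ring ?_)
    simpa using hc k
  obtain ⟨k, hk⟩ := hk
  have h1 : Module.finrank K (LinearMap.ker A) = 1 := by
    refine le_antisymm hA (Nat.one_le_iff_ne_zero.2 fun h => hbot ?_)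
    exact Submodule.finrank_eq_zero.1 h
  obtain ⟨⟨v₀, hv₀⟩, hne, hspan⟩ := finrank_eq_one_iff'.1 h1
  have hv₀ne : v₀ ≠ 0 := fun h => hne (Subtype.ext h)
  obtain ⟨i, hi⟩ := Function.ne_iff.1 hv₀ne
  refine ⟨k, LinearMap.proj i, fun v hv hl => ?_⟩
  have hAv : A v = Pi.single k (A v k) := by
    funext j
    by_cases hj : j = k
    · subst hj; simp
    · rw [hv j hj, Pi.single_eq_of_ne hj]
  have h2 : lam (A v) = 0 := hle (LinearMap.mem_range_self A v)
  have h3 : A v k = 0 := by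
    rw [hAv, show (Pi.single k (A v k) : Fin (m + 1) → K) = A v k • Pi.single k 1 by
      rw [← Pi.single_smul]; simp, map_smul, smul_eq_mul] at h2
    exact (mul_eq_zero.1 h2).resolve_right hk
  have h4 : A v = 0 := by rw [hAv, h3, Pi.single_zero]
  obtain ⟨c, hc⟩ := hspan ⟨v, h4⟩
  have hc' : c • v₀ = v := congrArg Subtype.val hc
  have h5 : c * v₀ i = 0 := by
    rw [← hc'] at hl; simpa using hl
  rw [← hc', (mul_eq_zero.1 h5).resolve_right hi, zero_smul]

/-! ### Smooth germs -/

section SmoothGerm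

variable {𝕜 : Type*} [RCLike 𝕜]
  {V : Type*} [NormedAddCommGroup V] [NormedSpace 𝕜 V]
  {W : Type*} [NormedAddCommGroup W] [NormedSpace 𝕜 W]
  {X : Type*} [NormedAddCommGroup X] [NormedSpace 𝕜 X]

theorem IsSmoothGerm.comp {g : W → X} {h : V → W} {x : V}
    (hg : IsSmoothGerm (𝕜 := 𝕜) g (h x)) (hh : IsSmoothGerm (𝕜 := 𝕜) h x) :
    IsSmoothGerm (𝕜 := 𝕜) (fun y => g (h y)) x := by
  have hc := hh.self_of_nhds.continuousAt.eventually hg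
  filter_upwards [hh, hc] with y h1 h2 using h2.comp y h1

theorem IsSmoothGerm.of_contDiff {g : V → W} (hg : ContDiff 𝕜 ∞ g) (x : V) :
    IsSmoothGerm (𝕜 := 𝕜) g x := Eventually.of_forall fun _ => hg.contDiffAt

theorem IsSmoothGerm.congr {g h : V → W} {x : V} (hg : IsSmoothGerm (𝕜 := 𝕜) g x)
    (h1 : h =ᶠ[𝓝 x] g) : IsSmoothGerm (𝕜 := 𝕜) h x := by
  filter_upwards [hg, h1.eventuallyEq_nhds] with y h2 h3 using h2.congr_of_eventuallyEq h3

theorem IsSmoothGerm.continuousAt {g : V → W} {x : V} (hg : IsSmoothGerm (𝕜 := 𝕜) g x) :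
    ContinuousAt g x := hg.self_of_nhds.continuousAt

theorem IsSmoothGerm.differentiableAt {g : V → W} {x : V} (hg : IsSmoothGerm (𝕜 := 𝕜) g x) :
    ∀ᶠ y in 𝓝 x, DifferentiableAt 𝕜 g y := by
  filter_upwards [hg] with y h using h.differentiableAt (by simp)

theorem IsSmoothGerm.add {g h : V → W} {x : V} (hg : IsSmoothGerm (𝕜 := 𝕜) g x)
    (hh : IsSmoothGerm (𝕜 := 𝕜) h x) : IsSmoothGerm (𝕜 := 𝕜) (fun y => g y + h y) x := by
  filter_upwards [hg, hh] with y h1 h2 using h1.add h2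

theorem IsSmoothGerm.sub {g h : V → W} {x : V} (hg : IsSmoothGerm (𝕜 := 𝕜) g x)
    (hh : IsSmoothGerm (𝕜 := 𝕜) h x) : IsSmoothGerm (𝕜 := 𝕜) (fun y => g y - h y) x := by
  filter_upwards [hg, hh] with y h1 h2 using h1.sub h2

theorem IsSmoothGerm.neg {g : V → W} {x : V} (hg : IsSmoothGerm (𝕜 := 𝕜) g x) :
    IsSmoothGerm (𝕜 := 𝕜) (fun y => - g y) x := by
  filter_upwards [hg] with y h1 using h1.neg

theorem IsSmoothGerm.smul {c : V → 𝕜} {g : V → W} {x : V} (hc : IsSmoothGerm (𝕜 := 𝕜) c x)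
    (hg : IsSmoothGerm (𝕜 := 𝕜) g x) : IsSmoothGerm (𝕜 := 𝕜) (fun y => c y • g y) x := by
  filter_upwards [hc, hg] with y h1 h2 using h1.smul h2

theorem IsSmoothGerm.mul {c d : V → 𝕜} {x : V} (hc : IsSmoothGerm (𝕜 := 𝕜) c x)
    (hd : IsSmoothGerm (𝕜 := 𝕜) d x) : IsSmoothGerm (𝕜 := 𝕜) (fun y => c y * d y) x := by
  filter_upwards [hc, hd] with y h1 h2 using h1.mul h2

theorem IsSmoothGerm.sum {ι : Type*} [Fintype ι] {g : ι → V → W} {x : V}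
    (hg : ∀ i, IsSmoothGerm (𝕜 := 𝕜) (g i) x) :
    IsSmoothGerm (𝕜 := 𝕜) (fun y => ∑ i, g i y) x := by
  filter_upwards [eventually_all.2 hg] with y h1
  exact ContDiffAt.sum fun i _ => h1 i

theorem IsSmoothGerm.prodMk {g : V → W} {h : V → X} {x : V} (hg : IsSmoothGerm (𝕜 := 𝕜) g x)
    (hh : IsSmoothGerm (𝕜 := 𝕜) h x) : IsSmoothGerm (𝕜 := 𝕜) (fun y => (g y, h y)) x := by
  filter_upwards [hg, hh] with y h1 h2 using h1.prodMk h2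

theorem isSmoothGerm_pi {ι : Type*} [Fintype ι] {g : V → ι → 𝕜} {x : V} :
    IsSmoothGerm (𝕜 := 𝕜) g x ↔ ∀ i, IsSmoothGerm (𝕜 := 𝕜) (fun y => g y i) x := by
  simp only [IsSmoothGerm, contDiffAt_pi, eventually_all]

theorem IsSmoothGerm.apply {ι : Type*} [Fintype ι] {g : V → ι → 𝕜} {x : V}
    (hg : IsSmoothGerm (𝕜 := 𝕜) g x) (i : ι) : IsSmoothGerm (𝕜 := 𝕜) (fun y => g y i) x :=
  isSmoothGerm_pi.1 hg i

theorem IsSmoothGerm.fderiv {g : V → W} {x : V} (hg : IsSmoothGerm (𝕜 := 𝕜) g x) :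
    IsSmoothGerm (𝕜 := 𝕜) (fderiv 𝕜 g) x := by
  filter_upwards [hg] with y h1 using h1.fderiv_right (by simp)

theorem IsSmoothGerm.clm_apply {A : V → W →L[𝕜] X} {g : V → W} {x : V}
    (hA : IsSmoothGerm (𝕜 := 𝕜) A x) (hg : IsSmoothGerm (𝕜 := 𝕜) g x) :
    IsSmoothGerm (𝕜 := 𝕜) (fun y => A y (g y)) x := by
  filter_upwards [hA, hg] with y h1 h2 using h1.clm_apply h2

theorem fderiv_coord {ι : Type*} [Fintype ι] {g : V → ι → 𝕜} {x : V}
    (hg : DifferentiableAt 𝕜 g x) (i : ι) (v : V) :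
    fderiv 𝕜 (fun y => g y i) x v = fderiv 𝕜 g x v i := by
  rw [(hasFDerivAt_pi'.1 hg.hasFDerivAt i).fderiv]
  rfl

end SmoothGerm

/-! ### Reparametrised quadratic families -/

section Reparametrisation

variable {𝕜 : Type*} [RCLike 𝕜]
  {V : Type*} [NormedAddCommGroup V] [NormedSpace 𝕜 V]
  {E : Type*} [NormedAddCommGroup E] [NormedSpace 𝕜 E]

/-- The reparametrisations `x ↦ x + t a(x)` generated by the vector field `a`. -/
def shift (a : V → V) (p : V × 𝕜) : V := p.1 + p.2 • a p.1

/-- The family `h + t h₁ + t² h₂`, quadratic in `t`, reparametrised by `x ↦ x + t a(x)`. -/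
def quadFamily (a : V → V) (h h₁ h₂ : V → E) (p : V × 𝕜) : E :=
  h (shift a p) + p.2 • h₁ (shift a p) + p.2 ^ 2 • h₂ (shift a p)

theorem shift_zero_right (a : V → V) (x : V) : shift a (x, (0 : 𝕜)) = x := by simp [shift]

theorem isSmoothGerm_shift {a : V → V} {x : V} (ha : IsSmoothGerm (𝕜 := 𝕜) a x) :
    IsSmoothGerm (𝕜 := 𝕜) (shift a : V × 𝕜 → V) (x, 0) := by
  have h1 : IsSmoothGerm (𝕜 := 𝕜) (fun p : V × 𝕜 => p.1) (x, 0) := .of_contDiff contDiff_fst _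
  have h2 : IsSmoothGerm (𝕜 := 𝕜) (fun p : V × 𝕜 => p.2) (x, 0) := .of_contDiff contDiff_snd _
  have h3 : IsSmoothGerm (𝕜 := 𝕜) (fun p : V × 𝕜 => a p.1) (x, 0) := IsSmoothGerm.comp ha h1
  exact h1.add (h2.smul h3)

theorem tendsto_shift {a : V → V} {x : V} (ha : IsSmoothGerm (𝕜 := 𝕜) a x) :
    Tendsto (shift a : V × 𝕜 → V) (𝓝 (x, 0)) (𝓝 x) := by
  have := (isSmoothGerm_shift ha).continuousAt
  rwa [ContinuousAt, shift_zero_right] at this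

variable {a : V → V} {h h₁ h₂ : V → E}

theorem quadFamily_zero_right (x : V) : quadFamily a h h₁ h₂ (x, (0 : 𝕜)) = h x := by
  simp [quadFamily, shift]

theorem isSmoothGerm_quadFamily {x : V} (ha : IsSmoothGerm (𝕜 := 𝕜) a x)
    (hh : IsSmoothGerm (𝕜 := 𝕜) h x) (hh₁ : IsSmoothGerm (𝕜 := 𝕜) h₁ x)
    (hh₂ : IsSmoothGerm (𝕜 := 𝕜) h₂ x) :
    IsSmoothGerm (𝕜 := 𝕜) (quadFamily a h h₁ h₂ : V × 𝕜 → E) (x, 0) := by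
  have hs := isSmoothGerm_shift ha
  have h2 : IsSmoothGerm (𝕜 := 𝕜) (fun p : V × 𝕜 => p.2) (x, 0) := .of_contDiff contDiff_snd _
  have h3 : IsSmoothGerm (𝕜 := 𝕜) (fun p : V × 𝕜 => p.2 ^ 2) (x, 0) :=
    .of_contDiff (contDiff_snd.pow 2) _
  rw [← shift_zero_right (𝕜 := 𝕜) a x] at hh hh₁ hh₂
  exact ((hh.comp hs).add (h2.smul (hh₁.comp hs))).add (h3.smul (hh₂.comp hs))

theorem deriv_quadFamily {x : V} (hh : DifferentiableAt 𝕜 h x) (hh₁ : DifferentiableAt 𝕜 h₁ x)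
    (hh₂ : DifferentiableAt 𝕜 h₂ x) :
    deriv (fun t : 𝕜 => quadFamily a h h₁ h₂ (x, t)) 0 = fderiv 𝕜 h x (a x) + h₁ x := by
  have hs : HasDerivAt (fun t : 𝕜 => shift a (x, t)) (a x) 0 := by
    simpa [shift] using ((hasDerivAt_id (0 : 𝕜)).smul_const (a x)).const_add x
  have hx := shift_zero_right (𝕜 := 𝕜) a x
  have c : ∀ {g : V → E}, DifferentiableAt 𝕜 g x →
      HasDerivAt (fun t : 𝕜 => g (shift a (x, t))) (fderiv 𝕜 g x (a x)) 0 := by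
    intro g hg
    exact HasFDerivAt.comp_hasDerivAt_of_eq (0 : 𝕜) hg.hasFDerivAt hs hx.symm
  have d := ((c hh).add ((hasDerivAt_id (0 : 𝕜)).smul (c hh₁))).add
    (((hasDerivAt_id (0 : 𝕜)).pow 2).smul (c hh₂))
  refine (d.congr_deriv ?_).deriv
  simp [hx]

theorem fderiv_quadFamily {x : V} {t : 𝕜} (ha : DifferentiableAt 𝕜 a x)
    (hh : DifferentiableAt 𝕜 h (shift a (x, t))) (hh₁ : DifferentiableAt 𝕜 h₁ (shift a (x, t)))
    (hh₂ : DifferentiableAt 𝕜 h₂ (shift a (x, t))) (v : V) :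
    fderiv 𝕜 (fun x => quadFamily a h h₁ h₂ (x, t)) x v =
      fderiv 𝕜 h (shift a (x, t)) (v + t • fderiv 𝕜 a x v) +
      t • fderiv 𝕜 h₁ (shift a (x, t)) (v + t • fderiv 𝕜 a x v) +
      t ^ 2 • fderiv 𝕜 h₂ (shift a (x, t)) (v + t • fderiv 𝕜 a x v) := by
  have hs : HasFDerivAt (fun x : V => shift a (x, t))
      (ContinuousLinearMap.id 𝕜 V + t • fderiv 𝕜 a x) x :=
    (hasFDerivAt_id x).add (ha.hasFDerivAt.const_smul t)
  have c : ∀ {g : V → E}, DifferentiableAt 𝕜 g (shift a (x, t)) →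
      HasFDerivAt (fun x : V => g (shift a (x, t)))
        ((fderiv 𝕜 g (shift a (x, t))).comp (ContinuousLinearMap.id 𝕜 V + t • fderiv 𝕜 a x)) x :=
    fun hg => hg.hasFDerivAt.comp x hs
  have d := ((c hh).add ((c hh₁).const_smul t)).add ((c hh₂).const_smul (t ^ 2))
  rw [show fderiv 𝕜 (fun x => quadFamily a h h₁ h₂ (x, t)) x = _ from d.fderiv]
  simp

end Reparametrisation

/-! ### Deformations of solutions of `dU = ∑ x_j dy_j` -/

section Unobstructed

variable {𝕜 : Type*} [RCLike 𝕜] {n : ℕ}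

theorem minSmoothness_two_le : minSmoothness 𝕜 2 ≤ (∞ : ℕ∞ω) := by
  rw [minSmoothness_of_isRCLikeNormedField]
  exact WithTop.coe_le_coe.2 le_top

/-- The second derivative of `U`, computed from `dU = ∑ x_j dy_j`. -/
theorem fderiv_fderiv_of_eq_sum {V : Type*} [NormedAddCommGroup V] [NormedSpace 𝕜 V] {x₀ : V}
    {U : V → 𝕜} {x y : V → Fin n → 𝕜}
    (hU : IsSmoothGerm (𝕜 := 𝕜) U x₀) (hx : IsSmoothGerm (𝕜 := 𝕜) x x₀)
    (hy : IsSmoothGerm (𝕜 := 𝕜) y x₀)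
    (h : ∀ᶠ s in 𝓝 x₀, ∀ v, fderiv 𝕜 U s v = ∑ j, x s j * fderiv 𝕜 y s v j) :
    ∀ᶠ s in 𝓝 x₀, ∀ v w, fderiv 𝕜 (fderiv 𝕜 U) s w v =
      ∑ j, (fderiv 𝕜 x s w j * fderiv 𝕜 y s v j + x s j * fderiv 𝕜 (fderiv 𝕜 y) s w v j) := by
  filter_upwards [h.eventually_nhds, hU.fderiv.differentiableAt, hx.differentiableAt,
    hy.fderiv.differentiableAt] with s hs hU1 hx1 hy1 v w
  have h1 : HasFDerivAt (fun s => fderiv 𝕜 U s v) ((fderiv 𝕜 (fderiv 𝕜 U) s).flip v) s :=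
    hU1.hasFDerivAt.clm_apply (hasFDerivAt_const v s) |>.congr_fderiv (by ext; simp)
  have hyv : HasFDerivAt (fun s => fderiv 𝕜 y s v) ((fderiv 𝕜 (fderiv 𝕜 y) s).flip v) s :=
    hy1.hasFDerivAt.clm_apply (hasFDerivAt_const v s) |>.congr_fderiv (by ext; simp)
  have h2 : HasFDerivAt (fun s => ∑ j, x s j * fderiv 𝕜 y s v j) _ s :=
    HasFDerivAt.fun_sum fun j _ =>
      (hasFDerivAt_pi'.1 hx1.hasFDerivAt j).mul (hasFDerivAt_pi'.1 hyv j)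
  have h3 := h2.congr_of_eventuallyEq (hs.mono fun s' hs' => hs' v)
  have h4 := DFunLike.congr_fun (h1.unique h3) w
  simp only [ContinuousLinearMap.flip_apply] at h4
  rw [h4]
  simp only [_root_.sum_apply]
  refine Finset.sum_congr rfl fun j _ => ?_
  simp
  ring

/-- The form `∑ dx_j ∧ dy_j` vanishes, as `∑ x_j dy_j` is exact. -/
theorem isotropic_of_eq_sum {V : Type*} [NormedAddCommGroup V] [NormedSpace 𝕜 V] {x₀ : V}
    {U : V → 𝕜} {x y : V → Fin n → 𝕜}
    (hU : IsSmoothGerm (𝕜 := 𝕜) U x₀) (hx : IsSmoothGerm (𝕜 := 𝕜) x x₀)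
    (hy : IsSmoothGerm (𝕜 := 𝕜) y x₀)
    (h : ∀ᶠ s in 𝓝 x₀, ∀ v, fderiv 𝕜 U s v = ∑ j, x s j * fderiv 𝕜 y s v j) (v w : V) :
    ∑ j, fderiv 𝕜 x x₀ w j * fderiv 𝕜 y x₀ v j = ∑ j, fderiv 𝕜 x x₀ v j * fderiv 𝕜 y x₀ w j := by
  have h1 := (fderiv_fderiv_of_eq_sum hU hx hy h).self_of_nhds
  have h2 := hU.self_of_nhds.isSymmSndFDerivAt minSmoothness_two_le v w
  have h3 := hy.self_of_nhds.isSymmSndFDerivAt minSmoothness_two_le v w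
  rw [h1, h1, h3, Finset.sum_add_distrib, Finset.sum_add_distrib] at h2
  exact (add_right_cancel h2).symm

/-- The linearised equation is invariant under infinitesimal reparametrisations: it is solved by
`(U' - dU(a), x' - dx(a), y' - dy(a))` if it is solved by `(U', x', y')`. -/
theorem linearised_sub_fderiv_apply {V : Type*} [NormedAddCommGroup V] [NormedSpace 𝕜 V] {x₀ : V}
    {U U' : V → 𝕜} {x y x' y' : V → Fin n → 𝕜} {a : V → V}
    (hU : IsSmoothGerm (𝕜 := 𝕜) U x₀) (hx : IsSmoothGerm (𝕜 := 𝕜) x x₀)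
    (hy : IsSmoothGerm (𝕜 := 𝕜) y x₀) (hU' : IsSmoothGerm (𝕜 := 𝕜) U' x₀)
    (hy' : IsSmoothGerm (𝕜 := 𝕜) y' x₀) (ha : IsSmoothGerm (𝕜 := 𝕜) a x₀)
    (h : ∀ᶠ s in 𝓝 x₀, ∀ v, fderiv 𝕜 U s v = ∑ j, x s j * fderiv 𝕜 y s v j)
    (h' : ∀ᶠ s in 𝓝 x₀, ∀ v, fderiv 𝕜 U' s v =
      ∑ j, (x' s j * fderiv 𝕜 y s v j + x s j * fderiv 𝕜 y' s v j)) :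
    ∀ᶠ s in 𝓝 x₀, ∀ v, fderiv 𝕜 (fun s => U' s - fderiv 𝕜 U s (a s)) s v =
      ∑ j, ((x' s j - fderiv 𝕜 x s (a s) j) * fderiv 𝕜 y s v j +
        x s j * fderiv 𝕜 (fun s => y' s - fderiv 𝕜 y s (a s)) s v j) := by
  filter_upwards [fderiv_fderiv_of_eq_sum hU hx hy h, h, h', hU, hy,
    hU.fderiv.differentiableAt, hy.fderiv.differentiableAt, hU'.differentiableAt,
    hy'.differentiableAt, ha.differentiableAt] with s h2 h1 h'1 hUs hys hU1 hy1 hU'1 hy'1 ha1 v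
  have e1 : HasFDerivAt (fun s => U' s - fderiv 𝕜 U s (a s)) _ s :=
    hU'1.hasFDerivAt.sub (hU1.hasFDerivAt.clm_apply ha1.hasFDerivAt)
  have e2 : HasFDerivAt (fun s => y' s - fderiv 𝕜 y s (a s)) _ s :=
    hy'1.hasFDerivAt.sub (hy1.hasFDerivAt.clm_apply ha1.hasFDerivAt)
  have s1 := hUs.isSymmSndFDerivAt minSmoothness_two_le v (a s)
  have s2 := hys.isSymmSndFDerivAt minSmoothness_two_le v (a s)
  rw [e1.fderiv, e2.fderiv]
  simp only [_root_.sub_apply, _root_.add_apply,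
    ContinuousLinearMap.comp_apply, ContinuousLinearMap.flip_apply, s1, s2, h1, h'1, h2,
    Pi.sub_apply, Pi.add_apply]
  rw [← Finset.sum_add_distrib, ← Finset.sum_sub_distrib]
  exact Finset.sum_congr rfl fun j _ => by ring

theorem isInvertible_of_injective {V : Type*} [NormedAddCommGroup V] [NormedSpace 𝕜 V]
    [FiniteDimensional 𝕜 V] {A : V →L[𝕜] V} (hA : ∀ v, A v = 0 → v = 0) : A.IsInvertible := by
  have hi : Function.Injective A.toLinearMap := (injective_iff_map_eq_zero _).2 hA
  exact ⟨(LinearEquiv.ofInjectiveEndo A.toLinearMap hi).toContinuousLinearEquiv, by ext; simp⟩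

theorem eventually_isInvertible_fderiv {X V : Type*} [TopologicalSpace X] [NormedAddCommGroup V]
    [NormedSpace 𝕜 V] [CompleteSpace V] {A : X → V →L[𝕜] V} {x₀ : X} (hA : ContinuousAt A x₀)
    (h : (A x₀).IsInvertible) : ∀ᶠ x in 𝓝 x₀, (A x).IsInvertible := by
  obtain ⟨e, he⟩ := h
  exact hA.eventually_mem (he ▸ ContinuousLinearEquiv.nhds e)

/-- The inverse function theorem for smooth germs. -/
theorem exists_smooth_localInverse {V : Type*} [NormedAddCommGroup V] [NormedSpace 𝕜 V]
    [FiniteDimensional 𝕜 V] {Φ : V → V} {x₀ : V} (hΦ : IsSmoothGerm (𝕜 := 𝕜) Φ x₀)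
    (hinv : (fderiv 𝕜 Φ x₀).IsInvertible) :
    ∃ Ψ : V → V, IsSmoothGerm (𝕜 := 𝕜) Ψ (Φ x₀) ∧ ∀ᶠ x in 𝓝 x₀, Ψ (Φ x) = x := by
  have := FiniteDimensional.complete 𝕜 V
  have hev := eventually_isInvertible_fderiv hΦ.fderiv.continuousAt hinv
  obtain ⟨e₀, he₀⟩ := hinv
  have hd : HasFDerivAt Φ (e₀ : V →L[𝕜] V) x₀ := by
    rw [he₀]; exact hΦ.differentiableAt.self_of_nhds.hasFDerivAt
  set e := hΦ.self_of_nhds.toOpenPartialHomeomorph Φ hd (by simp) with he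
  have hsrc : x₀ ∈ e.source := hΦ.self_of_nhds.mem_toOpenPartialHomeomorph_source hd (by simp)
  have hcoe : ∀ x, e x = Φ x := fun x => rfl
  refine ⟨e.symm, ?_, ?_⟩
  · have htgt : Φ x₀ ∈ e.target := e.map_source hsrc
    have hc : Tendsto e.symm (𝓝 (Φ x₀)) (𝓝 x₀) := by
      have := e.continuousAt_symm htgt
      rwa [ContinuousAt, ← hcoe, e.left_inv hsrc] at this
    filter_upwards [e.open_target.mem_nhds htgt, hc.eventually hev, hc.eventually hΦ]
      with u hu h1 h2
    obtain ⟨eu, heu⟩ := h1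
    refine e.contDiffAt_symm hu (f₀' := eu) ?_ h2
    rw [heu]
    exact (h2.differentiableAt (by simp)).hasFDerivAt
  · filter_upwards [e.open_source.mem_nhds hsrc] with x hx using e.left_inv hx

theorem clm_apply_eq_sum (A : (Fin n → 𝕜) →L[𝕜] 𝕜) (v : Fin n → 𝕜) :
    A v = ∑ j, A (Pi.single j 1) * v j := by
  conv_lhs => rw [pi_eq_sum_univ' v]
  simp [map_sum, mul_comm]

/-- Integration of `ζ dη` along the curves on which all `Φ_j` with `j ≠ k` are constant: modulo the
differentials of these `Φ_j`, the form `ζ dη` is exact. -/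
theorem exists_primitive_modulo {Φ : (Fin n → 𝕜) → Fin n → 𝕜} {x₀ : Fin n → 𝕜}
    (hΦ : IsSmoothGerm (𝕜 := 𝕜) Φ x₀) (hinv : (fderiv 𝕜 Φ x₀).IsInvertible) (k : Fin n)
    {ζ η : (Fin n → 𝕜) → 𝕜} (hζ : IsSmoothGerm (𝕜 := 𝕜) ζ x₀) (hη : IsSmoothGerm (𝕜 := 𝕜) η x₀) :
    ∃ (W : (Fin n → 𝕜) → 𝕜) (c : (Fin n → 𝕜) → Fin n → 𝕜),
      IsSmoothGerm (𝕜 := 𝕜) W x₀ ∧ IsSmoothGerm (𝕜 := 𝕜) c x₀ ∧ (∀ s, c s k = 0) ∧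
      ∀ᶠ s in 𝓝 x₀, ∀ v, fderiv 𝕜 W s v =
        ζ s * fderiv 𝕜 η s v + ∑ j, c s j * fderiv 𝕜 Φ s v j := by
  obtain ⟨Ψ, hΨ, hΨΦ⟩ := exists_smooth_localInverse hΦ hinv
  have hΨ0 : Ψ (Φ x₀) = x₀ := hΨΦ.self_of_nhds
  have hζ' : IsSmoothGerm (𝕜 := 𝕜) (fun u => ζ (Ψ u)) (Φ x₀) :=
    IsSmoothGerm.comp (by rwa [hΨ0]) hΨ
  have hη' : IsSmoothGerm (𝕜 := 𝕜) (fun u => η (Ψ u)) (Φ x₀) :=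
    IsSmoothGerm.comp (by rwa [hΨ0]) hΨ
  have hd : ∀ j : Fin n, IsSmoothGerm (𝕜 := 𝕜)
      (fun u => fderiv 𝕜 (fun u => η (Ψ u)) u (Pi.single j 1)) (Φ x₀) :=
    fun j => hη'.fderiv.clm_apply (.of_contDiff contDiff_const _)
  have hg := hζ'.mul (hd k)
  obtain ⟨δ, hδ, hδs⟩ := Metric.eventually_nhds_iff_ball.1 hg
  obtain ⟨W, hW, hWk⟩ := exists_contDiffOn_partial_primitive k (s₀ := Φ x₀) (δ := δ)
    fun u hu => (hδs u hu).contDiffWithinAt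
  have hball : Metric.ball (Φ x₀) δ ∈ 𝓝 (Φ x₀) := Metric.ball_mem_nhds _ hδ
  have hWs : IsSmoothGerm (𝕜 := 𝕜) W (Φ x₀) := by
    filter_upwards [hball] with u hu using hW.contDiffAt (Metric.isOpen_ball.mem_nhds hu)
  have hWd : ∀ j : Fin n, IsSmoothGerm (𝕜 := 𝕜)
      (fun u => fderiv 𝕜 W u (Pi.single j 1)) (Φ x₀) :=
    fun j => hWs.fderiv.clm_apply (.of_contDiff contDiff_const _)
  refine ⟨fun s => W (Φ s), fun s j => if j = k then 0 else
    fderiv 𝕜 W (Φ s) (Pi.single j 1) -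
      ζ (Ψ (Φ s)) * fderiv 𝕜 (fun u => η (Ψ u)) (Φ s) (Pi.single j 1),
    hWs.comp hΦ, isSmoothGerm_pi.2 fun j => ?_, fun s => if_pos rfl, ?_⟩
  · by_cases hj : j = k
    · simp only [hj, if_true]
      exact .of_contDiff contDiff_const _
    · simp only [hj, if_false]
      exact ((hWd j).sub (hζ'.mul (hd j))).comp hΦ
  filter_upwards [hΨΦ.eventually_nhds, hΦ.differentiableAt,
    hΦ.continuousAt.eventually hball, hΦ.continuousAt.eventually hWs.differentiableAt,
    hΦ.continuousAt.eventually hη'.differentiableAt] with s h1 h2 h3 h4 h5 v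
  have e1 : fderiv 𝕜 (fun s => W (Φ s)) s = (fderiv 𝕜 W (Φ s)).comp (fderiv 𝕜 Φ s) :=
    fderiv_comp s h4 h2
  have e2 : fderiv 𝕜 η s = (fderiv 𝕜 (fun u => η (Ψ u)) (Φ s)).comp (fderiv 𝕜 Φ s) := by
    rw [← fderiv_comp s h5 h2]
    refine EventuallyEq.fderiv_eq ?_
    filter_upwards [h1] with s' h
    simp [h]
  rw [e1, e2, ContinuousLinearMap.comp_apply, ContinuousLinearMap.comp_apply, clm_apply_eq_sum,
    clm_apply_eq_sum (fderiv 𝕜 (fun u => η (Ψ u)) (Φ s)), Finset.mul_sum,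
    ← Finset.sum_add_distrib]
  refine Finset.sum_congr rfl fun j _ => ?_
  by_cases hj : j = k
  · subst hj
    rw [hWk _ h3, h1.self_of_nhds]
    simp
    ring
  · simp only [hj, if_false, h1.self_of_nhds]
    ring

/-- The quadratic corrections `W` and `c` turn an infinitesimal deformation into a family of
solutions of `dU = ∑ x_j dy_j`. With `U₁ = U' - dU(a)` and likewise `x₁`, `y₁`, the family is
`U + t U₁ + t² W`, `x + t x₁ + t² c`, `y + t y₁`, composed with `s ↦ s + t a(s)`. The equation
holds in order `t²` by `hWc` and in order `t³` by `hcy`. -/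
theorem exists_family_of_quadratic_correction {U U' W : (Fin n → 𝕜) → 𝕜}
    {x y x' y' c : (Fin n → 𝕜) → Fin n → 𝕜} {a : (Fin n → 𝕜) → Fin n → 𝕜}
    (hU : IsSmoothGerm (𝕜 := 𝕜) U 0) (hx : IsSmoothGerm (𝕜 := 𝕜) x 0)
    (hy : IsSmoothGerm (𝕜 := 𝕜) y 0) (hU' : IsSmoothGerm (𝕜 := 𝕜) U' 0)
    (hx' : IsSmoothGerm (𝕜 := 𝕜) x' 0) (hy' : IsSmoothGerm (𝕜 := 𝕜) y' 0)
    (hW : IsSmoothGerm (𝕜 := 𝕜) W 0) (hc : IsSmoothGerm (𝕜 := 𝕜) c 0)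
    (ha : IsSmoothGerm (𝕜 := 𝕜) a 0)
    (h : ∀ᶠ s in 𝓝 0, ∀ v, fderiv 𝕜 U s v = ∑ j, x s j * fderiv 𝕜 y s v j)
    (h' : ∀ᶠ s in 𝓝 0, ∀ v, fderiv 𝕜 U' s v =
      ∑ j, (x' s j * fderiv 𝕜 y s v j + x s j * fderiv 𝕜 y' s v j))
    (hWc : ∀ᶠ s in 𝓝 0, ∀ v, fderiv 𝕜 W s v =
      ∑ j, ((x' s j - fderiv 𝕜 x s (a s) j) *
        fderiv 𝕜 (fun s => y' s - fderiv 𝕜 y s (a s)) s v j + c s j * fderiv 𝕜 y s v j))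
    (hcy : ∀ᶠ s in 𝓝 0, ∀ v,
      ∑ j, c s j * fderiv 𝕜 (fun s => y' s - fderiv 𝕜 y s (a s)) s v j = 0) :
    ∃ (Ut : (Fin n → 𝕜) × 𝕜 → 𝕜) (xt yt : (Fin n → 𝕜) × 𝕜 → Fin n → 𝕜),
      IsSmoothGerm (𝕜 := 𝕜) Ut 0 ∧ IsSmoothGerm (𝕜 := 𝕜) xt 0 ∧ IsSmoothGerm (𝕜 := 𝕜) yt 0 ∧
      (∀ s, Ut (s, 0) = U s ∧ xt (s, 0) = x s ∧ yt (s, 0) = y s) ∧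
      (∀ᶠ s in 𝓝 0, deriv (fun t => Ut (s, t)) 0 = U' s ∧ deriv (fun t => xt (s, t)) 0 = x' s ∧
        deriv (fun t => yt (s, t)) 0 = y' s) ∧
      ∀ᶠ p in 𝓝 (0 : (Fin n → 𝕜) × 𝕜), ∀ v, fderiv 𝕜 (fun s => Ut (s, p.2)) p.1 v =
        ∑ j, xt p j * fderiv 𝕜 (fun s => yt (s, p.2)) p.1 v j := by
  have hU₁ := hU'.sub (hU.fderiv.clm_apply ha)
  have hx₁ := hx'.sub (hx.fderiv.clm_apply ha)
  have hy₁ := hy'.sub (hy.fderiv.clm_apply ha)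
  have h0 : IsSmoothGerm (𝕜 := 𝕜) (fun _ : Fin n → 𝕜 => (0 : Fin n → 𝕜)) 0 :=
    .of_contDiff contDiff_const _
  have hlin := linearised_sub_fderiv_apply hU hx hy hU' hy' ha h h'
  refine ⟨quadFamily a U (fun s => U' s - fderiv 𝕜 U s (a s)) W,
    quadFamily a x (fun s => x' s - fderiv 𝕜 x s (a s)) c,
    quadFamily a y (fun s => y' s - fderiv 𝕜 y s (a s)) (fun _ => 0),
    isSmoothGerm_quadFamily ha hU hU₁ hW, isSmoothGerm_quadFamily ha hx hx₁ hc,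
    isSmoothGerm_quadFamily ha hy hy₁ h0, fun s => ⟨quadFamily_zero_right s,
    quadFamily_zero_right s, quadFamily_zero_right s⟩, ?_, ?_⟩
  · filter_upwards [hU.differentiableAt, hx.differentiableAt, hy.differentiableAt,
      hU₁.differentiableAt, hx₁.differentiableAt, hy₁.differentiableAt, hW.differentiableAt,
      hc.differentiableAt, h0.differentiableAt] with s h1 h2 h3 h4 h5 h6 h7 h8 h9
    rw [deriv_quadFamily h1 h4 h7, deriv_quadFamily h2 h5 h8, deriv_quadFamily h3 h6 h9]
    simp
  · have hsh := tendsto_shift ha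
    have hfst : Tendsto (Prod.fst : (Fin n → 𝕜) × 𝕜 → _) (𝓝 ((0 : Fin n → 𝕜), (0 : 𝕜))) (𝓝 0) :=
      continuous_fst.continuousAt
    filter_upwards [hfst.eventually ha.differentiableAt, hsh.eventually hU.differentiableAt,
      hsh.eventually hy.differentiableAt, hsh.eventually hU₁.differentiableAt,
      hsh.eventually hy₁.differentiableAt, hsh.eventually hW.differentiableAt,
      hsh.eventually h0.differentiableAt, hsh.eventually h, hsh.eventually hlin,
      hsh.eventually hWc, hsh.eventually hcy] with p h1 h2 h3 h4 h5 h6 h7 e1 e2 e3 e4 v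
    obtain ⟨s, t⟩ := p
    simp only [fderiv_quadFamily h1 h2 h4 h6, fderiv_quadFamily h1 h3 h5 h7, e1, e2, e3]
    -- What remains after the orders `0`, `1` and `2` have cancelled is the term `t³ ∑ c_j dy₁_j`.
    have e5 := e4 (v + t • fderiv 𝕜 a s v)
    generalize v + t • fderiv 𝕜 a s v = v' at e5 ⊢
    rw [← sub_eq_zero, ← neg_eq_zero, ← mul_zero (t ^ 3), ← e5]
    simp only [quadFamily, smul_eq_mul, Finset.mul_sum, ← Finset.sum_add_distrib,
      ← Finset.sum_sub_distrib, ← Finset.sum_neg_distrib]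
    refine Finset.sum_congr rfl fun j _ => ?_
    simp
    ring

/-- In corank at most one every infinitesimal deformation of a solution of `dU = ∑ x_j dy_j`
is the velocity of a family of solutions. -/
theorem exists_family_of_finrank_ker_le_one {U U' : (Fin n → 𝕜) → 𝕜}
    {x y x' y' : (Fin n → 𝕜) → Fin n → 𝕜}
    (hU : IsSmoothGerm (𝕜 := 𝕜) U 0) (hx : IsSmoothGerm (𝕜 := 𝕜) x 0)
    (hy : IsSmoothGerm (𝕜 := 𝕜) y 0) (hU' : IsSmoothGerm (𝕜 := 𝕜) U' 0)
    (hx' : IsSmoothGerm (𝕜 := 𝕜) x' 0) (hy' : IsSmoothGerm (𝕜 := 𝕜) y' 0)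
    (h : ∀ᶠ s in 𝓝 0, ∀ v, fderiv 𝕜 U s v = ∑ j, x s j * fderiv 𝕜 y s v j)
    (h' : ∀ᶠ s in 𝓝 0, ∀ v, fderiv 𝕜 U' s v =
      ∑ j, (x' s j * fderiv 𝕜 y s v j + x s j * fderiv 𝕜 y' s v j))
    (hker : Module.finrank 𝕜 (LinearMap.ker (fderiv 𝕜 y 0).toLinearMap) ≤ 1) :
    ∃ (Ut : (Fin n → 𝕜) × 𝕜 → 𝕜) (xt yt : (Fin n → 𝕜) × 𝕜 → Fin n → 𝕜),
      IsSmoothGerm (𝕜 := 𝕜) Ut 0 ∧ IsSmoothGerm (𝕜 := 𝕜) xt 0 ∧ IsSmoothGerm (𝕜 := 𝕜) yt 0 ∧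
      (∀ s, Ut (s, 0) = U s ∧ xt (s, 0) = x s ∧ yt (s, 0) = y s) ∧
      (∀ᶠ s in 𝓝 0, deriv (fun t => Ut (s, t)) 0 = U' s ∧ deriv (fun t => xt (s, t)) 0 = x' s ∧
        deriv (fun t => yt (s, t)) 0 = y' s) ∧
      ∀ᶠ p in 𝓝 (0 : (Fin n → 𝕜) × 𝕜), ∀ v, fderiv 𝕜 (fun s => Ut (s, p.2)) p.1 v =
        ∑ j, xt p j * fderiv 𝕜 (fun s => yt (s, p.2)) p.1 v j := by
  have hz : ∀ m : ℕ, IsSmoothGerm (𝕜 := 𝕜) (fun _ : Fin n → 𝕜 => (0 : Fin m → 𝕜)) 0 :=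
    fun m => .of_contDiff contDiff_const _
  cases n with
  | zero =>
    refine exists_family_of_quadratic_correction hU hx hy hU' hx' hy' (W := fun _ => 0)
      (.of_contDiff contDiff_const _) (hz 0) (hz 0) h h' ?_ ?_ <;> simp
  | succ m =>
    obtain ⟨k, l, hkl⟩ := exists_complementing_functional (fderiv 𝕜 y 0).toLinearMap hker
    -- The coordinate system formed by the `y_j` with `j ≠ k` and by `l`.
    set Φ : (Fin (m + 1) → 𝕜) → Fin (m + 1) → 𝕜 := fun s => Function.update (y s) k (l s) with hΦ
    have hl : ∀ s, HasFDerivAt (fun s => l s) (LinearMap.toContinuousLinearMap l) s :=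
      fun s => (LinearMap.toContinuousLinearMap l).hasFDerivAt
    have hΦs : IsSmoothGerm (𝕜 := 𝕜) Φ 0 := by
      refine isSmoothGerm_pi.2 fun j => ?_
      by_cases hj : j = k
      · subst hj
        simp only [hΦ, Function.update_self]
        exact .of_contDiff (LinearMap.toContinuousLinearMap l).contDiff _
      · simp only [hΦ, Function.update_of_ne hj]
        exact hy.apply j
    have hdΦ : ∀ᶠ s in 𝓝 (0 : Fin (m + 1) → 𝕜), ∀ v,
        fderiv 𝕜 Φ s v = Function.update (fderiv 𝕜 y s v) k (l v) := by
      filter_upwards [hΦs.differentiableAt, hy.differentiableAt] with s h1 h2 v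
      funext j
      rw [← fderiv_coord h1]
      by_cases hj : j = k
      · subst hj
        simp only [hΦ, Function.update_self]
        rw [(hl s).fderiv]
        rfl
      · simp only [hΦ, Function.update_of_ne hj]
        exact fderiv_coord h2 j v
    have hinv : (fderiv 𝕜 Φ 0).IsInvertible := by
      refine isInvertible_of_injective fun v hv => ?_
      rw [hdΦ.self_of_nhds] at hv
      refine hkl v (fun j hj => ?_) ?_
      · simpa [hj] using congrFun hv j
      · simpa using congrFun hv k
    have hev := eventually_isInvertible_fderiv hΦs.fderiv.continuousAt hinv
    -- Reparametrising by `a` reduces to infinitesimal deformations that fix `y_j`, `j ≠ k`.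
    set a : (Fin (m + 1) → 𝕜) → Fin (m + 1) → 𝕜 := fun s => (fderiv 𝕜 Φ s).inverse (y' s) with ha'
    have ha : IsSmoothGerm (𝕜 := 𝕜) a 0 := by
      filter_upwards [hev, hΦs.fderiv, hy'] with s h1 h2 h3
      exact (h1.contDiffAt_map_inverse.comp s h2).clm_apply h3
    have hay : ∀ᶠ s in 𝓝 (0 : Fin (m + 1) → 𝕜), ∀ j ≠ k,
        y' s j - fderiv 𝕜 y s (a s) j = 0 := by
      filter_upwards [hev, hdΦ] with s h1 h2 j hj
      have h3 := congrFun (h1.self_apply_inverse (y' s)) j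
      rw [h2, Function.update_of_ne hj] at h3
      rw [← h3, sub_self]
    have hx₁ := hx'.sub (hx.fderiv.clm_apply ha)
    have hy₁ := hy'.sub (hy.fderiv.clm_apply ha)
    obtain ⟨W, c, hW, hc, hck, hWc⟩ :=
      exists_primitive_modulo hΦs hinv k (hx₁.apply k) (hy₁.apply k)
    have hay' : ∀ᶠ s in 𝓝 (0 : Fin (m + 1) → 𝕜), ∀ j ≠ k, ∀ v,
        fderiv 𝕜 (fun s => y' s - fderiv 𝕜 y s (a s)) s v j = 0 := by
      filter_upwards [hay.eventually_nhds, hy₁.differentiableAt] with s h1 h2 j hj v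
      rw [← fderiv_coord h2]
      have h3 : (fun s => (y' s - fderiv 𝕜 y s (a s)) j) =ᶠ[𝓝 s] fun _ => 0 := by
        filter_upwards [h1] with s' h using h j hj
      rw [h3.fderiv_eq]
      simp
    refine exists_family_of_quadratic_correction hU hx hy hU' hx' hy' hW hc ha h h' ?_ ?_
    · filter_upwards [hWc, hay', hdΦ, hy₁.differentiableAt] with s h1 h2 h3 h4 v
      rw [h1, Finset.sum_add_distrib]
      congr 1
      · rw [Finset.sum_eq_single k (fun j _ hj => by rw [h2 j hj v, mul_zero]) (by simp),
          ← fderiv_coord h4]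
        rfl
      · refine Finset.sum_congr rfl fun j _ => ?_
        by_cases hj : j = k
        · subst hj; simp [hck]
        · rw [h3, Function.update_of_ne hj]
    · filter_upwards [hay'] with s h2 v
      refine Finset.sum_eq_zero fun j _ => ?_
      by_cases hj : j = k
      · subst hj; simp [hck]
      · rw [h2 j hj v, mul_zero]

end Unobstructed

/-! ### Deformations of solutions of `du + ∑ p_j dq_j = 0` -/

section Slices

variable {𝕜 : Type*} [RCLike 𝕜]
  {V : Type*} [NormedAddCommGroup V] [NormedSpace 𝕜 V]
  {W : Type*} [NormedAddCommGroup W] [NormedSpace 𝕜 W]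

theorem tendsto_prodMk_zero {V : Type*} [NormedAddCommGroup V] :
    Tendsto (fun s : V => (s, (0 : 𝕜))) (𝓝 0) (𝓝 0) := by
  have : ContinuousAt (fun s : V => (s, (0 : 𝕜))) 0 := by fun_prop
  exact this

theorem IsSmoothGerm.differentiableAt_snd {g : V × 𝕜 → W} (hg : IsSmoothGerm (𝕜 := 𝕜) g 0) :
    ∀ᶠ s in 𝓝 (0 : V), DifferentiableAt 𝕜 (fun t : 𝕜 => g (s, t)) 0 := by
  filter_upwards [tendsto_prodMk_zero.eventually hg.differentiableAt] with s h
  exact DifferentiableAt.comp (0 : 𝕜) h (by fun_prop)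

theorem IsSmoothGerm.differentiableAt_fst {g : V × 𝕜 → W} (hg : IsSmoothGerm (𝕜 := 𝕜) g 0) :
    ∀ᶠ p in 𝓝 (0 : V × 𝕜), DifferentiableAt 𝕜 (fun s : V => g (s, p.2)) p.1 := by
  filter_upwards [hg.differentiableAt] with p h
  exact DifferentiableAt.comp p.1 (g := g) (f := fun s : V => (s, p.2)) h (by fun_prop)

end Slices

section Legendre

variable {𝕜 : Type*} [RCLike 𝕜] {n : ℕ}
  {V : Type*} [NormedAddCommGroup V] [NormedSpace 𝕜 V]

open Classical in
theorem fderiv_ite_coord {g h : V → Fin n → 𝕜} {s : V} (hg : DifferentiableAt 𝕜 g s)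
    (hh : DifferentiableAt 𝕜 h s) (I : Set (Fin n)) (v : V) :
    fderiv 𝕜 (fun s j => if j ∈ I then g s j else h s j) s v =
      fun j => if j ∈ I then fderiv 𝕜 g s v j else fderiv 𝕜 h s v j := by
  have hd : DifferentiableAt 𝕜 (fun s j => if j ∈ I then g s j else h s j) s := by
    refine differentiableAt_pi.2 fun j => ?_
    by_cases hj : j ∈ I
    · simpa only [hj, if_true] using differentiableAt_pi.1 hg j
    · simpa only [hj, if_false] using differentiableAt_pi.1 hh j
  funext j
  rw [← fderiv_coord hd]
  by_cases hj : j ∈ I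
  · simpa only [hj, if_true] using fderiv_coord hg j v
  · simpa only [hj, if_false] using fderiv_coord hh j v

open Classical in
theorem isSmoothGerm_ite {g h : V → Fin n → 𝕜} {s : V} (hg : IsSmoothGerm (𝕜 := 𝕜) g s)
    (hh : IsSmoothGerm (𝕜 := 𝕜) h s) (I : Set (Fin n)) :
    IsSmoothGerm (𝕜 := 𝕜) (fun s j => if j ∈ I then g s j else h s j) s := by
  refine isSmoothGerm_pi.2 fun j => ?_
  by_cases hj : j ∈ I
  · simpa only [hj, if_true] using hg.apply j
  · simpa only [hj, if_false] using hh.apply j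

open Classical in
/-- The sum of the products `x_j y_j` over the `j` outside `I`. -/
noncomputable def partialDot (I : Set (Fin n)) (x y : Fin n → 𝕜) : 𝕜 :=
  ∑ j, if j ∈ I then 0 else x j * y j

open Classical in
theorem differentiableAt_partialDot {g h : V → Fin n → 𝕜} {s : V} (hg : DifferentiableAt 𝕜 g s)
    (hh : DifferentiableAt 𝕜 h s) (I : Set (Fin n)) :
    DifferentiableAt 𝕜 (fun s => partialDot I (g s) (h s)) s ∧ ∀ v,
    fderiv 𝕜 (fun s => partialDot I (g s) (h s)) s v =
      partialDot I (fderiv 𝕜 g s v) (h s) + partialDot I (g s) (fderiv 𝕜 h s v) := by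
  have h1 : ∀ j, HasFDerivAt (fun s => if j ∈ I then (0 : 𝕜) else g s j * h s j)
      (if j ∈ I then 0 else g s j • ((ContinuousLinearMap.proj j).comp (fderiv 𝕜 h s)) +
        h s j • ((ContinuousLinearMap.proj j).comp (fderiv 𝕜 g s))) s := by
    intro j
    by_cases hj : j ∈ I
    · simpa only [hj, if_true] using hasFDerivAt_const (0 : 𝕜) s
    · simpa only [hj, if_false] using
        (hasFDerivAt_pi'.1 hg.hasFDerivAt j).fun_mul (hasFDerivAt_pi'.1 hh.hasFDerivAt j)
  have h2 : HasFDerivAt (fun s => partialDot I (g s) (h s)) _ s :=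
    HasFDerivAt.fun_sum fun j (_ : j ∈ Finset.univ) => h1 j
  refine ⟨h2.differentiableAt, fun v => ?_⟩
  rw [h2.fderiv, _root_.sum_apply, partialDot, partialDot, ← Finset.sum_add_distrib]
  refine Finset.sum_congr rfl fun j _ => ?_
  by_cases hj : j ∈ I <;> simp [hj]
  ring

theorem isSmoothGerm_partialDot {g h : V → Fin n → 𝕜} {s : V} (hg : IsSmoothGerm (𝕜 := 𝕜) g s)
    (hh : IsSmoothGerm (𝕜 := 𝕜) h s) (I : Set (Fin n)) :
    IsSmoothGerm (𝕜 := 𝕜) (fun s => partialDot I (g s) (h s)) s := by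
  refine IsSmoothGerm.sum fun j => ?_
  by_cases hj : j ∈ I
  · simpa only [hj, if_true] using .of_contDiff contDiff_const _
  · simpa only [hj, if_false] using (hg.apply j).mul (hh.apply j)

open Classical in
/-- In corank at most one every infinitesimal deformation of a solution of `du + ∑ p_j dq_j = 0` is
the velocity of a family of solutions. A Legendre transformation in the pairs `(q_j, p_j)` with `j`
outside a suitable set `I` reduces to `exists_family_of_finrank_ker_le_one`: it replaces `q_j` by
`p_j`, `p_j` by `-q_j` and `-u` by `-u - ∑ p_j q_j`, the sum over `j ∉ I`, and `I` is chosen so that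
the kernel of the new `dy` is that of `(dq, dp)`. -/
theorem exists_family_of_corank_le_one {u u' : (Fin n → 𝕜) → 𝕜}
    {q p q' p' : (Fin n → 𝕜) → Fin n → 𝕜}
    (hu : IsSmoothGerm (𝕜 := 𝕜) u 0) (hq : IsSmoothGerm (𝕜 := 𝕜) q 0)
    (hp : IsSmoothGerm (𝕜 := 𝕜) p 0) (hu' : IsSmoothGerm (𝕜 := 𝕜) u' 0)
    (hq' : IsSmoothGerm (𝕜 := 𝕜) q' 0) (hp' : IsSmoothGerm (𝕜 := 𝕜) p' 0)
    (h : ∀ᶠ s in 𝓝 0, ∀ v, fderiv 𝕜 u s v + ∑ j, p s j * fderiv 𝕜 q s v j = 0)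
    (h' : ∀ᶠ s in 𝓝 0, ∀ v, fderiv 𝕜 u' s v +
      ∑ j, (p' s j * fderiv 𝕜 q s v j + p s j * fderiv 𝕜 q' s v j) = 0)
    (hker : Module.finrank 𝕜 (LinearMap.ker (fderiv 𝕜 q 0).toLinearMap ⊓
      LinearMap.ker (fderiv 𝕜 p 0).toLinearMap : Submodule 𝕜 (Fin n → 𝕜)) ≤ 1) :
    ∃ (ut : (Fin n → 𝕜) × 𝕜 → 𝕜) (qt pt : (Fin n → 𝕜) × 𝕜 → Fin n → 𝕜),
      IsSmoothGerm (𝕜 := 𝕜) ut 0 ∧ IsSmoothGerm (𝕜 := 𝕜) qt 0 ∧ IsSmoothGerm (𝕜 := 𝕜) pt 0 ∧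
      (∀ s, ut (s, 0) = u s ∧ qt (s, 0) = q s ∧ pt (s, 0) = p s) ∧
      (∀ᶠ s in 𝓝 0, deriv (fun t => ut (s, t)) 0 = u' s ∧ deriv (fun t => qt (s, t)) 0 = q' s ∧
        deriv (fun t => pt (s, t)) 0 = p' s) ∧
      ∀ᶠ r in 𝓝 (0 : (Fin n → 𝕜) × 𝕜), ∀ v, fderiv 𝕜 (fun s => ut (s, r.2)) r.1 v +
        ∑ j, pt r j * fderiv 𝕜 (fun s => qt (s, r.2)) r.1 v j = 0 := by
  have hiso := isotropic_of_eq_sum hu.neg hp hq (by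
    filter_upwards [h] with s hs v
    rw [fderiv_fun_neg, neg_apply]
    exact neg_eq_of_add_eq_zero_right (hs v))
  obtain ⟨I, hI⟩ := exists_coordinate_lagrangian (fderiv 𝕜 p 0).toLinearMap
    (fderiv 𝕜 q 0).toLinearMap hiso
  obtain ⟨Ut, xt, yt, hUt, hxt, hyt, hzero, hder, hrel⟩ := exists_family_of_finrank_ker_le_one
    (U := fun s => -u s - partialDot I (p s) (q s))
    (U' := fun s => -u' s - (partialDot I (p' s) (q s) + partialDot I (p s) (q' s)))
    (x := fun s j => if j ∈ I then p s j else (-q s) j)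
    (y := fun s j => if j ∈ I then q s j else p s j)
    (x' := fun s j => if j ∈ I then p' s j else (-q' s) j)
    (y' := fun s j => if j ∈ I then q' s j else p' s j)
    (hu.neg.sub (isSmoothGerm_partialDot hp hq I)) (isSmoothGerm_ite hp hq.neg I)
    (isSmoothGerm_ite hq hp I)
    (hu'.neg.sub ((isSmoothGerm_partialDot hp' hq I).add (isSmoothGerm_partialDot hp hq' I)))
    (isSmoothGerm_ite hp' hq'.neg I) (isSmoothGerm_ite hq' hp' I)
    (by
      filter_upwards [h, hu.differentiableAt, hq.differentiableAt, hp.differentiableAt]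
        with s hs hu hq hp v
      obtain ⟨d1, e1⟩ := differentiableAt_partialDot hp hq I
      rw [fderiv_ite_coord hq hp, fderiv_fun_sub hu.fun_neg d1, fderiv_fun_neg, sub_apply,
        neg_apply, neg_eq_of_add_eq_zero_right (hs v), e1, partialDot, partialDot,
        ← Finset.sum_add_distrib, ← Finset.sum_sub_distrib]
      refine Finset.sum_congr rfl fun j _ => ?_
      by_cases hj : j ∈ I <;> simp [hj]
      ring)
    (by
      filter_upwards [h', hu'.differentiableAt, hq.differentiableAt, hp.differentiableAt,
        hq'.differentiableAt, hp'.differentiableAt] with s hs hu hq hp hq' hp' v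
      obtain ⟨d1, e1⟩ := differentiableAt_partialDot hp' hq I
      obtain ⟨d2, e2⟩ := differentiableAt_partialDot hp hq' I
      rw [fderiv_ite_coord hq hp, fderiv_ite_coord hq' hp',
        fderiv_fun_sub hu.fun_neg (d1.fun_add d2),
        fderiv_fun_neg, fderiv_fun_add d1 d2, sub_apply, add_apply,
        neg_apply, neg_eq_of_add_eq_zero_right (hs v), e1, e2]
      simp only [partialDot]
      rw [← Finset.sum_add_distrib, ← Finset.sum_add_distrib, ← Finset.sum_add_distrib,
        ← Finset.sum_sub_distrib]
      refine Finset.sum_congr rfl fun j _ => ?_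
      by_cases hj : j ∈ I <;> simp [hj]
      ring)
    (by
      refine (Submodule.finrank_mono fun v hv => ?_).trans hker
      have hv' : fderiv 𝕜 (fun s j => if j ∈ I then q s j else p s j) 0 v = 0 := hv
      rw [fderiv_ite_coord hq.differentiableAt.self_of_nhds hp.differentiableAt.self_of_nhds] at hv'
      refine hI v (fun j hj => ?_) fun j hj => ?_
      · simpa [hj] using congrFun hv' j
      · simpa [hj] using congrFun hv' j)
  have hqt := isSmoothGerm_ite hyt hxt.neg I
  have hpt := isSmoothGerm_ite hxt hyt I
  refine ⟨fun r => -Ut r - partialDot I (yt r) (-xt r),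
    fun r j => if j ∈ I then yt r j else (-xt r) j, fun r j => if j ∈ I then xt r j else yt r j,
    hUt.neg.sub (isSmoothGerm_partialDot hyt hxt.neg I), hqt, hpt, fun s => ?_, ?_, ?_⟩
  · obtain ⟨h1, h2, h3⟩ := hzero s
    refine ⟨?_, ?_, ?_⟩
    · simp only [h1, h2, h3, partialDot]
      rw [sub_eq_iff_eq_add, neg_sub, sub_neg_eq_add, add_comm, add_right_inj]
      refine Finset.sum_congr rfl fun j _ => ?_
      by_cases hj : j ∈ I <;> simp [hj]
    · funext j
      by_cases hj : j ∈ I <;> simp [hj, h2, h3]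
    · funext j
      by_cases hj : j ∈ I <;> simp [hj, h2, h3]
  · filter_upwards [hder, hUt.differentiableAt_snd, hxt.differentiableAt_snd,
      hyt.differentiableAt_snd] with s hs dU dx dy
    obtain ⟨h1, h2, h3⟩ := hs
    obtain ⟨k1, k2, k3⟩ := hzero s
    rw [← fderiv_apply_one_eq_deriv] at h1 h2 h3
    simp only [← fderiv_apply_one_eq_deriv]
    obtain ⟨d1, e1⟩ := differentiableAt_partialDot dy dx.fun_neg I
    refine ⟨?_, ?_, ?_⟩
    · rw [fderiv_fun_sub dU.fun_neg d1, fderiv_fun_neg, sub_apply, neg_apply, e1, h1, h3,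
        fderiv_fun_neg, neg_apply, h2, k2, k3]
      simp only [partialDot]
      rw [← Finset.sum_add_distrib, ← Finset.sum_add_distrib, sub_eq_iff_eq_add, neg_sub,
        sub_neg_eq_add, add_comm, add_right_inj]
      refine Finset.sum_congr rfl fun j _ => ?_
      by_cases hj : j ∈ I <;> simp [hj]
    · rw [fderiv_ite_coord dy dx.fun_neg, fderiv_fun_neg, neg_apply, h2, h3]
      funext j
      by_cases hj : j ∈ I <;> simp [hj]
    · rw [fderiv_ite_coord dx dy, h2, h3]
      funext j
      by_cases hj : j ∈ I <;> simp [hj]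
  · filter_upwards [hrel, hUt.differentiableAt_fst, hxt.differentiableAt_fst,
      hyt.differentiableAt_fst] with r hs dU dx dy v
    obtain ⟨d1, e1⟩ := differentiableAt_partialDot dy dx.fun_neg I
    rw [fderiv_fun_sub dU.fun_neg d1, fderiv_fun_neg, sub_apply, neg_apply, e1, hs,
      fderiv_ite_coord dy dx.fun_neg, fderiv_fun_neg, neg_apply]
    simp only [partialDot]
    rw [← Finset.sum_add_distrib, ← Finset.sum_neg_distrib, ← Finset.sum_sub_distrib,
      ← Finset.sum_add_distrib]
    refine Finset.sum_eq_zero fun j _ => ?_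
    by_cases hj : j ∈ I <;> simp [hj]
    ring

end Legendre

/-! ### Affine coordinates on the projectivised cotangent bundle -/

section Charts

variable {𝕜 : Type*} [RCLike 𝕜] {n : ℕ}

/-- The affine coordinates `(z, p)` of the point `(z, [w])`, where `p` lists the quotients
`w_j / w_i` for `j ≠ i`. -/
noncomputable def affineCoord (i : Fin (n + 1)) (q : PTCot 𝕜 n) :
    (Fin (n + 1) → 𝕜) × (Fin n → 𝕜) := (q.1, ProjChart.coord i q.2)

/-- The point of `PTCot 𝕜 n` with affine coordinates `(z, p)`. -/
noncomputable def ofAffine (i : Fin (n + 1)) (e : (Fin (n + 1) → 𝕜) × (Fin n → 𝕜)) : PTCot 𝕜 n :=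
  (e.1, (ProjChart.chart i).symm e.2)

theorem ofAffine_mem_dom (i : Fin (n + 1)) (e : (Fin (n + 1) → 𝕜) × (Fin n → 𝕜)) :
    (ofAffine i e).2 ∈ ProjChart.dom i :=
  (ProjChart.chart (𝕜 := 𝕜) i).map_target (mem_univ e.2)

theorem affineCoord_ofAffine (i : Fin (n + 1)) (e : (Fin (n + 1) → 𝕜) × (Fin n → 𝕜)) :
    affineCoord i (ofAffine i e) = e :=
  Prod.ext rfl ((ProjChart.chart (𝕜 := 𝕜) i).right_inv (mem_univ e.2))

theorem ofAffine_affineCoord {i : Fin (n + 1)} {q : PTCot 𝕜 n} (hq : q.2 ∈ ProjChart.dom i) :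
    ofAffine i (affineCoord i q) = q :=
  Prod.ext rfl ((ProjChart.chart (𝕜 := 𝕜) i).left_inv hq)

theorem isOpen_affine_dom (i : Fin (n + 1)) : IsOpen {q : PTCot 𝕜 n | q.2 ∈ ProjChart.dom i} :=
  (ProjChart.isOpen_dom i).preimage continuous_snd

theorem chart_mem_maximalAtlas (i : Fin (n + 1)) :
    ProjChart.chart (𝕜 := 𝕜) i ∈ IsManifold.maximalAtlas 𝓘(𝕜, Fin n → 𝕜) ∞
      (ℙ 𝕜 (Fin (n + 1) → 𝕜)) :=
  IsManifold.subset_maximalAtlas (mem_range_self i)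

theorem contMDiffAt_affineCoord {i : Fin (n + 1)} {q : PTCot 𝕜 n} (hq : q.2 ∈ ProjChart.dom i) :
    ContMDiffAt (PTModel 𝕜 n) 𝓘(𝕜, (Fin (n + 1) → 𝕜) × (Fin n → 𝕜)) ∞ (affineCoord i) q := by
  have h1 : ContMDiffAt 𝓘(𝕜, Fin n → 𝕜) 𝓘(𝕜, Fin n → 𝕜) ∞ (ProjChart.chart (𝕜 := 𝕜) i) q.2 :=
    contMDiffAt_of_mem_maximalAtlas (chart_mem_maximalAtlas i) hq
  exact ContMDiffAt.prodMk_space contMDiffAt_fst (h1.comp q contMDiffAt_snd)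

theorem contMDiff_ofAffine (i : Fin (n + 1)) :
    ContMDiff 𝓘(𝕜, (Fin (n + 1) → 𝕜) × (Fin n → 𝕜)) (PTModel 𝕜 n) ∞ (ofAffine (𝕜 := 𝕜) i) := by
  intro e
  have h1 : ContMDiffAt 𝓘(𝕜, Fin n → 𝕜) 𝓘(𝕜, Fin n → 𝕜) ∞ (ProjChart.chart (𝕜 := 𝕜) i).symm e.2 :=
    contMDiffAt_symm_of_mem_maximalAtlas (chart_mem_maximalAtlas i) (mem_univ e.2)
  exact ContMDiffAt.prodMk contDiff_fst.contMDiff.contMDiffAt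
    (h1.comp e contDiff_snd.contMDiff.contMDiffAt)

/-- The derivative of the affine coordinates. -/
noncomputable def affineDeriv (i : Fin (n + 1)) (q : PTCot 𝕜 n) :
    TangentSpace (PTModel 𝕜 n) q →L[𝕜] (Fin (n + 1) → 𝕜) × (Fin n → 𝕜) :=
  mfderiv (PTModel 𝕜 n) 𝓘(𝕜, (Fin (n + 1) → 𝕜) × (Fin n → 𝕜)) (affineCoord i) q

theorem mdifferentiableAt_proj (q : PTCot 𝕜 n) :
    MDifferentiableAt (PTModel 𝕜 n) 𝓘(𝕜, Fin (n + 1) → 𝕜) proj q := mdifferentiableAt_fst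

theorem affineDeriv_fst {i : Fin (n + 1)} {q : PTCot 𝕜 n} (hq : q.2 ∈ ProjChart.dom i)
    (v : TangentSpace (PTModel 𝕜 n) q) : (affineDeriv i q v).1 = dproj q v := by
  have h1 := mfderiv_comp_apply (I' := 𝓘(𝕜, (Fin (n + 1) → 𝕜) × (Fin n → 𝕜)))
    (I'' := 𝓘(𝕜, Fin (n + 1) → 𝕜)) (g := Prod.fst) (f := affineCoord i) q
    (contDiff_fst (n := 1).contMDiff.mdifferentiableAt one_ne_zero)
    ((contMDiffAt_affineCoord hq).mdifferentiableAt (by simp)) v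
  rw [mfderiv_eq_fderiv, fderiv_fst] at h1
  exact h1.symm

theorem affineDeriv_mfderiv {X : Type*} [NormedAddCommGroup X] [NormedSpace 𝕜 X]
    {i : Fin (n + 1)} {F : X → PTCot 𝕜 n} {x : X} (hx : (F x).2 ∈ ProjChart.dom i)
    (hF : MDifferentiableAt 𝓘(𝕜, X) (PTModel 𝕜 n) F x) (v : X) :
    affineDeriv i (F x) (mfderiv 𝓘(𝕜, X) (PTModel 𝕜 n) F x v) =
      fderiv 𝕜 (fun y => affineCoord i (F y)) x v := by
  have h1 := mfderiv_comp_apply x ((contMDiffAt_affineCoord hx).mdifferentiableAt (by simp)) hF v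
  rw [mfderiv_eq_fderiv] at h1
  exact h1.symm

theorem dproj_mfderiv {X : Type*} [NormedAddCommGroup X] [NormedSpace 𝕜 X]
    {F : X → PTCot 𝕜 n} {x : X}
    (hF : MDifferentiableAt 𝓘(𝕜, X) (PTModel 𝕜 n) F x) (v : X) :
    dproj (F x) (mfderiv 𝓘(𝕜, X) (PTModel 𝕜 n) F x v) = fderiv 𝕜 (fun y => proj (F y)) x v := by
  have h1 := mfderiv_comp_apply x (mdifferentiableAt_proj (F x)) hF v
  rw [mfderiv_eq_fderiv] at h1
  exact h1.symm

theorem affineDeriv_bijective {i : Fin (n + 1)} {q : PTCot 𝕜 n} (hq : q.2 ∈ ProjChart.dom i) :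
    Function.Bijective (affineDeriv i q) := by
  have hA := (contMDiffAt_affineCoord hq).mdifferentiableAt (show (∞ : ℕ∞ω) ≠ 0 by simp)
  have hB := (contMDiff_ofAffine (𝕜 := 𝕜) i (affineCoord i q)).mdifferentiableAt
    (show (∞ : ℕ∞ω) ≠ 0 by simp)
  constructor
  · refine (injective_iff_map_eq_zero (affineDeriv i q)).2 fun v hv => ?_
    have h1 := mfderiv_comp_apply q hB hA v
    have h2 : (ofAffine i ∘ affineCoord i : PTCot 𝕜 n → PTCot 𝕜 n) =ᶠ[𝓝 q] id := by
      filter_upwards [(isOpen_affine_dom i).mem_nhds hq] with q' h using ofAffine_affineCoord h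
    have hv' : mfderiv (PTModel 𝕜 n) 𝓘(𝕜, (Fin (n + 1) → 𝕜) × (Fin n → 𝕜))
        (affineCoord i) q v = 0 := hv
    rw [h2.mfderiv_eq, mfderiv_id, hv', map_zero] at h1
    exact h1
  · intro e
    refine ⟨mfderiv 𝓘(𝕜, (Fin (n + 1) → 𝕜) × (Fin n → 𝕜)) (PTModel 𝕜 n) (ofAffine i)
      (affineCoord i q) e, ?_⟩
    have h1 := affineDeriv_mfderiv (ofAffine_mem_dom i _) hB e
    simp only [affineCoord_ofAffine, fderiv_fun_id] at h1
    rw [ofAffine_affineCoord hq] at h1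
    exact h1

/-- The contact plane can be computed with any representative of the covector. -/
theorem mem_contactPlane_iff {q : PTCot 𝕜 n} {w : Fin (n + 1) → 𝕜} (hw : w ≠ 0)
    (h : q.2 = Projectivization.mk 𝕜 w hw) (v : TangentSpace (PTModel 𝕜 n) q) :
    v ∈ contactPlane q ↔ ∑ k, w k * dproj q v k = 0 := by
  obtain ⟨a, ha⟩ := Projectivization.exists_smul_eq_mk_rep 𝕜 w hw
  rw [← h] at ha
  have h1 : contactForm q v = a * ∑ k, w k * dproj q v k := by
    simp [contactForm, ← ha, Units.smul_def, Finset.mul_sum, mul_assoc]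
  rw [contactPlane, LinearMap.mem_ker, h1]
  simp

theorem mk_vec_affineCoord {i : Fin (n + 1)} {q : PTCot 𝕜 n} (hq : q.2 ∈ ProjChart.dom i) :
    q.2 = Projectivization.mk 𝕜 (ProjChart.vec i (affineCoord i q).2)
      (ProjChart.vec_ne_zero _ _) :=
  (ProjChart.mk_vec_coord i q.2 hq).symm

variable {V : Type*} [NormedAddCommGroup V] [NormedSpace 𝕜 V]

theorem isIntegralAt_iff {i : Fin (n + 1)} {F : V → PTCot 𝕜 n} {x : V}
    (hx : (F x).2 ∈ ProjChart.dom i) (hF : MDifferentiableAt 𝓘(𝕜, V) (PTModel 𝕜 n) F x) :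
    IsIntegralAt F x ↔ ∀ v, ∑ k, ProjChart.vec i (affineCoord i (F x)).2 k *
      fderiv 𝕜 (fun y => proj (F y)) x v k = 0 := by
  have e : ∀ v : V, ∑ k, ProjChart.vec i (affineCoord i (F x)).2 k *
      dproj (F x) (mfderiv 𝓘(𝕜, V) (PTModel 𝕜 n) F x v) k =
      ∑ k, ProjChart.vec i (affineCoord i (F x)).2 k * fderiv 𝕜 (fun y => proj (F y)) x v k :=
    fun v => Finset.sum_congr rfl fun k _ => by rw [dproj_mfderiv hF v]
  exact ⟨fun H v => (e v).symm.trans ((mem_contactPlane_iff _ (mk_vec_affineCoord hx) _).1 (H v)),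
    fun H v => (mem_contactPlane_iff _ (mk_vec_affineCoord hx) _).2 ((e v).trans (H v))⟩

theorem IsSmoothGermPT.mdifferentiableAt {F : V → PTCot 𝕜 n} {x : V} (hF : IsSmoothGermPT F x) :
    ∀ᶠ y in 𝓝 x, MDifferentiableAt 𝓘(𝕜, V) (PTModel 𝕜 n) F y := by
  filter_upwards [hF] with y h using h.mdifferentiableAt (by simp)

theorem IsSmoothGermPT.eventually_mem_dom {i : Fin (n + 1)} {F : V → PTCot 𝕜 n} {x : V}
    (hF : IsSmoothGermPT F x) (hx : (F x).2 ∈ ProjChart.dom i) :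
    ∀ᶠ y in 𝓝 x, (F y).2 ∈ ProjChart.dom i :=
  hF.self_of_nhds.continuousAt.eventually ((isOpen_affine_dom i).mem_nhds hx)

theorem IsSmoothGermPT.affineCoord {i : Fin (n + 1)} {F : V → PTCot 𝕜 n} {x : V}
    (hF : IsSmoothGermPT F x) (hx : (F x).2 ∈ ProjChart.dom i) :
    IsSmoothGerm (𝕜 := 𝕜) (fun y => affineCoord i (F y)) x := by
  filter_upwards [hF, hF.eventually_mem_dom hx] with y h1 h2
  exact contMDiffAt_iff_contDiffAt.1 ((contMDiffAt_affineCoord h2).comp y h1)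

theorem IsSmoothGerm.ofAffine {h : V → (Fin (n + 1) → 𝕜) × (Fin n → 𝕜)} {x : V}
    (hh : IsSmoothGerm (𝕜 := 𝕜) h x) (i : Fin (n + 1)) :
    IsSmoothGermPT (fun y => ofAffine i (h y)) x := by
  filter_upwards [hh] with y h1
  exact (contMDiff_ofAffine i (h y)).comp y h1.contMDiffAt

theorem IsSmoothGerm.fst {W X : Type*} [NormedAddCommGroup W] [NormedSpace 𝕜 W]
    [NormedAddCommGroup X] [NormedSpace 𝕜 X] {h : V → W × X} {x : V}
    (hh : IsSmoothGerm (𝕜 := 𝕜) h x) : IsSmoothGerm (𝕜 := 𝕜) (fun y => (h y).1) x := by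
  filter_upwards [hh] with y h1 using h1.fst

theorem IsSmoothGerm.snd {W X : Type*} [NormedAddCommGroup W] [NormedSpace 𝕜 W]
    [NormedAddCommGroup X] [NormedSpace 𝕜 X] {h : V → W × X} {x : V}
    (hh : IsSmoothGerm (𝕜 := 𝕜) h x) : IsSmoothGerm (𝕜 := 𝕜) (fun y => (h y).2) x := by
  filter_upwards [hh] with y h1 using h1.snd

theorem isIntegralAt_ofAffine_iff {i : Fin (n + 1)} {h : V → (Fin (n + 1) → 𝕜) × (Fin n → 𝕜)}
    {x : V} (hh : DifferentiableAt 𝕜 h x) :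
    IsIntegralAt (fun y => ofAffine i (h y)) x ↔ ∀ v, ∑ k, ProjChart.vec i (h x).2 k *
      fderiv 𝕜 (fun y => (h y).1) x v k = 0 := by
  have hm : MDifferentiableAt 𝓘(𝕜, V) (PTModel 𝕜 n) (fun y => ofAffine i (h y)) x :=
    ((contMDiff_ofAffine i (h x)).mdifferentiableAt (by simp)).comp x hh.mdifferentiableAt
  rw [isIntegralAt_iff (i := i) (F := fun y => FrontalGerm.ofAffine i (h y))
    (ofAffine_mem_dom i _) hm]
  simp only [affineCoord_ofAffine]
  rfl

end Charts

/-! ### The linearised integrality condition -/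

section Infinitesimal

variable {𝕜 : Type*} [RCLike 𝕜] {n : ℕ}

theorem sum_vec_mul (i : Fin (n + 1)) (p : Fin n → 𝕜) (a : Fin (n + 1) → 𝕜) :
    ∑ k, ProjChart.vec i p k * a k = a i + ∑ j, p j * a (i.succAbove j) := by
  rw [Fin.sum_univ_succAbove _ i]
  simp [ProjChart.vec]

/-- The pairs `(z', p')` of smooth germs that solve the linearisation
`∑ w_k dz'_k + ∑ p'_j dz_j = 0` of the integrality condition at `F`, written in the `i`-th affine
coordinates: `w` is the representative of the covector with `w_i = 1`, and `j ≠ i` in the second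
sum. -/
noncomputable def linearisedSolutions (i : Fin (n + 1)) (F : (Fin n → 𝕜) → PTCot 𝕜 n) :
    Submodule 𝕜 ((Fin n → 𝕜) → (Fin (n + 1) → 𝕜) × (Fin n → 𝕜)) where
  carrier := {h | IsSmoothGerm (𝕜 := 𝕜) h 0 ∧ ∀ᶠ s in 𝓝 0, ∀ v,
    ∑ k, ProjChart.vec i (affineCoord i (F s)).2 k * fderiv 𝕜 (fun s => (h s).1) s v k +
      ∑ j, (h s).2 j * fderiv 𝕜 (fun s => proj (F s)) s v (i.succAbove j) = 0}
  zero_mem' := ⟨.of_contDiff contDiff_const _, by simp⟩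
  add_mem' := by
    rintro g h ⟨hg, hg'⟩ ⟨hh, hh'⟩
    refine ⟨hg.add hh, ?_⟩
    filter_upwards [hg', hh', hg.fst.differentiableAt, hh.fst.differentiableAt]
      with s h1 h2 h3 h4 v
    simp only [Pi.add_apply, Prod.fst_add, Prod.snd_add]
    rw [fderiv_fun_add h3 h4]
    simp only [add_apply, Pi.add_apply, mul_add, add_mul, Finset.sum_add_distrib]
    linear_combination h1 v + h2 v
  smul_mem' := by
    rintro c h ⟨hh, hh'⟩
    refine ⟨IsSmoothGerm.smul (.of_contDiff contDiff_const _) hh, ?_⟩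
    filter_upwards [hh', hh.fst.differentiableAt] with s h1 h2 v
    simp only [Pi.smul_apply, Prod.smul_fst, Prod.smul_snd]
    rw [fderiv_fun_const_smul h2]
    simp only [smul_apply, Pi.smul_apply, smul_eq_mul, mul_left_comm _ c, mul_assoc,
      ← Finset.mul_sum]
    linear_combination c * h1 v

/-- A vector field along `F` in affine coordinates. -/
noncomputable def fieldCoord (i : Fin (n + 1)) (F : (Fin n → 𝕜) → PTCot 𝕜 n) :
    (∀ x, TangentSpace (PTModel 𝕜 n) (F x)) →ₗ[𝕜]
      ((Fin n → 𝕜) → (Fin (n + 1) → 𝕜) × (Fin n → 𝕜)) where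
  toFun s := fun x => affineDeriv i (F x) (s x)
  map_add' s t := by funext x; exact map_add (affineDeriv i (F x)) _ _
  map_smul' c s := by funext x; exact map_smul (affineDeriv i (F x)) _ _

/-- The vector field germs along `F` that solve the linearised integrality condition, written in
the `i`-th affine chart. -/
noncomputable def infinitesimalDeformations (i : Fin (n + 1)) (F : (Fin n → 𝕜) → PTCot 𝕜 n) :
    Submodule 𝕜 (FieldGerm F) :=
  ((linearisedSolutions i F).comap (fieldCoord i F)).map (zeroGerms F).mkQ

/-- The section underlying the velocity of the deformation `G`. The identification of the tangent
spaces at `G (x, 0)` and at `F x`, where these points differ, is through the common model space. -/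
noncomputable def velocitySection (F : (Fin n → 𝕜) → PTCot 𝕜 n)
    (G : (Fin n → 𝕜) × 𝕜 → PTCot 𝕜 n) : ∀ x, TangentSpace (PTModel 𝕜 n) (F x) := fun x =>
  (mfderiv 𝓘(𝕜, 𝕜) (PTModel 𝕜 n) (fun t : 𝕜 => G (x, t)) 0 (1 : 𝕜) :
      TangentSpace (PTModel 𝕜 n) (G (x, 0)))

theorem velocity_eq (F : (Fin n → 𝕜) → PTCot 𝕜 n) (G : (Fin n → 𝕜) × 𝕜 → PTCot 𝕜 n) :
    velocity F G = (zeroGerms F).mkQ (velocitySection F G) := rfl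

theorem IsSmoothGermPT.mdifferentiableAt_snd {G : (Fin n → 𝕜) × 𝕜 → PTCot 𝕜 n}
    (hG : IsSmoothGermPT G 0) :
    ∀ᶠ s in 𝓝 (0 : Fin n → 𝕜), MDifferentiableAt 𝓘(𝕜, 𝕜) (PTModel 𝕜 n) (fun t => G (s, t)) 0 := by
  filter_upwards [tendsto_prodMk_zero.eventually hG.mdifferentiableAt] with s h
  have h2 : DifferentiableAt 𝕜 (fun t : 𝕜 => (s, t)) 0 := by fun_prop
  exact MDifferentiableAt.comp (0 : 𝕜) (g := G) (f := fun t => (s, t)) h h2.mdifferentiableAt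

theorem dproj_velocitySection {F : (Fin n → 𝕜) → PTCot 𝕜 n} {G : (Fin n → 𝕜) × 𝕜 → PTCot 𝕜 n}
    (hG : IsSmoothGermPT G 0) (h0 : ∀ᶠ x in 𝓝 (0 : Fin n → 𝕜), G (x, 0) = F x) :
    ∀ᶠ x in 𝓝 (0 : Fin n → 𝕜), dproj (F x) (velocitySection F G x) =
      deriv (fun t => proj (G (x, t))) 0 := by
  filter_upwards [hG.mdifferentiableAt_snd, h0] with s h1 h2
  have h3 := dproj_mfderiv h1 (1 : 𝕜)
  rw [fderiv_apply_one_eq_deriv] at h3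
  rw [← h3, ← h2]
  rfl

theorem affineDeriv_velocitySection {i : Fin (n + 1)} {F : (Fin n → 𝕜) → PTCot 𝕜 n}
    {G : (Fin n → 𝕜) × 𝕜 → PTCot 𝕜 n} (hF : IsSmoothGermPT F 0)
    (hi : (F 0).2 ∈ ProjChart.dom i)
    (hG : IsSmoothGermPT G 0) (h0 : ∀ᶠ x in 𝓝 (0 : Fin n → 𝕜), G (x, 0) = F x) :
    ∀ᶠ x in 𝓝 (0 : Fin n → 𝕜), affineDeriv i (F x) (velocitySection F G x) =
      deriv (fun t => affineCoord i (G (x, t))) 0 := by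
  filter_upwards [hG.mdifferentiableAt_snd, h0, hF.eventually_mem_dom hi] with s h1 h2 h4
  have h3 := affineDeriv_mfderiv (i := i) (F := fun t => G (s, t)) (x := 0) (by rwa [h2]) h1 (1 : 𝕜)
  rw [fderiv_apply_one_eq_deriv] at h3
  rw [← h3]
  -- Only the base point of the tangent vector changes, from `F s` to the equal `G (s, 0)`.
  have h5 : ∀ q, G (s, 0) = q →
      affineDeriv i q (mfderiv 𝓘(𝕜, 𝕜) (PTModel 𝕜 n) (fun t : 𝕜 => G (s, t)) 0 (1 : 𝕜) :
        TangentSpace (PTModel 𝕜 n) (G (s, 0))) = affineDeriv i (G (s, 0))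
      (mfderiv 𝓘(𝕜, 𝕜) (PTModel 𝕜 n) (fun t : 𝕜 => G (s, t)) 0 (1 : 𝕜) :
        TangentSpace (PTModel 𝕜 n) (G (s, 0))) := by
    rintro _ rfl; rfl
  exact h5 _ h2

theorem hasFDerivAt_slice_fst {V W X : Type*} [NormedAddCommGroup V] [NormedSpace 𝕜 V]
    [NormedAddCommGroup W] [NormedSpace 𝕜 W] [NormedAddCommGroup X] [NormedSpace 𝕜 X]
    {H : V × 𝕜 → W × X} {s : V} {t : 𝕜} (h : DifferentiableAt 𝕜 H (s, t)) :
    HasFDerivAt (fun x => (H (x, t)).1) ((ContinuousLinearMap.fst 𝕜 W X).comp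
      ((fderiv 𝕜 H (s, t)).comp (ContinuousLinearMap.inl 𝕜 V 𝕜))) s := by
  have h1 : HasFDerivAt (fun x => H (x, t)) _ s :=
    HasFDerivAt.comp s h.hasFDerivAt (hasFDerivAt_prodMk_left s t)
  exact (ContinuousLinearMap.fst 𝕜 W X).hasFDerivAt.comp s h1

/-- The velocity of an integral deformation solves the linearised condition, as one sees by
differentiating the integrality condition in `t` and exchanging the derivatives in `t` and `x`. -/
theorem velocity_mem_infinitesimalDeformations {i : Fin (n + 1)} {F : (Fin n → 𝕜) → PTCot 𝕜 n}
    {G : (Fin n → 𝕜) × 𝕜 → PTCot 𝕜 n} (hF : IsSmoothGermPT F 0)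
    (hi : (F 0).2 ∈ ProjChart.dom i)
    (hG : IsSmoothGermPT G 0) (h0 : ∀ᶠ x in 𝓝 (0 : Fin n → 𝕜), G (x, 0) = F x)
    (hint : ∀ᶠ p in 𝓝 (0 : (Fin n → 𝕜) × 𝕜), IsIntegralAt (fun x => G (x, p.2)) p.1) :
    velocity F G ∈ infinitesimalDeformations i F := by
  refine ⟨velocitySection F G, ?_, rfl⟩
  have hG0 : (G 0).2 ∈ ProjChart.dom i := by
    have := h0.self_of_nhds
    rw [Prod.zero_eq_mk, this]; exact hi
  have hH := hG.affineCoord hG0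
  set H : (Fin n → 𝕜) × 𝕜 → (Fin (n + 1) → 𝕜) × (Fin n → 𝕜) :=
    fun r => affineCoord i (G r) with hHdef
  -- The velocity is `h' (s) = ∂H/∂t (s, 0)`.
  set h' : (Fin n → 𝕜) → (Fin (n + 1) → 𝕜) × (Fin n → 𝕜) :=
    fun s => fderiv 𝕜 H (s, 0) (0, 1) with hh'
  have hpair : IsSmoothGerm (𝕜 := 𝕜) (fun s : Fin n → 𝕜 => (s, (0 : 𝕜))) 0 :=
    .of_contDiff (by fun_prop) _
  have hh's : IsSmoothGerm (𝕜 := 𝕜) h' 0 :=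
    (IsSmoothGerm.comp (g := fderiv 𝕜 H) (h := fun s : Fin n → 𝕜 => (s, (0 : 𝕜)))
      hH.fderiv hpair).clm_apply (.of_contDiff contDiff_const _)
  have heq : fieldCoord i F (velocitySection F G) =ᶠ[𝓝 0] h' := by
    filter_upwards [affineDeriv_velocitySection hF hi hG h0,
      tendsto_prodMk_zero.eventually hH.differentiableAt] with s h1 h2
    refine h1.trans ?_
    have h3 : HasDerivAt (fun t : 𝕜 => (s, t)) ((0, 1) : (Fin n → 𝕜) × 𝕜) 0 :=
      (hasDerivAt_const (0 : 𝕜) s).prodMk (hasDerivAt_id 0)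
    exact (h2.hasFDerivAt.comp_hasDerivAt (0 : 𝕜) h3).deriv
  have hmem : h' ∈ linearisedSolutions i F := by
    refine ⟨hh's, ?_⟩
    have hrel : ∀ᶠ r in 𝓝 ((0 : Fin n → 𝕜), (0 : 𝕜)), ∀ v : Fin n → 𝕜,
        (fderiv 𝕜 H r (v, 0)).1 i +
          ∑ j, (H r).2 j * (fderiv 𝕜 H r (v, 0)).1 (i.succAbove j) = 0 := by
      filter_upwards [hint, hG.mdifferentiableAt, hH.differentiableAt,
        hG.eventually_mem_dom hG0] with r h1 h2 h3 h4 v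
      obtain ⟨s, t⟩ := r
      have hm : MDifferentiableAt 𝓘(𝕜, Fin n → 𝕜) (PTModel 𝕜 n) (fun x => G (x, t)) s := by
        have : DifferentiableAt 𝕜 (fun x : Fin n → 𝕜 => (x, t)) s := by fun_prop
        exact MDifferentiableAt.comp s (g := G) (f := fun x => (x, t)) h2 this.mdifferentiableAt
      have h5 := (isIntegralAt_iff (F := fun x => G (x, t)) h4 hm).1 h1 v
      rw [sum_vec_mul] at h5
      have h6 := hasFDerivAt_slice_fst h3
      rw [show fderiv 𝕜 (fun x => proj (G (x, t))) s = _ from h6.fderiv] at h5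
      exact h5
    filter_upwards [hrel.curry_nhds, tendsto_prodMk_zero.eventually hH,
      tendsto_prodMk_zero.eventually hH.differentiableAt,
      tendsto_prodMk_zero.eventually hH.fderiv.differentiableAt, h0.eventually_nhds]
      with s h1 h2 h3 h4 h5 v
    have hz : (fun x => proj (F x)) =ᶠ[𝓝 s] fun x => (H (x, 0)).1 := by
      filter_upwards [h5] with x hx
      rw [← hx]; rfl
    have hz' : fderiv 𝕜 (fun x => proj (F x)) s v = (fderiv 𝕜 H (s, 0) (v, 0)).1 := by
      have h6 := hasFDerivAt_slice_fst h3
      rw [hz.fderiv_eq, h6.fderiv]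
      rfl
    have hp : (affineCoord i (F s)).2 = (H (s, 0)).2 := by
      rw [← h5.self_of_nhds]
    have hline : HasDerivAt (fun t : 𝕜 => (s, t)) ((0, 1) : (Fin n → 𝕜) × 𝕜) 0 :=
      (hasDerivAt_const (0 : 𝕜) s).prodMk (hasDerivAt_id 0)
    have hd1 : HasDerivAt (fun t : 𝕜 => H (s, t)) (h' s) 0 :=
      h3.hasFDerivAt.comp_hasDerivAt (0 : 𝕜) hline
    have hd2 : HasDerivAt (fun t : 𝕜 => fderiv 𝕜 H (s, t) (v, 0))
        (fderiv 𝕜 (fderiv 𝕜 H) (s, 0) (0, 1) (v, 0)) 0 := by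
      have := (h4.hasFDerivAt.comp_hasDerivAt (0 : 𝕜) hline).clm_apply
        (hasDerivAt_const (0 : 𝕜) ((v, 0) : (Fin n → 𝕜) × 𝕜))
      simpa using this
    have hsymm := h2.isSymmSndFDerivAt minSmoothness_two_le (0, 1) (v, 0)
    have hd3 : fderiv 𝕜 (fun s => (h' s).1) s v =
        (fderiv 𝕜 (fderiv 𝕜 H) (s, 0) (0, 1) (v, 0)).1 := by
      have h6 : HasFDerivAt (fun x : Fin n → 𝕜 => fderiv 𝕜 H (x, 0))
          ((fderiv 𝕜 (fderiv 𝕜 H) (s, 0)).comp (ContinuousLinearMap.inl 𝕜 (Fin n → 𝕜) 𝕜)) s :=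
        h4.hasFDerivAt.comp s (hasFDerivAt_prodMk_left s (0 : 𝕜))
      have h7 := (ContinuousLinearMap.fst 𝕜 (Fin (n + 1) → 𝕜) (Fin n → 𝕜)).hasFDerivAt.comp s
        (h6.clm_apply (hasFDerivAt_const ((0, 1) : (Fin n → 𝕜) × 𝕜) s))
      rw [show fderiv 𝕜 (fun s => (h' s).1) s = _ from h7.fderiv, hsymm]
      simp
    have hfst : ∀ (k : Fin (n + 1)), HasDerivAt (fun t : 𝕜 => (fderiv 𝕜 H (s, t) (v, 0)).1 k)
        ((fderiv 𝕜 (fderiv 𝕜 H) (s, 0) (0, 1) (v, 0)).1 k) 0 := fun k =>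
      hasDerivAt_pi.1 (hd2.fst) k
    have hsnd : ∀ j, HasDerivAt (fun t : 𝕜 => (H (s, t)).2 j) ((h' s).2 j) 0 := fun j =>
      hasDerivAt_pi.1 (hd1.snd) j
    have hφ := (hfst i).add (HasDerivAt.fun_sum (u := Finset.univ) fun j _ =>
      (hsnd j).fun_mul (hfst (i.succAbove j)))
    have hφ0 := hφ.unique ((hasDerivAt_const (0 : 𝕜) (0 : 𝕜)).congr_of_eventuallyEq
      (h1.mono fun t ht => ht v))
    rw [sum_vec_mul, hz', hd3, hp]
    refine Eq.trans ?_ hφ0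
    rw [Finset.sum_add_distrib]
    ring
  refine ⟨IsSmoothGerm.congr hmem.1 heq, ?_⟩
  filter_upwards [hmem.2, heq.eventuallyEq_nhds] with s h1 h2 v
  have h3 : (fun s => (fieldCoord i F (velocitySection F G) s).1) =ᶠ[𝓝 s] fun s => (h' s).1 := by
    filter_upwards [h2] with x hx
    rw [hx]
  rw [h3.fderiv_eq, h2.self_of_nhds]
  exact h1 v

end Infinitesimal

/-! ### Infinitesimal deformations in corank at most one -/

section Realisation

variable {𝕜 : Type*} [RCLike 𝕜] {n : ℕ}

/-- The integrality condition in affine coordinates. -/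
theorem eventually_integral_affine {V : Type*} [NormedAddCommGroup V] [NormedSpace 𝕜 V] {x₀ : V}
    {i : Fin (n + 1)} {F : V → PTCot 𝕜 n}
    (hF : IsSmoothGermPT F x₀) (hi : (F x₀).2 ∈ ProjChart.dom i)
    (hint : ∀ᶠ s in 𝓝 x₀, IsIntegralAt F s) :
    ∀ᶠ s in 𝓝 x₀, ∀ v, fderiv 𝕜 (fun s => proj (F s)) s v i +
      ∑ j, (affineCoord i (F s)).2 j *
        fderiv 𝕜 (fun s => proj (F s)) s v (i.succAbove j) = 0 := by
  filter_upwards [hint, hF.eventually_mem_dom hi, hF.mdifferentiableAt] with s h1 h2 h3 v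
  have := (isIntegralAt_iff h2 h3).1 h1 v
  rwa [sum_vec_mul] at this

theorem fderiv_succAbove {V : Type*} [NormedAddCommGroup V] [NormedSpace 𝕜 V]
    {z : V → Fin (n + 1) → 𝕜} {s : V} (hz : DifferentiableAt 𝕜 z s) (i : Fin (n + 1)) (v : V) :
    fderiv 𝕜 (fun s j => z s (i.succAbove j)) s v =
      fun j => fderiv 𝕜 z s v (i.succAbove j) := by
  have hd : DifferentiableAt 𝕜 (fun s j => z s (i.succAbove j)) s :=
    differentiableAt_pi.2 fun j => differentiableAt_pi.1 hz _
  funext j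
  rw [← fderiv_coord hd, fderiv_coord hz]

/-- By integrality `dz_i` vanishes wherever the other `dz_j` do, so that the common kernel of these
and of `dp` at `0` is the kernel of `dF_0`. -/
theorem finrank_ker_inf_ker_le_one {i : Fin (n + 1)} {F : (Fin n → 𝕜) → PTCot 𝕜 n}
    (hF : IsSmoothGermPT F 0) (hi : (F 0).2 ∈ ProjChart.dom i)
    (hint : ∀ᶠ s in 𝓝 0, IsIntegralAt F s) (hc : corank F ≤ 1) :
    Module.finrank 𝕜 (LinearMap.ker
      (fderiv 𝕜 (fun s j => proj (F s) (i.succAbove j)) 0).toLinearMap ⊓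
      LinearMap.ker (fderiv 𝕜 (fun s => (affineCoord i (F s)).2) 0).toLinearMap :
        Submodule 𝕜 (Fin n → 𝕜)) ≤ 1 := by
  set A : (Fin n → 𝕜) →ₗ[𝕜] ((Fin (n + 1) → 𝕜) × (Fin n → 𝕜)) :=
    (mfderiv 𝓘(𝕜, Fin n → 𝕜) (PTModel 𝕜 n) F 0).toLinearMap with hA
  have hc' : n - Module.finrank 𝕜 (LinearMap.range A) ≤ 1 := hc
  have hrk := LinearMap.finrank_range_add_finrank_ker A
  rw [Module.finrank_fin_fun] at hrk
  have hle : Module.finrank 𝕜 (LinearMap.ker A) ≤ 1 := by omega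
  refine (Submodule.finrank_mono fun v hv => ?_).trans hle
  have hz := (hF.affineCoord hi).fst.differentiableAt.self_of_nhds
  have hp := (hF.affineCoord hi).snd.differentiableAt.self_of_nhds
  have h1 : fderiv 𝕜 (fun s j => proj (F s) (i.succAbove j)) 0 v = 0 := hv.1
  have h2 : fderiv 𝕜 (fun s => (affineCoord i (F s)).2) 0 v = 0 := hv.2
  have hz' : DifferentiableAt 𝕜 (fun s => proj (F s)) 0 := hz
  rw [fderiv_succAbove hz'] at h1
  have h3 := (eventually_integral_affine hF hi hint).self_of_nhds v
  have h4 : fderiv 𝕜 (fun s => proj (F s)) 0 v = 0 := by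
    funext k
    refine i.succAboveCases ?_ (fun j => congrFun h1 j) k
    rw [Finset.sum_eq_zero fun j _ => by rw [show fderiv 𝕜 (fun s => proj (F s)) 0 v
      (i.succAbove j) = 0 from congrFun h1 j, mul_zero], add_zero] at h3
    exact h3
  have h5 : fderiv 𝕜 (fun s => affineCoord i (F s)) 0 v = 0 := by
    have h6 := hz'.hasFDerivAt.prodMk hp.hasFDerivAt
    rw [show fderiv 𝕜 (fun s => affineCoord i (F s)) 0 = _ from h6.fderiv]
    simp [h4, h2]
  rw [← affineDeriv_mfderiv hi hF.mdifferentiableAt.self_of_nhds] at h5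
  exact (affineDeriv_bijective hi).1 (h5.trans (map_zero _).symm)

/-- In corank at most one every infinitesimal deformation is the velocity of an integral
deformation. -/
theorem infinitesimalDeformations_subset {i : Fin (n + 1)} {F : (Fin n → 𝕜) → PTCot 𝕜 n}
    (hF : IsSmoothGermPT F 0) (hi : (F 0).2 ∈ ProjChart.dom i)
    (hint : ∀ᶠ s in 𝓝 0, IsIntegralAt F s) (hc : corank F ≤ 1) :
    (infinitesimalDeformations i F : Set (FieldGerm F)) ⊆ integralDeformations F := by
  rintro _ ⟨s, ⟨hs, hlin⟩, rfl⟩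
  have hcoord := hF.affineCoord hi
  have hz : IsSmoothGerm (𝕜 := 𝕜) (fun s => proj (F s)) 0 := hcoord.fst
  obtain ⟨ut, qt, pt, hut, hqt, hpt, hzero, hder, hrel⟩ := exists_family_of_corank_le_one
    (u := fun x => proj (F x) i) (q := fun x j => proj (F x) (i.succAbove j))
    (p := fun x => (affineCoord i (F x)).2) (u' := fun x => (fieldCoord i F s x).1 i)
    (q' := fun x j => (fieldCoord i F s x).1 (i.succAbove j))
    (p' := fun x => (fieldCoord i F s x).2)
    (hz.apply i) (isSmoothGerm_pi.2 fun j => hz.apply (i.succAbove j)) hcoord.snd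
    (hs.fst.apply i) (isSmoothGerm_pi.2 fun j => hs.fst.apply (i.succAbove j)) hs.snd
    (by
      filter_upwards [eventually_integral_affine hF hi hint, hz.differentiableAt] with x h1 h2 v
      rw [fderiv_coord h2, fderiv_succAbove h2]
      exact h1 v)
    (by
      filter_upwards [hlin, hz.differentiableAt, hs.fst.differentiableAt] with x h1 h2 h3 v
      have h4 := h1 v
      rw [sum_vec_mul] at h4
      rw [fderiv_coord h3, fderiv_succAbove h2, fderiv_succAbove h3, Finset.sum_add_distrib]
      linear_combination h4)
    (finrank_ker_inf_ker_le_one hF hi hint hc)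
  set H : (Fin n → 𝕜) × 𝕜 → (Fin (n + 1) → 𝕜) × (Fin n → 𝕜) :=
    fun r => (i.insertNth (ut r) (qt r), pt r) with hHdef
  have hH : IsSmoothGerm (𝕜 := 𝕜) H 0 := by
    refine IsSmoothGerm.prodMk (isSmoothGerm_pi.2 fun k => ?_) hpt
    refine i.succAboveCases ?_ (fun j => ?_) k
    · simpa using hut
    · simpa using hqt.apply j
  have hG := hH.ofAffine i
  have h0 : ∀ᶠ x in 𝓝 (0 : Fin n → 𝕜), ofAffine i (H (x, 0)) = F x := by
    filter_upwards [hF.eventually_mem_dom hi] with x hx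
    obtain ⟨h1, h2, h3⟩ := hzero x
    refine Eq.trans (congrArg _ ?_) (ofAffine_affineCoord hx)
    refine Prod.ext (funext fun k => ?_) h3
    refine i.succAboveCases ?_ (fun j => ?_) k
    · exact (by simp [hHdef] : (H (x, 0)).1 i = ut (x, 0)).trans h1
    · exact (by simp [hHdef] : (H (x, 0)).1 (i.succAbove j) = qt (x, 0) j).trans (congrFun h2 j)
  refine ⟨fun r => ofAffine i (H r), hG, h0, ?_, ?_⟩
  · filter_upwards [hrel, hut.differentiableAt_fst, hqt.differentiableAt_fst,
      hH.differentiableAt_fst] with r h1 h2 h3 h4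
    refine (isIntegralAt_ofAffine_iff (h := fun x => H (x, r.2)) h4).2 fun v => ?_
    rw [sum_vec_mul, ← h1 v]
    have h5 : DifferentiableAt 𝕜 (fun x => (H (x, r.2)).1) r.1 := h4.fst
    rw [← fderiv_coord h5]
    simp only [← fderiv_coord h5, ← fderiv_coord h3]
    simp [hHdef]
  · rw [velocity_eq, ← sub_eq_zero, ← map_sub]
    refine (Submodule.Quotient.mk_eq_zero _).2 ?_
    have hv := affineDeriv_velocitySection hF hi hG h0
    have hev : ∀ᶠ x in 𝓝 (0 : Fin n → 𝕜),
        (s - velocitySection F (fun r => ofAffine i (H r))) x = 0 := by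
      filter_upwards [hv, hder, hF.eventually_mem_dom hi, hut.differentiableAt_snd,
        hqt.differentiableAt_snd, hpt.differentiableAt_snd] with x h1 h2 h3 h4 h5 h6
      refine sub_eq_zero.2 ((affineDeriv_bijective h3).1 ?_)
      rw [h1]
      simp only [affineCoord_ofAffine]
      obtain ⟨k1, k2, k3⟩ := h2
      have h7 : HasDerivAt (fun t => H (x, t))
          ((fieldCoord i F s x).1, (fieldCoord i F s x).2) 0 := by
        refine HasDerivAt.prodMk (hasDerivAt_pi.2 fun k => ?_) (k3 ▸ h6.hasDerivAt)
        refine i.succAboveCases ?_ (fun j => ?_) k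
        · simpa [k1] using h4.hasDerivAt
        · have := hasDerivAt_pi.1 (k2 ▸ h5.hasDerivAt) j
          simpa using this
      exact h7.deriv.symm
    exact hev

theorem infinitesimalDeformations_eq {i : Fin (n + 1)} {F : (Fin n → 𝕜) → PTCot 𝕜 n}
    (hF : IsSmoothGermPT F 0) (hi : (F 0).2 ∈ ProjChart.dom i)
    (hint : ∀ᶠ s in 𝓝 0, IsIntegralAt F s) (hc : corank F ≤ 1) :
    (infinitesimalDeformations i F : Set (FieldGerm F)) = integralDeformations F := by
  refine (infinitesimalDeformations_subset hF hi hint hc).antisymm ?_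
  rintro _ ⟨G, h1, h2, h3, rfl⟩
  exact velocity_mem_infinitesimalDeformations hF hi h1 h2 h3

end Realisation

/-! ### Density of the immersive points -/

section Density

variable {𝕜 : Type*} [RCLike 𝕜] {n : ℕ}

/-- A continuous germ that vanishes at the immersive points of a proper frontal is zero. -/
theorem eventually_eq_zero_of_immersive {V W Y : Type*} [NormedAddCommGroup V] [NormedSpace 𝕜 V]
    [NormedAddCommGroup W] [NormedSpace 𝕜 W] [TopologicalSpace Y] [T1Space Y] [Zero Y]
    {f : V → W} {b : V → Y} {x₀ : V}
    (hf : ∃ U ∈ 𝓝 x₀, IsNowhereDense {y ∈ U | ¬ Function.Injective (fderiv 𝕜 f y)})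
    (hb : ∀ᶠ x in 𝓝 x₀, ContinuousAt b x)
    (h : ∀ᶠ x in 𝓝 x₀, Function.Injective (fderiv 𝕜 f x) → b x = 0) :
    ∀ᶠ x in 𝓝 x₀, b x = 0 := by
  obtain ⟨U, hU, hnd⟩ := hf
  filter_upwards [hb, h.eventually_nhds, eventually_eventually_nhds.2 hU] with x h1 h2 h3
  by_contra hx
  have h4 : {y ∈ U | ¬ Function.Injective (fderiv 𝕜 f y)} ∈ 𝓝 x := by
    filter_upwards [h1.eventually_ne hx, h2, h3] with y k1 k2 k3
    exact ⟨k3, fun hinj => k1 (k2 hinj)⟩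
  have h5 : x ∈ interior (closure {y ∈ U | ¬ Function.Injective (fderiv 𝕜 f y)}) :=
    mem_interior_iff_mem_nhds.2 (mem_of_superset h4 subset_closure)
  rw [hnd] at h5
  exact h5

/-- If `dz_i` is a combination of the other `dz_j`, these are independent at the immersive points,
hence on a dense set; so a relation `∑ b_j dz_j = 0` with continuous coefficients is trivial. -/
theorem eventually_eq_zero_of_sum_eq_zero {f : (Fin n → 𝕜) → Fin (n + 1) → 𝕜}
    {p b : (Fin n → 𝕜) → Fin n → 𝕜} {i : Fin (n + 1)} {x₀ : Fin n → 𝕜}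
    (hf : ∃ U ∈ 𝓝 x₀, IsNowhereDense {y ∈ U | ¬ Function.Injective (fderiv 𝕜 f y)})
    (hp : ∀ᶠ s in 𝓝 x₀, ∀ v, fderiv 𝕜 f s v i + ∑ j, p s j * fderiv 𝕜 f s v (i.succAbove j) = 0)
    (hb : ∀ᶠ s in 𝓝 x₀, ContinuousAt b s)
    (h : ∀ᶠ s in 𝓝 x₀, ∀ v, ∑ j, b s j * fderiv 𝕜 f s v (i.succAbove j) = 0) :
    ∀ᶠ s in 𝓝 x₀, b s = 0 := by
  refine eventually_eq_zero_of_immersive hf hb ?_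
  filter_upwards [hp, h] with s h1 h2 hinj
  set A : (Fin n → 𝕜) →ₗ[𝕜] (Fin n → 𝕜) :=
    LinearMap.pi fun j => LinearMap.proj (i.succAbove j) ∘ₗ (fderiv 𝕜 f s).toLinearMap with hA
  have hAinj : Function.Injective A := by
    refine (injective_iff_map_eq_zero A).2 fun v hv => hinj ?_
    have h3 : ∀ j, fderiv 𝕜 f s v (i.succAbove j) = 0 := fun j => congrFun hv j
    rw [map_zero]
    funext k
    refine i.succAboveCases ?_ h3 k
    have := h1 v
    simpa [h3] using this
  funext j
  obtain ⟨v, hv⟩ := LinearMap.injective_iff_surjective.1 hAinj (Pi.single j 1)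
  have h3 : ∀ k, fderiv 𝕜 f s v (i.succAbove k) = (Pi.single j 1 : Fin n → 𝕜) k :=
    fun k => congrFun hv k
  have := h2 v
  simpa [h3, Pi.single_apply] using this

theorem IsLegendrianLift.eventually_fderiv_eq {f : (Fin n → 𝕜) → Fin (n + 1) → 𝕜}
    {F : (Fin n → 𝕜) → PTCot 𝕜 n} (hF : IsLegendrianLift F f 0) :
    ∀ᶠ s in 𝓝 0, fderiv 𝕜 (fun s => proj (F s)) s = fderiv 𝕜 f s :=
  EventuallyEq.fderiv (𝕜 := 𝕜) hF.proj_eq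

theorem IsLegendrianLift.eventually_integral_affine {f : (Fin n → 𝕜) → Fin (n + 1) → 𝕜}
    {F : (Fin n → 𝕜) → PTCot 𝕜 n} (hF : IsLegendrianLift F f 0) {i : Fin (n + 1)}
    (hi : (F 0).2 ∈ ProjChart.dom i) :
    ∀ᶠ s in 𝓝 0, ∀ v, fderiv 𝕜 f s v i +
      ∑ j, (affineCoord i (F s)).2 j * fderiv 𝕜 f s v (i.succAbove j) = 0 := by
  filter_upwards [FrontalGerm.eventually_integral_affine hF.smooth hi hF.integral,
    hF.eventually_fderiv_eq] with s h1 h2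
  rwa [← h2]

/-- `dπ` is injective on infinitesimal deformations of the Nash lift of a proper frontal. -/
theorem eq_zero_of_tProj_eq_zero {f : (Fin n → 𝕜) → Fin (n + 1) → 𝕜} {i : Fin (n + 1)}
    {F : (Fin n → 𝕜) → PTCot 𝕜 n} (hF : IsLegendrianLift F f 0) (hi : (F 0).2 ∈ ProjChart.dom i)
    (hf : ∃ U ∈ 𝓝 (0 : Fin n → 𝕜), IsNowhereDense {y ∈ U | ¬ Function.Injective (fderiv 𝕜 f y)})
    {ξ : FieldGerm F} (hξ : ξ ∈ infinitesimalDeformations i F) (h0 : tProj F ξ = 0) : ξ = 0 := by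
  obtain ⟨s, ⟨hs, hlin⟩, rfl⟩ := hξ
  have h1 : ∀ᶠ x in 𝓝 (0 : Fin n → 𝕜), dproj (F x) (s x) = 0 := Germ.coe_eq.1 h0
  have h2 : ∀ᶠ x in 𝓝 (0 : Fin n → 𝕜), (fieldCoord i F s x).1 = 0 := by
    filter_upwards [h1, hF.smooth.eventually_mem_dom hi] with x k1 k2
    exact (affineDeriv_fst k2 (s x)).trans k1
  have h3 : ∀ᶠ x in 𝓝 (0 : Fin n → 𝕜), (fieldCoord i F s x).2 = 0 := by
    refine eventually_eq_zero_of_sum_eq_zero hf (hF.eventually_integral_affine hi)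
      (hs.snd.mono fun x hx => hx.continuousAt) ?_
    filter_upwards [hlin, h2.eventually_nhds, hF.eventually_fderiv_eq] with x k1 k2 k4 v
    have k3 : (fun x => (fieldCoord i F s x).1) =ᶠ[𝓝 x] fun _ => 0 := k2
    have := k1 v
    rw [k3.fderiv_eq, k4] at this
    simpa using this
  refine (Submodule.Quotient.mk_eq_zero _).2 ?_
  have h4 : ∀ᶠ x in 𝓝 (0 : Fin n → 𝕜), s x = 0 := by
    filter_upwards [h2, h3, hF.smooth.eventually_mem_dom hi] with x k1 k2 k3
    exact (affineDeriv_bijective k3).1 ((Prod.ext k1 k2 : fieldCoord i F s x = 0).trans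
      (map_zero _).symm)
  exact h4

end Density

/-! ### Frontal deformations as projections of integral deformations -/

section Normalise

variable {𝕜 : Type*} [RCLike 𝕜] {n : ℕ}

/-- The affine coordinates `w_j / w_i`, `j ≠ i`, of the point `[w]`. -/
def normalise (i : Fin (n + 1)) (w : Fin (n + 1) → 𝕜) : Fin n → 𝕜 :=
  fun j => w (i.succAbove j) / w i

theorem vec_normalise {i : Fin (n + 1)} {w : Fin (n + 1) → 𝕜} (hw : w i ≠ 0) :
    ProjChart.vec i (normalise i w) = (w i)⁻¹ • w := by
  funext k
  refine i.succAboveCases ?_ (fun j => ?_) k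
  · simp [ProjChart.vec, hw]
  · simp [ProjChart.vec, normalise, div_eq_inv_mul]

theorem sum_vec_normalise_mul_eq_zero_iff {i : Fin (n + 1)} {w : Fin (n + 1) → 𝕜} (hw : w i ≠ 0)
    (a : Fin (n + 1) → 𝕜) :
    ∑ k, ProjChart.vec i (normalise i w) k * a k = 0 ↔ ∑ k, w k * a k = 0 := by
  simp [vec_normalise hw, mul_assoc, ← Finset.mul_sum, hw]

theorem normalise_vec (i : Fin (n + 1)) (p : Fin n → 𝕜) :
    normalise i (ProjChart.vec i p) = p := by
  funext j
  simp [normalise, ProjChart.vec]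

variable {V : Type*} [NormedAddCommGroup V] [NormedSpace 𝕜 V]

theorem IsSmoothGerm.normalise {w : V → Fin (n + 1) → 𝕜} {x : V}
    (hw : IsSmoothGerm (𝕜 := 𝕜) w x) {i : Fin (n + 1)} (hi : w x i ≠ 0) :
    IsSmoothGerm (𝕜 := 𝕜) (fun y => normalise i (w y)) x := by
  refine isSmoothGerm_pi.2 fun j => ?_
  filter_upwards [hw.apply i, hw.apply (i.succAbove j),
    (hw.apply i).continuousAt.eventually_ne hi] with y h1 h2 h3 using h2.div h1 h3

theorem IsSmoothGerm.vec {p : V → Fin n → 𝕜} {x : V}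
    (hp : IsSmoothGerm (𝕜 := 𝕜) p x) (i : Fin (n + 1)) :
    IsSmoothGerm (𝕜 := 𝕜) (fun y => ProjChart.vec i (p y)) x := by
  refine isSmoothGerm_pi.2 fun k => ?_
  refine i.succAboveCases ?_ (fun j => ?_) k
  · simpa [ProjChart.vec] using .of_contDiff contDiff_const _
  · simpa [ProjChart.vec] using hp.apply j

theorem fderiv_snoc {V : Type*} [NormedAddCommGroup V] [NormedSpace 𝕜 V]
    {g : V → Fin n → 𝕜} {c : V → 𝕜} {x : V}
    (hg : DifferentiableAt 𝕜 g x) (hc : DifferentiableAt 𝕜 c x) (v : V) :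
    fderiv 𝕜 (fun y => (Fin.snoc (g y) (c y) : Fin (n + 1) → 𝕜)) x v =
      (Fin.snoc (fderiv 𝕜 g x v) (fderiv 𝕜 c x v) : Fin (n + 1) → 𝕜) := by
  have hd : DifferentiableAt 𝕜 (fun y => (Fin.snoc (g y) (c y) : Fin (n + 1) → 𝕜)) x := by
    refine differentiableAt_pi.2 fun k => ?_
    refine Fin.lastCases ?_ (fun j => ?_) k
    · simpa using hc
    · simpa using differentiableAt_pi.1 hg j
  funext k
  rw [← fderiv_coord hd]
  refine Fin.lastCases ?_ (fun j => ?_) k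
  · simp
  · simp [fderiv_coord hg]

end Normalise

section Frontal

variable {𝕜 : Type*} [RCLike 𝕜] {n : ℕ}

theorem tProj_velocity {F : (Fin n → 𝕜) → PTCot 𝕜 n} {G : (Fin n → 𝕜) × 𝕜 → PTCot 𝕜 n}
    (hG : IsSmoothGermPT G 0) (h0 : ∀ᶠ x in 𝓝 (0 : Fin n → 𝕜), G (x, 0) = F x) :
    tProj F (velocity F G) = ((fun x => deriv (fun t => proj (G (x, t))) 0 :
      (Fin n → 𝕜) → Fin (n + 1) → 𝕜) : Germ (𝓝 (0 : Fin n → 𝕜)) (Fin (n + 1) → 𝕜)) :=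
  Germ.coe_eq.2 (dproj_velocitySection hG h0)

theorem IsSmoothGermPT.proj {V : Type*} [NormedAddCommGroup V] [NormedSpace 𝕜 V] {F : V → PTCot 𝕜 n}
    {x : V} (hF : IsSmoothGermPT F x) : IsSmoothGerm (𝕜 := 𝕜) (fun y => proj (F y)) x := by
  obtain ⟨i, hi⟩ := ProjChart.exists_mem_dom (F x).2
  exact (hF.affineCoord hi).fst

/-- An integral deformation `(g_t, [w_t])` projects to a frontal unfolding: the covectors
`[w_t, -w_t(∂g_t/∂t)]` define an integral lift of `(x, t) ↦ (g_t(x), t)`. -/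
theorem tProj_velocity_mem_frontalDeformations {f : (Fin n → 𝕜) → Fin (n + 1) → 𝕜}
    {F : (Fin n → 𝕜) → PTCot 𝕜 n} (hF : IsLegendrianLift F f 0)
    {G : (Fin n → 𝕜) × 𝕜 → PTCot 𝕜 n}
    (hG : IsSmoothGermPT G 0) (h0 : ∀ᶠ x in 𝓝 (0 : Fin n → 𝕜), G (x, 0) = F x)
    (hint : ∀ᶠ p in 𝓝 (0 : (Fin n → 𝕜) × 𝕜), IsIntegralAt (fun x => G (x, p.2)) p.1) :
    tProj F (velocity F G) ∈ frontalDeformations f := by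
  obtain ⟨i, hi⟩ := ProjChart.exists_mem_dom (G 0).2
  have hz := hG.proj
  refine ⟨fun r => proj (G r), hz, ?_, ?_, tProj_velocity hG h0⟩
  · filter_upwards [h0, hF.proj_eq] with x h1 h2
    rw [h1, h2]
  have hw := (hG.affineCoord hi).snd.vec i
  set w : (Fin n → 𝕜) × 𝕜 → Fin (n + 1) → 𝕜 :=
    fun r => ProjChart.vec i (affineCoord i (G r)).2 with hwdef
  have hdt : IsSmoothGerm (𝕜 := 𝕜) (fun r => fderiv 𝕜 (fun r => proj (G r)) r (0, 1)) 0 :=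
    hz.fderiv.clm_apply (.of_contDiff contDiff_const _)
  -- The value of the last component is forced by `W (∂g_t/∂t, 1) = 0`.
  set W : (Fin n → 𝕜) × 𝕜 → Fin (n + 2) → 𝕜 := fun r => Fin.snoc (w r)
    (-∑ k, w r k * fderiv 𝕜 (fun r => proj (G r)) r (0, 1) k) with hWdef
  have hW : IsSmoothGerm (𝕜 := 𝕜) W 0 := by
    refine isSmoothGerm_pi.2 fun k => ?_
    refine Fin.lastCases ?_ (fun j => ?_) k
    · simpa [hWdef] using (IsSmoothGerm.sum fun k => (hw.apply k).mul (hdt.apply k)).neg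
    · simpa [hWdef] using hw.apply j
  have hWi : ∀ r, W r i.castSucc = 1 := by
    intro r
    simp [hWdef, hwdef, ProjChart.vec]
  have hWi0 : ∀ r, W r i.castSucc ≠ 0 := fun r => by rw [hWi]; exact one_ne_zero
  have hg : IsSmoothGerm (𝕜 := 𝕜)
      (fun r : (Fin n → 𝕜) × 𝕜 => (Fin.snoc (proj (G r)) r.2 : Fin (n + 2) → 𝕜)) 0 := by
    refine isSmoothGerm_pi.2 fun k => ?_
    refine Fin.lastCases ?_ (fun j => ?_) k
    · simpa using .of_contDiff contDiff_snd _
    · simpa using hz.apply j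
  have hH := hg.prodMk (hW.normalise (hWi0 0))
  refine ⟨fun r => ofAffine i.castSucc
    ((Fin.snoc (proj (G r)) r.2 : Fin (n + 2) → 𝕜), normalise i.castSucc (W r)),
    hH.ofAffine _, ?_, Eventually.of_forall fun r => rfl⟩
  filter_upwards [hH.differentiableAt, hint, hG.eventually_mem_dom hi, hz.differentiableAt,
    hG.mdifferentiableAt] with r h1 h2 h3 h4 h5
  refine (isIntegralAt_ofAffine_iff h1).2 fun v => ?_
  rw [sum_vec_normalise_mul_eq_zero_iff (hWi0 r)]
  obtain ⟨s, t⟩ := r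
  obtain ⟨v₁, v₂⟩ := v
  have hm : MDifferentiableAt 𝓘(𝕜, Fin n → 𝕜) (PTModel 𝕜 n) (fun x => G (x, t)) s := by
    have : DifferentiableAt 𝕜 (fun x : Fin n → 𝕜 => (x, t)) s := by fun_prop
    exact MDifferentiableAt.comp s (g := G) (f := fun x => (x, t)) h5 this.mdifferentiableAt
  have h6 := (isIntegralAt_iff (F := fun x => G (x, t)) h3 hm).1 h2 v₁
  have h7 : HasFDerivAt (fun x : Fin n → 𝕜 => proj (G (x, t)))
      ((fderiv 𝕜 (fun r => proj (G r)) (s, t)).comp (ContinuousLinearMap.inl 𝕜 (Fin n → 𝕜) 𝕜)) s :=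
    HasFDerivAt.comp s (g := fun r => proj (G r)) h4.hasFDerivAt (hasFDerivAt_prodMk_left s t)
  rw [h7.fderiv] at h6
  simp only [ContinuousLinearMap.comp_apply, ContinuousLinearMap.inl_apply] at h6
  simp only [fderiv_snoc h4 differentiableAt_snd]
  have h8 : ((v₁, v₂) : (Fin n → 𝕜) × 𝕜) = (v₁, 0) + v₂ • (0, 1) := by simp
  rw [Fin.sum_univ_castSucc]
  simp only [hWdef, Fin.snoc_castSucc, Fin.snoc_last, fderiv_snd, ContinuousLinearMap.coe_snd']
  rw [h8, map_add, map_smul]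
  simp only [Pi.add_apply, Pi.smul_apply, smul_eq_mul, mul_add, Finset.sum_add_distrib,
    mul_left_comm _ v₂, ← Finset.mul_sum]
  rw [h6]
  ring

/-- A deformation with frontal unfolding lifts to an integral deformation of the Nash lift. -/
theorem exists_integral_deformation_of_frontal {f : (Fin n → 𝕜) → Fin (n + 1) → 𝕜}
    {F : (Fin n → 𝕜) → PTCot 𝕜 n} (hF : IsLegendrianLift F f 0)
    (hf : ∃ U ∈ 𝓝 (0 : Fin n → 𝕜),
      IsNowhereDense {y ∈ U | ¬ Function.Injective (fderiv 𝕜 f y)})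
    {g : (Fin n → 𝕜) × 𝕜 → Fin (n + 1) → 𝕜} (hg : IsSmoothGerm (𝕜 := 𝕜) g 0)
    (hg0 : ∀ᶠ x in 𝓝 (0 : Fin n → 𝕜), g (x, 0) = f x)
    (hfr : IsFrontalGerm (𝕜 := 𝕜) (n := n + 1)
      (fun p : (Fin n → 𝕜) × 𝕜 => (Fin.snoc (g p) p.2 : Fin (n + 2) → 𝕜)) 0) :
    ∃ G : (Fin n → 𝕜) × 𝕜 → PTCot 𝕜 n, IsSmoothGermPT G 0 ∧
      (∀ᶠ x in 𝓝 (0 : Fin n → 𝕜), G (x, 0) = F x) ∧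
      (∀ᶠ p in 𝓝 (0 : (Fin n → 𝕜) × 𝕜), IsIntegralAt (fun x => G (x, p.2)) p.1) ∧
      ∀ r, proj (G r) = g r := by
  obtain ⟨i, hi⟩ := ProjChart.exists_mem_dom (F 0).2
  obtain ⟨L, hL⟩ := hfr
  obtain ⟨I, hI⟩ := ProjChart.exists_mem_dom (L 0).2
  have hW := (hL.smooth.affineCoord hI).snd.vec I
  set W : (Fin n → 𝕜) × 𝕜 → Fin (n + 2) → 𝕜 :=
    fun r => ProjChart.vec I (affineCoord I (L r)).2 with hWdef
  -- The lift `[w, c]` of the unfolding restricts to the candidate `[w]` for the lifts of `g_t`.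
  set w : (Fin n → 𝕜) × 𝕜 → Fin (n + 1) → 𝕜 := fun r k => W r k.castSucc with hwdef
  have hw : IsSmoothGerm (𝕜 := 𝕜) w 0 := isSmoothGerm_pi.2 fun k => hW.apply k.castSucc
  have hrel : ∀ᶠ r in 𝓝 (0 : (Fin n → 𝕜) × 𝕜), ∀ v : (Fin n → 𝕜) × 𝕜,
      ∑ k, w r k * fderiv 𝕜 g r v k + W r (Fin.last _) * v.2 = 0 := by
    filter_upwards [hL.integral, hL.smooth.eventually_mem_dom hI, hL.smooth.mdifferentiableAt,
      hL.proj_eq.eventually_nhds, hg.differentiableAt] with r h1 h2 h3 h4 h5 v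
    have h6 := (isIntegralAt_iff h2 h3).1 h1 v
    have h7 : (fun y => proj (L y)) =ᶠ[𝓝 r] fun p => (Fin.snoc (g p) p.2 : Fin (n + 2) → 𝕜) := h4
    rw [h7.fderiv_eq, fderiv_snoc h5 differentiableAt_snd, Fin.sum_univ_castSucc] at h6
    simp only [Fin.snoc_castSucc, Fin.snoc_last] at h6
    rwa [show fderiv 𝕜 (fun p : (Fin n → 𝕜) × 𝕜 => p.2) r = _ from fderiv_snd] at h6
  have hrelx : ∀ᶠ r in 𝓝 (0 : (Fin n → 𝕜) × 𝕜), ∀ v : Fin n → 𝕜,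
      ∑ k, w r k * fderiv 𝕜 (fun x => g (x, r.2)) r.1 v k = 0 := by
    filter_upwards [hrel, hg.differentiableAt] with r h1 h2 v
    have h3 : HasFDerivAt (fun x : Fin n → 𝕜 => g (x, r.2))
        ((fderiv 𝕜 g r).comp (ContinuousLinearMap.inl 𝕜 (Fin n → 𝕜) 𝕜)) r.1 :=
      HasFDerivAt.comp r.1 (g := g) h2.hasFDerivAt (hasFDerivAt_prodMk_left r.1 r.2)
    have h4 := h1 (v, 0)
    rw [h3.fderiv]
    simpa using h4
  -- At `t = 0` the covectors `w` are proportional to those of `F`.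
  have hprop : ∀ᶠ s in 𝓝 (0 : Fin n → 𝕜), ∀ j,
      w (s, 0) (i.succAbove j) = w (s, 0) i * (affineCoord i (F s)).2 j := by
    have hb : ∀ᶠ s in 𝓝 (0 : Fin n → 𝕜), (fun j => w (s, 0) (i.succAbove j) -
        w (s, 0) i * (affineCoord i (F s)).2 j) = 0 := by
      have hFrel := hF.eventually_integral_affine hi
      have hpair : IsSmoothGerm (𝕜 := 𝕜) (fun s : Fin n → 𝕜 => (s, (0 : 𝕜))) 0 :=
        .of_contDiff (by fun_prop) _
      have hws : IsSmoothGerm (𝕜 := 𝕜) (fun s : Fin n → 𝕜 => w (s, 0)) 0 :=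
        IsSmoothGerm.comp (g := w) (h := fun s : Fin n → 𝕜 => (s, (0 : 𝕜))) hw hpair
      have hbs : IsSmoothGerm (𝕜 := 𝕜) (fun s j => w (s, 0) (i.succAbove j) -
          w (s, 0) i * (affineCoord i (F s)).2 j) 0 :=
        isSmoothGerm_pi.2 fun j => (hws.apply _).sub
          ((hws.apply i).mul ((hF.smooth.affineCoord hi).snd.apply j))
      refine eventually_eq_zero_of_sum_eq_zero hf hFrel (hbs.mono fun s hs => hs.continuousAt) ?_
      filter_upwards [hFrel, tendsto_prodMk_zero.eventually hrelx, hg0.eventually_nhds]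
        with s h1 h2 h3 v
      have h4 : (fun x => g (x, 0)) =ᶠ[𝓝 s] f := h3
      have h5 := h2 v
      rw [h4.fderiv_eq, Fin.sum_univ_succAbove _ i] at h5
      simp only [sub_mul, Finset.sum_sub_distrib, mul_assoc, ← Finset.mul_sum]
      linear_combination h5 - w (s, 0) i * h1 v
    filter_upwards [hb] with s hs j
    exact sub_eq_zero.1 (congrFun hs j)
  -- If `w 0 i = 0`, then `w 0 = 0`, and the integrality condition in the direction of `t` makes
  -- the last component of the nonzero covector `W 0` vanish as well.
  have hwi : w 0 i ≠ 0 := by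
    intro h0
    have h1 : w 0 = 0 := by
      funext k
      refine i.succAboveCases h0 (fun j => ?_) k
      have := hprop.self_of_nhds j
      rw [Prod.mk_zero_zero, h0, zero_mul] at this
      exact this
    have h2 := hrel.self_of_nhds (0, 1)
    rw [h1] at h2
    refine ProjChart.vec_ne_zero I (affineCoord I (L 0)).2 (funext fun k => ?_)
    refine Fin.lastCases ?_ (fun j => congrFun h1 j) k
    simpa using h2
  have hH := hg.prodMk (hw.normalise hwi)
  refine ⟨fun r => ofAffine i (g r, normalise i (w r)), hH.ofAffine i, ?_, ?_, fun r => rfl⟩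
  · have hwi' : ∀ᶠ s in 𝓝 (0 : Fin n → 𝕜), w (s, 0) i ≠ 0 :=
      tendsto_prodMk_zero.eventually ((hw.apply i).continuousAt.eventually_ne hwi)
    filter_upwards [hg0, hF.proj_eq, hprop, hF.smooth.eventually_mem_dom hi, hwi']
      with s h1 h2 h3 h4 h5
    refine Eq.trans (congrArg _ ?_) (ofAffine_affineCoord h4)
    refine Prod.ext (h1.trans h2.symm) (funext fun j => ?_)
    simp only [normalise, h3 j]
    field_simp
  · filter_upwards [hrelx, hH.differentiableAt_fst,
      (hw.apply i).continuousAt.eventually_ne hwi] with r h1 h2 h3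
    refine (isIntegralAt_ofAffine_iff
      (h := fun x => (g (x, r.2), normalise i (w (x, r.2)))) h2).2 fun v => ?_
    exact (sum_vec_normalise_mul_eq_zero_iff h3 _).2 (h1 v)

/-- Frontal deformations are the projections of the integral deformations of the Nash lift. -/
theorem image_tProj_integralDeformations {f : (Fin n → 𝕜) → Fin (n + 1) → 𝕜}
    {F : (Fin n → 𝕜) → PTCot 𝕜 n} (hF : IsLegendrianLift F f 0)
    (hf : ∃ U ∈ 𝓝 (0 : Fin n → 𝕜),
      IsNowhereDense {y ∈ U | ¬ Function.Injective (fderiv 𝕜 f y)}) :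
    tProj F '' integralDeformations F = frontalDeformations f := by
  refine Subset.antisymm ?_ ?_
  · rintro _ ⟨_, ⟨G, h1, h2, h3, rfl⟩, rfl⟩
    exact tProj_velocity_mem_frontalDeformations hF h1 h2 h3
  · rintro _ ⟨g, h1, h2, h3, rfl⟩
    obtain ⟨G, k1, k2, k3, k4⟩ := exists_integral_deformation_of_frontal hF hf h1 h2 h3
    refine ⟨velocity F G, ⟨G, k1, k2, k3, rfl⟩, ?_⟩
    rw [tProj_velocity k1 k2]
    simp only [k4]

end Frontal

/-! ### Trivial Legendrian deformations -/

section TrivialDeformations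

variable {𝕜 : Type*} [RCLike 𝕜] {n : ℕ}

/-- The trivial deformations `Ψ_t ∘ F ∘ σ_t` are smooth integral deformations of `F`. -/
theorem isIntegral_trivial_deformation {f : (Fin n → 𝕜) → Fin (n + 1) → 𝕜}
    {F : (Fin n → 𝕜) → PTCot 𝕜 n} (hF : IsLegendrianLift F f 0)
    {σ : (Fin n → 𝕜) × 𝕜 → Fin n → 𝕜} {Ψ : PTCot 𝕜 n × 𝕜 → PTCot 𝕜 n}
    (hσ : IsSmoothGerm (𝕜 := 𝕜) σ 0) (hσ0 : ∀ᶠ x in 𝓝 (0 : Fin n → 𝕜), σ (x, 0) = x)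
    (hΨ : IsLegendrianFamily Ψ (F 0)) :
    IsSmoothGermPT (fun r => Ψ (F (σ r), r.2)) 0 ∧
    (∀ᶠ x in 𝓝 (0 : Fin n → 𝕜), Ψ (F (σ (x, 0)), 0) = F x) ∧
    ∀ᶠ p in 𝓝 (0 : (Fin n → 𝕜) × 𝕜), IsIntegralAt (fun x => Ψ (F (σ (x, p.2)), p.2)) p.1 := by
  have hσ00 : σ 0 = 0 := hσ0.self_of_nhds
  have hσc : Tendsto σ (𝓝 0) (𝓝 0) := by
    have := hσ.continuousAt
    rwa [ContinuousAt, hσ00] at this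
  have hFc : ContinuousAt F 0 := hF.smooth.self_of_nhds.continuousAt
  have hpair : Tendsto (fun r : (Fin n → 𝕜) × 𝕜 => (F (σ r), r.2)) (𝓝 0) (𝓝 (F 0, 0)) :=
    (hFc.tendsto.comp hσc).prodMk_nhds continuous_snd.continuousAt
  refine ⟨?_, ?_, ?_⟩
  · filter_upwards [hσ, hσc.eventually hF.smooth, hpair.eventually hΨ.smooth] with r h1 h2 h3
    have h4 : ContMDiffAt 𝓘(𝕜, (Fin n → 𝕜) × 𝕜) (PTModel 𝕜 n) ∞ (fun r => F (σ r)) r :=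
      ContMDiffAt.comp r (g := F) (f := σ) h2 h1.contMDiffAt
    have h5 : ContMDiffAt 𝓘(𝕜, (Fin n → 𝕜) × 𝕜) 𝓘(𝕜, 𝕜) ∞
        (fun r : (Fin n → 𝕜) × 𝕜 => r.2) r := contDiffAt_snd.contMDiffAt
    exact ContMDiffAt.comp r (g := Ψ) (f := fun r => (F (σ r), r.2)) h3 (h4.prodMk h5)
  · filter_upwards [hσ0, hFc.eventually hΨ.start] with x h1 h2
    rw [h1, h2]
  · filter_upwards [hσ.differentiableAt_fst, hσc.eventually hF.smooth, hσc.eventually hF.integral,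
      hpair.eventually hΨ.smooth, hpair.eventually hΨ.contact] with r h1 h2 h3 h4 h5
    obtain ⟨s, t⟩ := r
    have k1 : MDifferentiableAt (PTModel 𝕜 n) (PTModel 𝕜 n) (fun q => Ψ (q, t)) (F (σ (s, t))) :=
      (ContMDiffAt.comp (F (σ (s, t))) (g := Ψ) (f := fun q => (q, t)) h4
        (contMDiffAt_id.prodMk contMDiffAt_const)).mdifferentiableAt (by simp)
    have k2 : MDifferentiableAt 𝓘(𝕜, Fin n → 𝕜) (PTModel 𝕜 n) F (σ (s, t)) :=
      h2.mdifferentiableAt (by simp)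
    have k3 : MDifferentiableAt 𝓘(𝕜, Fin n → 𝕜) 𝓘(𝕜, Fin n → 𝕜) (fun x => σ (x, t)) s :=
      h1.mdifferentiableAt
    have k4 : MDifferentiableAt 𝓘(𝕜, Fin n → 𝕜) (PTModel 𝕜 n) (fun x => F (σ (x, t))) s :=
      MDifferentiableAt.comp s (g := F) (f := fun x => σ (x, t)) k2 k3
    intro v
    have e1 := mfderiv_comp_apply s (g := fun q => Ψ (q, t)) (f := fun x => F (σ (x, t))) k1 k4 v
    have e2 := mfderiv_comp_apply s (g := F) (f := fun x => σ (x, t)) k2 k3 v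
    refine (congrArg (· ∈ contactPlane (Ψ (F (σ (s, t)), t))) e1).mpr ?_
    refine (congrArg (_ ∈ ·) h5).mp ?_
    exact Submodule.mem_map_of_mem ((congrArg (· ∈ contactPlane (F (σ (s, t)))) e2).mpr (h3 _))

theorem legendrianTangent_subset {f : (Fin n → 𝕜) → Fin (n + 1) → 𝕜}
    {F : (Fin n → 𝕜) → PTCot 𝕜 n} (hF : IsLegendrianLift F f 0) :
    legendrianTangent F ⊆ integralDeformations F := by
  rintro _ ⟨σ, Ψ, h1, h2, h3, rfl⟩
  obtain ⟨k1, k2, k3⟩ := isIntegral_trivial_deformation hF h1 h2 h3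
  exact ⟨_, k1, k2, k3, rfl⟩

theorem isSmoothGerm_of_isLegendrianLift {f : (Fin n → 𝕜) → Fin (n + 1) → 𝕜}
    {F : (Fin n → 𝕜) → PTCot 𝕜 n} (hF : IsLegendrianLift F f 0) : IsSmoothGerm (𝕜 := 𝕜) f 0 :=
  hF.smooth.proj.congr (hF.proj_eq.mono fun _ h => h.symm)

/-- The projection of `Ψ_t ∘ F ∘ σ_t` is `ψ_t ∘ f ∘ σ_t`, whose velocity is `df ∘ a + b ∘ f` for the
velocities `a` of `σ_t` and `b` of `ψ_t` at `t = 0`. -/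
theorem tProj_mem_extendedTangent {f : (Fin n → 𝕜) → Fin (n + 1) → 𝕜}
    {F : (Fin n → 𝕜) → PTCot 𝕜 n} (hF : IsLegendrianLift F f 0) {ξ : FieldGerm F}
    (hξ : ξ ∈ legendrianTangent F) : tProj F ξ ∈ extendedTangent f := by
  obtain ⟨σ, Ψ, hσ, hσ0, hΨ, rfl⟩ := hξ
  obtain ⟨k1, k2, k3⟩ := isIntegral_trivial_deformation hF hσ hσ0 hΨ
  have hf := isSmoothGerm_of_isLegendrianLift hF
  have hf0 : proj (F 0) = f 0 := hF.proj_eq.self_of_nhds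
  obtain ⟨ψ, hψ, hcov⟩ := hΨ.covers
  rw [hf0] at hψ
  obtain ⟨i, hi⟩ := ProjChart.exists_mem_dom (F 0).2
  -- `ψ_0` is the identity because `π` has local sections.
  have hψ0 : ∀ᶠ z in 𝓝 (f 0), ψ (z, 0) = z := by
    have hsec : Tendsto (fun z => ofAffine i (z, (affineCoord i (F 0)).2)) (𝓝 (f 0))
        (𝓝 (F 0)) := by
      have hc : Continuous fun z : Fin (n + 1) → 𝕜 =>
          ofAffine i (z, (affineCoord i (F 0)).2) :=
        (contMDiff_ofAffine i).continuous.comp (by fun_prop)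
      have h1 : ofAffine i (f 0, (affineCoord i (F 0)).2) = F 0 := by
        rw [← hf0]; exact ofAffine_affineCoord hi
      simpa [h1] using hc.tendsto (f 0)
    have hsec' : Tendsto (fun z => (ofAffine i (z, (affineCoord i (F 0)).2), (0 : 𝕜))) (𝓝 (f 0))
        (𝓝 (F 0, 0)) := hsec.prodMk_nhds tendsto_const_nhds
    filter_upwards [hsec.eventually hΨ.start, hsec'.eventually hcov] with z h1 h2
    rw [h1] at h2
    exact h2.symm
  have hfc : Tendsto f (𝓝 0) (𝓝 (f 0)) := hf.continuousAt
  have hpz : Tendsto (fun z : Fin (n + 1) → 𝕜 => (z, (0 : 𝕜))) (𝓝 (f 0)) (𝓝 (f 0, 0)) :=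
    tendsto_id.prodMk_nhds tendsto_const_nhds
  refine ⟨fun x => fderiv 𝕜 σ (x, 0) (0, 1), fun z => fderiv 𝕜 ψ (z, 0) (0, 1), ?_, ?_, ?_⟩
  · have hpair : IsSmoothGerm (𝕜 := 𝕜) (fun s : Fin n → 𝕜 => (s, (0 : 𝕜))) 0 :=
      .of_contDiff (by fun_prop) _
    exact (IsSmoothGerm.comp (g := fderiv 𝕜 σ) (h := fun s : Fin n → 𝕜 => (s, (0 : 𝕜)))
      hσ.fderiv hpair).clm_apply (.of_contDiff contDiff_const _)
  · have hpair : IsSmoothGerm (𝕜 := 𝕜) (fun s : Fin (n + 1) → 𝕜 => (s, (0 : 𝕜))) (f 0) :=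
      .of_contDiff (by fun_prop) _
    exact (IsSmoothGerm.comp (g := fderiv 𝕜 ψ) (h := fun s : Fin (n + 1) → 𝕜 => (s, (0 : 𝕜)))
      hψ.fderiv hpair).clm_apply (.of_contDiff contDiff_const _)
  · rw [tProj_velocity k1 k2]
    refine Germ.coe_eq.2 ?_
    have hσ00 : σ 0 = 0 := hσ0.self_of_nhds
    have hσc : Tendsto σ (𝓝 0) (𝓝 0) := by
      have := hσ.continuousAt
      rwa [ContinuousAt, hσ00] at this
    have hFc : ContinuousAt F 0 := hF.smooth.self_of_nhds.continuousAt
    have hpair : Tendsto (fun r : (Fin n → 𝕜) × 𝕜 => (F (σ r), r.2)) (𝓝 0) (𝓝 (F 0, 0)) :=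
      (hFc.tendsto.comp hσc).prodMk_nhds continuous_snd.continuousAt
    have hproj : ∀ᶠ r in 𝓝 ((0 : Fin n → 𝕜), (0 : 𝕜)),
        proj (Ψ (F (σ r), r.2)) = ψ (f (σ r), r.2) := by
      filter_upwards [hpair.eventually hcov, hσc.eventually hF.proj_eq] with r h1 h2
      rw [h1, h2]
    filter_upwards [hproj.curry_nhds, tendsto_prodMk_zero.eventually hσ.differentiableAt, hσ0,
      hf.differentiableAt, hfc.eventually (hpz.eventually hψ.differentiableAt),
      hfc.eventually hψ0.eventually_nhds] with x h1 h2 h3 h4 h5 h6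
    have h7 : (fun t => proj (Ψ (F (σ (x, t)), t))) =ᶠ[𝓝 0] fun t => ψ (f (σ (x, t)), t) := h1
    rw [h7.deriv_eq]
    have hline : HasDerivAt (fun t : 𝕜 => (x, t)) ((0, 1) : (Fin n → 𝕜) × 𝕜) 0 :=
      (hasDerivAt_const (0 : 𝕜) x).prodMk (hasDerivAt_id 0)
    have d1 : HasDerivAt (fun t : 𝕜 => σ (x, t)) (fderiv 𝕜 σ (x, 0) (0, 1)) 0 :=
      h2.hasFDerivAt.comp_hasDerivAt (0 : 𝕜) hline
    have d2 : HasDerivAt (fun t : 𝕜 => f (σ (x, t))) (fderiv 𝕜 f x (fderiv 𝕜 σ (x, 0) (0, 1))) 0 :=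
      HasFDerivAt.comp_hasDerivAt_of_eq (0 : 𝕜) h4.hasFDerivAt d1 h3.symm
    have d3 : HasDerivAt (fun t : 𝕜 => ψ (f (σ (x, t)), t))
        (fderiv 𝕜 ψ (f x, 0) (fderiv 𝕜 f x (fderiv 𝕜 σ (x, 0) (0, 1)), 1)) 0 :=
      HasFDerivAt.comp_hasDerivAt_of_eq (0 : 𝕜) h5.hasFDerivAt (d2.prodMk (hasDerivAt_id 0))
        (by rw [h3])
    rw [d3.deriv]
    have h8 : ∀ v, fderiv 𝕜 ψ (f x, 0) (v, 0) = v := by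
      intro v
      have h9 : HasFDerivAt (fun z : Fin (n + 1) → 𝕜 => ψ (z, 0))
          ((fderiv 𝕜 ψ (f x, 0)).comp (ContinuousLinearMap.inl 𝕜 (Fin (n + 1) → 𝕜) 𝕜)) (f x) :=
        HasFDerivAt.comp (f x) (g := ψ) h5.hasFDerivAt (hasFDerivAt_prodMk_left (f x) (0 : 𝕜))
      have h10 : (fun z : Fin (n + 1) → 𝕜 => ψ (z, 0)) =ᶠ[𝓝 (f x)] id := h6
      have h11 := h9.unique ((hasFDerivAt_id (f x)).congr_of_eventuallyEq h10)
      exact DFunLike.congr_fun h11 v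
    rw [show ((fderiv 𝕜 f x (fderiv 𝕜 σ (x, 0) (0, 1)), 1) : (Fin (n + 1) → 𝕜) × 𝕜) =
      (fderiv 𝕜 f x (fderiv 𝕜 σ (x, 0) (0, 1)), 0) + (0, 1) by simp, map_add, h8]

end TrivialDeformations

/-! ### Contact lifts of vector fields on the base -/

section ContactLift

variable {𝕜 : Type*} [RCLike 𝕜] {n : ℕ}
  {V : Type*} [NormedAddCommGroup V] [NormedSpace 𝕜 V]

theorem isSmoothGerm_det {ι : Type*} [Fintype ι] [DecidableEq ι] {A : V → Matrix ι ι 𝕜} {x : V}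
    (hA : ∀ k l, IsSmoothGerm (𝕜 := 𝕜) (fun y => A y k l) x) :
    IsSmoothGerm (𝕜 := 𝕜) (fun y => (A y).det) x := by
  simp only [Matrix.det_apply']
  refine IsSmoothGerm.sum fun s => IsSmoothGerm.mul (.of_contDiff contDiff_const _) ?_
  filter_upwards [eventually_all.2 fun k => hA (s k) k] with y h
  exact contDiffAt_prod fun k _ => h k

theorem isSmoothGerm_adjugate {ι : Type*} [Fintype ι] [DecidableEq ι] {A : V → Matrix ι ι 𝕜}
    {x : V} (hA : ∀ k l, IsSmoothGerm (𝕜 := 𝕜) (fun y => A y k l) x) (k l : ι) :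
    IsSmoothGerm (𝕜 := 𝕜) (fun y => (A y).adjugate k l) x := by
  simp only [Matrix.adjugate_apply]
  refine isSmoothGerm_det fun a b => ?_
  by_cases ha : a = l
  · subst ha
    simpa using .of_contDiff contDiff_const _
  · simpa [ha] using hA a b

/-- The Jacobian matrix of `z ↦ z + t b(z)`. -/
noncomputable def shiftJacobian (b : (Fin n → 𝕜) → Fin n → 𝕜) (r : (Fin n → 𝕜) × 𝕜) :
    Matrix (Fin n) (Fin n) 𝕜 :=
  1 + r.2 • LinearMap.toMatrix' (fderiv 𝕜 b r.1).toLinearMap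

theorem shiftJacobian_zero_right (b : (Fin n → 𝕜) → Fin n → 𝕜) (z : Fin n → 𝕜) :
    shiftJacobian b (z, 0) = 1 := by simp [shiftJacobian]

theorem shiftJacobian_mulVec (b : (Fin n → 𝕜) → Fin n → 𝕜) (r : (Fin n → 𝕜) × 𝕜) (v : Fin n → 𝕜) :
    Matrix.mulVec (shiftJacobian b r) v = v + r.2 • fderiv 𝕜 b r.1 v := by
  rw [shiftJacobian, Matrix.add_mulVec, Matrix.one_mulVec, Matrix.smul_mulVec,
    LinearMap.toMatrix'_mulVec]
  rfl

theorem isSmoothGerm_shiftJacobian {b : (Fin n → 𝕜) → Fin n → 𝕜} {z₀ : Fin n → 𝕜}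
    (hb : IsSmoothGerm (𝕜 := 𝕜) b z₀) (k l : Fin n) :
    IsSmoothGerm (𝕜 := 𝕜) (fun r => shiftJacobian b r k l) (z₀, 0) := by
  have h1 : IsSmoothGerm (𝕜 := 𝕜) (fun r : (Fin n → 𝕜) × 𝕜 => fderiv 𝕜 b r.1) (z₀, 0) :=
    IsSmoothGerm.comp (g := fderiv 𝕜 b) (h := fun r : (Fin n → 𝕜) × 𝕜 => r.1)
      hb.fderiv (.of_contDiff contDiff_fst _)
  have h2 : IsSmoothGerm (𝕜 := 𝕜)
      (fun r : (Fin n → 𝕜) × 𝕜 => fderiv 𝕜 b r.1 (Pi.single l 1)) (z₀, 0) :=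
    h1.clm_apply (.of_contDiff contDiff_const _)
  have h3 : IsSmoothGerm (𝕜 := 𝕜) (fun r : (Fin n → 𝕜) × 𝕜 => r.2) (z₀, 0) :=
    .of_contDiff contDiff_snd _
  have h4 : IsSmoothGerm (𝕜 := 𝕜)
      (fun _ : (Fin n → 𝕜) × 𝕜 => (1 : Matrix (Fin n) (Fin n) 𝕜) k l) (z₀, 0) :=
    .of_contDiff contDiff_const _
  refine (h4.add (h3.mul (h2.apply k))).congr (Eventually.of_forall fun r => ?_)
  simp [shiftJacobian, LinearMap.toMatrix'_apply]

/-- The covector `w ∘ (dψ_t)⁻¹` for `ψ_t(z) = z + t b(z)`, up to the factor `det dψ_t`, which makes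
it polynomial in `dψ_t`. -/
noncomputable def liftedCovector (i : Fin (n + 1)) (b : (Fin (n + 1) → 𝕜) → Fin (n + 1) → 𝕜)
    (r : ((Fin (n + 1) → 𝕜) × (Fin n → 𝕜)) × 𝕜) : Fin (n + 1) → 𝕜 :=
  Matrix.vecMul (ProjChart.vec i r.1.2) (shiftJacobian b (r.1.1, r.2)).adjugate

/-- The contact lift of `ψ_t(z) = z + t b(z)` in affine coordinates. -/
noncomputable def contactLiftAffine (i : Fin (n + 1))
    (b : (Fin (n + 1) → 𝕜) → Fin (n + 1) → 𝕜)
    (r : ((Fin (n + 1) → 𝕜) × (Fin n → 𝕜)) × 𝕜) : (Fin (n + 1) → 𝕜) × (Fin n → 𝕜) :=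
  (r.1.1 + r.2 • b r.1.1, normalise i (liftedCovector i b r))

/-- The contact lift of `ψ_t(z) = z + t b(z)`. -/
noncomputable def contactLift (i : Fin (n + 1)) (b : (Fin (n + 1) → 𝕜) → Fin (n + 1) → 𝕜)
    (r : PTCot 𝕜 n × 𝕜) : PTCot 𝕜 n :=
  ofAffine i (contactLiftAffine i b (affineCoord i r.1, r.2))

variable {i : Fin (n + 1)} {b : (Fin (n + 1) → 𝕜) → Fin (n + 1) → 𝕜}

theorem liftedCovector_zero_right (e : (Fin (n + 1) → 𝕜) × (Fin n → 𝕜)) :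
    liftedCovector i b (e, 0) = ProjChart.vec i e.2 := by
  simp [liftedCovector, shiftJacobian_zero_right]

theorem contactLiftAffine_zero_right (e : (Fin (n + 1) → 𝕜) × (Fin n → 𝕜)) :
    contactLiftAffine i b (e, 0) = e := by
  rw [contactLiftAffine, liftedCovector_zero_right, normalise_vec]
  simp

theorem isSmoothGerm_liftedCovector {e₀ : (Fin (n + 1) → 𝕜) × (Fin n → 𝕜)}
    (hb : IsSmoothGerm (𝕜 := 𝕜) b e₀.1) :
    IsSmoothGerm (𝕜 := 𝕜) (liftedCovector i b) (e₀, 0) := by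
  refine isSmoothGerm_pi.2 fun k => ?_
  change IsSmoothGerm (𝕜 := 𝕜) (fun r : ((Fin (n + 1) → 𝕜) × (Fin n → 𝕜)) × 𝕜 =>
    ∑ l, ProjChart.vec i r.1.2 l * (shiftJacobian b (r.1.1, r.2)).adjugate l k) (e₀, 0)
  refine IsSmoothGerm.sum fun l => ?_
  have h1 : IsSmoothGerm (𝕜 := 𝕜)
      (fun r : ((Fin (n + 1) → 𝕜) × (Fin n → 𝕜)) × 𝕜 => r.1.2) (e₀, 0) :=
    .of_contDiff (contDiff_snd.comp contDiff_fst) _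
  have h2 : IsSmoothGerm (𝕜 := 𝕜)
      (fun r : ((Fin (n + 1) → 𝕜) × (Fin n → 𝕜)) × 𝕜 => (r.1.1, r.2)) (e₀, 0) :=
    .of_contDiff ((contDiff_fst.comp contDiff_fst).prodMk contDiff_snd) _
  have h3 := isSmoothGerm_adjugate (isSmoothGerm_shiftJacobian hb) l k
  exact ((h1.vec i).apply l).mul (IsSmoothGerm.comp
    (g := fun r => (shiftJacobian b r).adjugate l k)
    (h := fun r : ((Fin (n + 1) → 𝕜) × (Fin n → 𝕜)) × 𝕜 => (r.1.1, r.2)) h3 h2)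

theorem liftedCovector_ne_zero (e₀ : (Fin (n + 1) → 𝕜) × (Fin n → 𝕜)) :
    liftedCovector i b (e₀, 0) i ≠ 0 := by
  rw [liftedCovector_zero_right]
  simp [ProjChart.vec]

theorem isSmoothGerm_contactLiftAffine {e₀ : (Fin (n + 1) → 𝕜) × (Fin n → 𝕜)}
    (hb : IsSmoothGerm (𝕜 := 𝕜) b e₀.1) :
    IsSmoothGerm (𝕜 := 𝕜) (contactLiftAffine i b) (e₀, 0) := by
  have h1 : IsSmoothGerm (𝕜 := 𝕜)
      (fun r : ((Fin (n + 1) → 𝕜) × (Fin n → 𝕜)) × 𝕜 => r.1.1) (e₀, 0) :=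
    .of_contDiff (contDiff_fst.comp contDiff_fst) _
  have h2 : IsSmoothGerm (𝕜 := 𝕜)
      (fun r : ((Fin (n + 1) → 𝕜) × (Fin n → 𝕜)) × 𝕜 => r.2) (e₀, 0) :=
    .of_contDiff contDiff_snd _
  have h3 := IsSmoothGerm.comp (g := b)
    (h := fun r : ((Fin (n + 1) → 𝕜) × (Fin n → 𝕜)) × 𝕜 => r.1.1) hb h1
  exact (h1.add (h2.smul h3)).prodMk
    ((isSmoothGerm_liftedCovector hb).normalise (liftedCovector_ne_zero e₀))

/-- The lifted covector takes the values of the original one, up to the factor `det dψ_t`, on the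
images under `dψ_t`. -/
theorem liftedCovector_dotProduct (r : ((Fin (n + 1) → 𝕜) × (Fin n → 𝕜)) × 𝕜)
    (u : Fin (n + 1) → 𝕜) :
    ∑ k, liftedCovector i b r k * (u + r.2 • fderiv 𝕜 b r.1.1 u) k =
      (shiftJacobian b (r.1.1, r.2)).det * ∑ k, ProjChart.vec i r.1.2 k * u k := by
  have h1 := shiftJacobian_mulVec b (r.1.1, r.2) u
  simp only at h1
  rw [← h1]
  change dotProduct (liftedCovector i b r) _ = _ * dotProduct (ProjChart.vec i r.1.2) u
  rw [liftedCovector, ← Matrix.dotProduct_mulVec, Matrix.mulVec_mulVec, Matrix.adjugate_mul,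
    Matrix.smul_mulVec, Matrix.one_mulVec, dotProduct_smul, smul_eq_mul]

/-- The contact lift preserves the contact planes by `liftedCovector_dotProduct`. It maps each of
them onto the contact plane at the image point because its derivative is invertible for small
`t`. -/
theorem isLegendrianFamily_contactLift {q₀ : PTCot 𝕜 n} (hi : q₀.2 ∈ ProjChart.dom i)
    (hb : IsSmoothGerm (𝕜 := 𝕜) b (proj q₀)) : IsLegendrianFamily (contactLift i b) q₀ := by
  have hE := isSmoothGerm_contactLiftAffine (i := i) (e₀ := affineCoord i q₀) hb
  have hW := isSmoothGerm_liftedCovector (i := i) (e₀ := affineCoord i q₀) hb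
  have hdom : ∀ᶠ p in 𝓝 (q₀, (0 : 𝕜)), p.1.2 ∈ ProjChart.dom i :=
    (continuous_fst.tendsto (q₀, (0 : 𝕜))).eventually ((isOpen_affine_dom i).mem_nhds hi)
  have htend : Tendsto (fun p : PTCot 𝕜 n × 𝕜 => (affineCoord i p.1, p.2)) (𝓝 (q₀, 0))
      (𝓝 (affineCoord i q₀, 0)) :=
    ((contMDiffAt_affineCoord hi).continuousAt.tendsto.comp
      (continuous_fst.tendsto (q₀, (0 : 𝕜)))).prodMk_nhds (continuous_snd.tendsto (q₀, (0 : 𝕜)))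
  refine ⟨?_, ?_, ?_, ?_⟩
  · filter_upwards [htend.eventually hE, hdom] with p h1 h2
    have h3 : ContMDiffAt ((PTModel 𝕜 n).prod 𝓘(𝕜, 𝕜))
        𝓘(𝕜, ((Fin (n + 1) → 𝕜) × (Fin n → 𝕜)) × 𝕜) ∞
        (fun p : PTCot 𝕜 n × 𝕜 => (affineCoord i p.1, p.2)) p :=
      (ContMDiffAt.comp p (g := affineCoord i) (contMDiffAt_affineCoord h2)
        contMDiffAt_fst).prodMk_space contMDiffAt_snd
    have h4 := ContMDiffAt.comp p (g := contactLiftAffine i b)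
      (f := fun p : PTCot 𝕜 n × 𝕜 => (affineCoord i p.1, p.2)) h1.contMDiffAt h3
    exact ContMDiffAt.comp p (g := ofAffine i) (contMDiff_ofAffine i _) h4
  · filter_upwards [(isOpen_affine_dom i).mem_nhds hi] with q hq
    rw [contactLift, contactLiftAffine_zero_right, ofAffine_affineCoord hq]
  · -- Near `t = 0` the derivative of the lift is invertible.
    have hinv : ∀ᶠ r in 𝓝 (affineCoord i q₀, (0 : 𝕜)),
        (fderiv 𝕜 (fun e => contactLiftAffine i b (e, r.2)) r.1).IsInvertible := by
      have h1 : ∀ᶠ r in 𝓝 (affineCoord i q₀, (0 : 𝕜)),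
          fderiv 𝕜 (fun e => contactLiftAffine i b (e, r.2)) r.1 =
          (fderiv 𝕜 (contactLiftAffine i b) r).comp (ContinuousLinearMap.inl 𝕜 _ 𝕜) := by
        filter_upwards [hE.differentiableAt] with r h
        exact (HasFDerivAt.comp r.1 (g := contactLiftAffine i b) h.hasFDerivAt
          (hasFDerivAt_prodMk_left r.1 r.2)).fderiv
      have h2 : ContinuousAt (fun r => (fderiv 𝕜 (contactLiftAffine i b) r).comp
          (ContinuousLinearMap.inl 𝕜 _ 𝕜)) (affineCoord i q₀, (0 : 𝕜)) :=
        hE.fderiv.continuousAt.clm_comp continuousAt_const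
      have h3 := eventually_isInvertible_fderiv h2 (by
        rw [← h1.self_of_nhds]
        simp only [contactLiftAffine_zero_right, fderiv_fun_id]
        exact ⟨ContinuousLinearEquiv.refl 𝕜 _, rfl⟩)
      filter_upwards [h1, h3] with r k1 k2
      rwa [k1]
    have hdet : ∀ᶠ r in 𝓝 (affineCoord i q₀, (0 : 𝕜)),
        (shiftJacobian b (r.1.1, r.2)).det ≠ 0 := by
      have h1 : Tendsto (fun r : ((Fin (n + 1) → 𝕜) × (Fin n → 𝕜)) × 𝕜 => (r.1.1, r.2))
          (𝓝 (affineCoord i q₀, 0)) (𝓝 (proj q₀, 0)) :=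
        (continuous_fst.fst.prodMk continuous_snd).tendsto _
      refine h1.eventually ((isSmoothGerm_det
        (isSmoothGerm_shiftJacobian hb)).continuousAt.eventually_ne ?_)
      rw [shiftJacobian_zero_right, Matrix.det_one]
      exact one_ne_zero
    have hfst : Tendsto (fun r : ((Fin (n + 1) → 𝕜) × (Fin n → 𝕜)) × 𝕜 => r.1.1)
        (𝓝 (affineCoord i q₀, 0)) (𝓝 (proj q₀)) :=
      continuous_fst.fst.tendsto _
    filter_upwards [hdom, htend.eventually hinv, htend.eventually hdet,
      htend.eventually hE.differentiableAt,
      htend.eventually (hfst.eventually hb.differentiableAt),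
      htend.eventually ((hW.apply i).continuousAt.eventually_ne (liftedCovector_ne_zero _))]
      with p h1 h2 h3 h4 h5 h6
    obtain ⟨q, t⟩ := p
    set e := affineCoord i q with he
    have hA := (contMDiffAt_affineCoord h1).mdifferentiableAt (show (∞ : ℕ∞ω) ≠ 0 by simp)
    have hEt : DifferentiableAt 𝕜 (fun e => contactLiftAffine i b (e, t)) e :=
      DifferentiableAt.comp e (g := contactLiftAffine i b) (f := fun e => (e, t)) h4 (by fun_prop)
    have hEA : MDifferentiableAt (PTModel 𝕜 n) 𝓘(𝕜, (Fin (n + 1) → 𝕜) × (Fin n → 𝕜))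
        (fun q => contactLiftAffine i b (affineCoord i q, t)) q :=
      MDifferentiableAt.comp q (g := fun e => contactLiftAffine i b (e, t))
        hEt.mdifferentiableAt hA
    have hO := (contMDiff_ofAffine (𝕜 := 𝕜) i (contactLiftAffine i b (e, t))).mdifferentiableAt
      (show (∞ : ℕ∞ω) ≠ 0 by simp)
    have hmem : (contactLift i b (q, t)).2 ∈ ProjChart.dom i := ofAffine_mem_dom i _
    -- The derivative of the lift in affine coordinates.
    have hD : ∀ v : TangentSpace (PTModel 𝕜 n) q, affineDeriv i (contactLift i b (q, t))
        (mfderiv (PTModel 𝕜 n) (PTModel 𝕜 n) (fun q => contactLift i b (q, t)) q v) =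
        fderiv 𝕜 (fun e => contactLiftAffine i b (e, t)) e (affineDeriv i q v) := by
      intro v
      have k1 := mfderiv_comp_apply q (g := ofAffine i)
        (f := fun q => contactLiftAffine i b (affineCoord i q, t)) hO hEA v
      have k2 := mfderiv_comp_apply q (g := fun e => contactLiftAffine i b (e, t))
        (f := affineCoord i) hEt.mdifferentiableAt hA v
      rw [mfderiv_eq_fderiv] at k2
      have k3 := affineDeriv_mfderiv (ofAffine_mem_dom i _) hO
        (fderiv 𝕜 (fun e => contactLiftAffine i b (e, t)) e (affineDeriv i q v))
      simp only [affineCoord_ofAffine, fderiv_fun_id] at k3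
      refine Eq.trans ?_ k3
      refine congrArg (affineDeriv i (ofAffine i (contactLiftAffine i b (e, t)))) (k1.trans ?_)
      exact congrArg _ k2
    have hdD : ∀ v : TangentSpace (PTModel 𝕜 n) q, dproj (contactLift i b (q, t))
        (mfderiv (PTModel 𝕜 n) (PTModel 𝕜 n) (fun q => contactLift i b (q, t)) q v) =
        dproj q v + t • fderiv 𝕜 b e.1 (dproj q v) := by
      intro v
      rw [← affineDeriv_fst hmem, ← affineDeriv_fst h1]
      refine (congrArg Prod.fst (hD v)).trans ?_
      have k1 : HasFDerivAt (fun e : (Fin (n + 1) → 𝕜) × (Fin n → 𝕜) => e.1 + t • b e.1)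
          (ContinuousLinearMap.fst 𝕜 _ _ + t • (fderiv 𝕜 b e.1).comp
            (ContinuousLinearMap.fst 𝕜 _ _)) e :=
        hasFDerivAt_fst.add ((HasFDerivAt.comp e (g := b) h5.hasFDerivAt
          hasFDerivAt_fst).const_smul t)
      have k2 := hEt.hasFDerivAt.fst.unique k1
      exact DFunLike.congr_fun k2 (affineDeriv i q v)
    have hiff : ∀ v : TangentSpace (PTModel 𝕜 n) q,
        mfderiv (PTModel 𝕜 n) (PTModel 𝕜 n) (fun q => contactLift i b (q, t)) q v ∈
          contactPlane (contactLift i b (q, t)) ↔ v ∈ contactPlane q := by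
      intro v
      have k1 : (affineCoord i (contactLift i b (q, t))).2 =
          normalise i (liftedCovector i b (e, t)) := by
        rw [contactLift, affineCoord_ofAffine, contactLiftAffine]
      rw [mem_contactPlane_iff _ (mk_vec_affineCoord h1),
        mem_contactPlane_iff _ (mk_vec_affineCoord hmem), hdD]
      have k2 := sum_vec_normalise_mul_eq_zero_iff h6 (dproj q v + t • fderiv 𝕜 b e.1 (dproj q v))
      rw [liftedCovector_dotProduct (e, t), mul_eq_zero, or_iff_right h3, ← k1] at k2
      exact k2
    ext v'
    constructor
    · rintro ⟨v, hv, rfl⟩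
      exact (hiff v).2 hv
    · intro hv'
      obtain ⟨u, hu⟩ := h2.surjective (affineDeriv i (contactLift i b (q, t)) v')
      obtain ⟨v, rfl⟩ := (affineDeriv_bijective h1).2 u
      have k1 : mfderiv (PTModel 𝕜 n) (PTModel 𝕜 n) (fun q => contactLift i b (q, t)) q v = v' :=
        (affineDeriv_bijective hmem).1 ((hD v).trans hu)
      refine ⟨v, (hiff v).1 ?_, k1⟩
      exact k1.symm ▸ hv'
  · refine ⟨fun r => r.1 + r.2 • b r.1, ?_, Eventually.of_forall fun p => rfl⟩
    exact isSmoothGerm_shift hb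

/-- The germ `df ∘ a + b ∘ f` is the projection of the velocity of `Ψ_t ∘ F ∘ σ_t`, where
`σ_t(x) = x + t a(x)` and `Ψ_t` is the contact lift of `z ↦ z + t b(z)`. -/
theorem exists_legendrianTangent_of_mem_extendedTangent {f : (Fin n → 𝕜) → Fin (n + 1) → 𝕜}
    {F : (Fin n → 𝕜) → PTCot 𝕜 n} (hF : IsLegendrianLift F f 0)
    {η : Germ (𝓝 (0 : Fin n → 𝕜)) (Fin (n + 1) → 𝕜)} (hη : η ∈ extendedTangent f) :
    ∃ ξ ∈ legendrianTangent F, tProj F ξ = η := by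
  obtain ⟨a, b, ha, hb, rfl⟩ := hη
  obtain ⟨i, hi⟩ := ProjChart.exists_mem_dom (F 0).2
  have hf0 : proj (F 0) = f 0 := hF.proj_eq.self_of_nhds
  have hf := isSmoothGerm_of_isLegendrianLift hF
  have hσ : IsSmoothGerm (𝕜 := 𝕜) (shift a : (Fin n → 𝕜) × 𝕜 → _) 0 := isSmoothGerm_shift ha
  have hσ0 : ∀ᶠ x in 𝓝 (0 : Fin n → 𝕜), shift a (x, (0 : 𝕜)) = x :=
    Eventually.of_forall fun x => shift_zero_right a x
  have hΨ := isLegendrianFamily_contactLift hi (by rwa [hf0])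
  obtain ⟨k1, k2, k3⟩ := isIntegral_trivial_deformation hF hσ hσ0 hΨ
  refine ⟨_, ⟨shift a, contactLift i b, hσ, hσ0, hΨ, rfl⟩, ?_⟩
  rw [tProj_velocity k1 k2]
  refine Germ.coe_eq.2 ?_
  have hbf : IsSmoothGerm (𝕜 := 𝕜) (fun x => b (f x)) (fun _ => 0) := hb.comp hf
  have hproj : ∀ᶠ r in 𝓝 ((0 : Fin n → 𝕜), (0 : 𝕜)),
      proj (contactLift i b (F (shift a r), r.2)) =
        quadFamily a f (fun x => b (f x)) (fun _ => 0) r := by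
    filter_upwards [(tendsto_shift ha).eventually hF.proj_eq] with r h1
    have h2 : proj (contactLift i b (F (shift a r), r.2)) =
      proj (F (shift a r)) + r.2 • b (proj (F (shift a r))) := rfl
    rw [h2, h1]
    simp [quadFamily]
  filter_upwards [hproj.curry_nhds, hf.differentiableAt, hbf.differentiableAt] with x h1 h2 h3
  have h4 : (fun t => proj (contactLift i b (F (shift a (x, t)), t))) =ᶠ[𝓝 0]
    fun t => quadFamily a f (fun x => b (f x)) (fun _ => 0) (x, t) := h1
  rw [h4.deriv_eq, deriv_quadFamily h2 h3 (differentiableAt_const _)]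

theorem image_tProj_legendrianTangent {f : (Fin n → 𝕜) → Fin (n + 1) → 𝕜}
    {F : (Fin n → 𝕜) → PTCot 𝕜 n} (hF : IsLegendrianLift F f 0) :
    tProj F '' legendrianTangent F = extendedTangent f := by
  refine Subset.antisymm ?_ fun η hη => exists_legendrianTangent_of_mem_extendedTangent hF hη
  rintro _ ⟨ξ, hξ, rfl⟩
  exact tProj_mem_extendedTangent hF hξ

end ContactLift

/-! ### The isomorphisms -/

universe u

/-- A linear map that is injective on `Θ` induces isomorphisms of `Θ` with its image and of the
quotients by a subspace of the target and by its preimage. -/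
theorem exists_quotient_equiv {K : Type*} {M N : Type*} [Field K] [AddCommGroup M] [Module K M]
    [AddCommGroup N] [Module K N] (T : M →ₗ[K] N) (Θ : Submodule K M) (A : Submodule K N)
    (hT : ∀ ξ ∈ Θ, T ξ = 0 → ξ = 0) :
    ∃ (e : Θ ≃ₗ[K] Θ.map T)
      (P : (Θ.map T ⧸ A.submoduleOf (Θ.map T)) ≃ₗ[K] (Θ ⧸ (Θ ⊓ A.comap T).submoduleOf Θ)),
      (∀ ξ : Θ, (e ξ : N) = T ξ) ∧
      ∀ ξ : Θ, P ((A.submoduleOf (Θ.map T)).mkQ (e ξ)) =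
        ((Θ ⊓ A.comap T).submoduleOf Θ).mkQ ξ := by
  let e : Θ ≃ₗ[K] Θ.map T := LinearEquiv.ofBijective
    (T.restrict (q := Θ.map T) fun ξ hξ => Submodule.mem_map_of_mem hξ) (by
      refine ⟨(injective_iff_map_eq_zero _).2 fun ξ hξ => ?_, ?_⟩
      · exact Subtype.ext (hT ξ ξ.2 (congrArg Subtype.val hξ))
      · rintro ⟨_, ξ, hξ, rfl⟩
        exact ⟨⟨ξ, hξ⟩, rfl⟩)
  have hmap : ((Θ ⊓ A.comap T).submoduleOf Θ).map (e : Θ →ₗ[K] Θ.map T) =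
      A.submoduleOf (Θ.map T) := by
    ext η
    constructor
    · rintro ⟨ξ, hξ, rfl⟩
      exact hξ.2
    · intro hη
      obtain ⟨ξ, rfl⟩ := e.surjective η
      exact ⟨ξ, ⟨ξ.2, hη⟩, rfl⟩
  refine ⟨e, (Submodule.Quotient.equiv _ _ e hmap).symm, fun ξ => rfl, fun ξ => ?_⟩
  rw [LinearEquiv.symm_apply_eq]
  rfl

/-- A linear map that is injective on a subspace `Θ` induces isomorphisms of `Θ` with its image and
of the quotients by a subspace `A` of the image and by its preimage. The four subspaces are given
as the sets `I`, `L`, `R` and `A`. -/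
theorem exists_quotient_equiv_of_sets {K : Type*} {M N : Type u} [Field K] [AddCommGroup M]
    [Module K M] [AddCommGroup N] [Module K N] (T : M →ₗ[K] N) (Θ : Submodule K M)
    (TA : Submodule K N) {I L : Set M} {R A : Set N} (hI : (Θ : Set M) = I)
    (hL : ((Θ ⊓ TA.comap T : Submodule K M) : Set M) = L) (hR : T '' I = R) (hA : (TA : Set N) = A)
    (hLA : T '' L = A) (hT : ∀ ξ ∈ Θ, T ξ = 0 → ξ = 0) :
    ∃ (Θ TL : Submodule K M) (Fr TA : Submodule K N),
      (Θ : Set M) = I ∧ (TL : Set M) = L ∧ (Fr : Set N) = R ∧ (TA : Set N) = A ∧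
      TL ≤ Θ ∧ TA ≤ Fr ∧
      ∃ (e : Θ ≃ₗ[K] Fr)
        (P : (Fr ⧸ TA.submoduleOf Fr) ≃ₗ[K] (Θ ⧸ TL.submoduleOf Θ)),
        (∀ ξ : Θ, (e ξ : N) = T ξ) ∧
        (∀ ξ : Θ, P ((TA.submoduleOf Fr).mkQ (e ξ)) = (TL.submoduleOf Θ).mkQ ξ) ∧
        Module.rank K (Fr ⧸ TA.submoduleOf Fr) = Module.rank K (Θ ⧸ TL.submoduleOf Θ) := by
  subst hI hL hR hA
  obtain ⟨e, P, he, hP⟩ := exists_quotient_equiv T Θ TA hT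
  refine ⟨Θ, Θ ⊓ TA.comap T, Θ.map T, TA, rfl, rfl, Submodule.map_coe _ _, rfl, inf_le_left, ?_,
    e, P, he, hP, P.rank_eq⟩
  intro η hη
  obtain ⟨ξ, hξ, rfl⟩ := hLA.ge hη
  exact Submodule.mem_map_of_mem hξ.1

section Isomorphism

variable {𝕜 : Type*} [RCLike 𝕜] {n : ℕ}

/-- `T𝒜_e f` as a linear subspace. -/
def extendedTangentSubmodule (f : (Fin n → 𝕜) → Fin (n + 1) → 𝕜) :
    Submodule 𝕜 (Germ (𝓝 (0 : Fin n → 𝕜)) (Fin (n + 1) → 𝕜)) where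
  carrier := extendedTangent f
  zero_mem' := ⟨fun _ => 0, fun _ => 0, .of_contDiff contDiff_const _,
    .of_contDiff contDiff_const _, Germ.coe_eq.2 (Eventually.of_forall fun x => by simp)⟩
  add_mem' := by
    rintro _ _ ⟨a, b, ha, hb, rfl⟩ ⟨a', b', ha', hb', rfl⟩
    refine ⟨_, _, ha.add ha', hb.add hb', ?_⟩
    rw [← Germ.coe_add]
    refine Germ.coe_eq.2 (Eventually.of_forall fun x => ?_)
    simp only [Pi.add_apply, map_add]
    abel
  smul_mem' := by
    rintro c _ ⟨a, b, ha, hb, rfl⟩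
    refine ⟨fun x => c • a x, fun x => c • b x,
      IsSmoothGerm.smul (.of_contDiff contDiff_const _) ha,
      IsSmoothGerm.smul (.of_contDiff contDiff_const _) hb, ?_⟩
    rw [← Germ.coe_smul]
    refine Germ.coe_eq.2 (Eventually.of_forall fun x => ?_)
    simp

/-- `Tℒ_e` is the preimage of `T𝒜_e f` under `tπ` in `θ_I`: a field in this preimage has the same
projection as one in `Tℒ_e`, so that the two agree by injectivity of `tπ`. -/
theorem legendrianTangent_eq {f : (Fin n → 𝕜) → Fin (n + 1) → 𝕜} {i : Fin (n + 1)}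
    {F : (Fin n → 𝕜) → PTCot 𝕜 n} (hF : IsLegendrianLift F f 0) (hi : (F 0).2 ∈ ProjChart.dom i)
    (hf : ∃ U ∈ 𝓝 (0 : Fin n → 𝕜),
      IsNowhereDense {y ∈ U | ¬ Function.Injective (fderiv 𝕜 f y)}) (hc : corank F ≤ 1) :
    (infinitesimalDeformations i F ⊓ (extendedTangentSubmodule f).comap (tProj F) :
      Submodule 𝕜 (FieldGerm F)) = legendrianTangent F := by
  have hΘ := infinitesimalDeformations_eq hF.smooth hi hF.integral hc
  refine Subset.antisymm ?_ fun ξ hξ => ⟨?_, tProj_mem_extendedTangent hF hξ⟩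
  · rintro ξ ⟨h1, h2⟩
    obtain ⟨η, h3, h4⟩ := exists_legendrianTangent_of_mem_extendedTangent hF h2
    have h5 : η ∈ infinitesimalDeformations i F := by
      rw [← SetLike.mem_coe, hΘ]
      exact legendrianTangent_subset hF h3
    have h6 : η - ξ = 0 := eq_zero_of_tProj_eq_zero hF hi hf (sub_mem h5 h1) (by
      rw [map_sub, h4, sub_self])
    rwa [← sub_eq_zero.1 h6]
  · rw [hΘ]
    exact legendrianTangent_subset hF hξ

end Isomorphism

end FrontalGerm

theorem mainTheorem10 {𝕜 : Type*} [RCLike 𝕜] (n : ℕ)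
    (f : (Fin n → 𝕜) → Fin (n + 1) → 𝕜) (hf₀ : f 0 = 0)
    (hf : FrontalGerm.IsProperFrontalGerm (𝕜 := 𝕜) f 0)
    (f' : (Fin n → 𝕜) → FrontalGerm.PTCot 𝕜 n)
    (hf' : FrontalGerm.IsLegendrianLift (𝕜 := 𝕜) f' f 0)
    (hcorank : FrontalGerm.corank f' ≤ 1) :
    ∃ (Θ TL : Submodule 𝕜 (FrontalGerm.FieldGerm f'))
      (Fr TA : Submodule 𝕜 (Filter.Germ (nhds (0 : Fin n → 𝕜)) (Fin (n + 1) → 𝕜))),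
      (Θ : Set (FrontalGerm.FieldGerm f')) = FrontalGerm.integralDeformations f' ∧
      (TL : Set (FrontalGerm.FieldGerm f')) = FrontalGerm.legendrianTangent f' ∧
      (Fr : Set (Filter.Germ (nhds (0 : Fin n → 𝕜)) (Fin (n + 1) → 𝕜))) =
        FrontalGerm.frontalDeformations f ∧
      (TA : Set (Filter.Germ (nhds (0 : Fin n → 𝕜)) (Fin (n + 1) → 𝕜))) =
        FrontalGerm.extendedTangent f ∧
      TL ≤ Θ ∧ TA ≤ Fr ∧
      ∃ (e : Θ ≃ₗ[𝕜] Fr)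
        (P : (Fr ⧸ TA.submoduleOf Fr) ≃ₗ[𝕜] (Θ ⧸ TL.submoduleOf Θ)),
        (∀ ξ : Θ, (e ξ : Filter.Germ (nhds (0 : Fin n → 𝕜)) (Fin (n + 1) → 𝕜)) =
          FrontalGerm.tProj f' ξ) ∧
        (∀ ξ : Θ, P ((TA.submoduleOf Fr).mkQ (e ξ)) = (TL.submoduleOf Θ).mkQ ξ) ∧
        Module.rank 𝕜 (Fr ⧸ TA.submoduleOf Fr) = Module.rank 𝕜 (Θ ⧸ TL.submoduleOf Θ) := by
  obtain ⟨i, hi⟩ := ProjChart.exists_mem_dom (f' 0).2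
  have hΘ := FrontalGerm.infinitesimalDeformations_eq hf'.smooth hi hf'.integral hcorank
  have hTL := FrontalGerm.legendrianTangent_eq hf' hi hf.2 hcorank
  have hFr := FrontalGerm.image_tProj_integralDeformations hf' hf.2
  have hTA := FrontalGerm.image_tProj_legendrianTangent hf'
  exact FrontalGerm.exists_quotient_equiv_of_sets (FrontalGerm.tProj f')
    (FrontalGerm.infinitesimalDeformations i f') (FrontalGerm.extendedTangentSubmodule f) hΘ hTL
    hFr rfl hTA fun ξ hξ h0 => FrontalGerm.eq_zero_of_tProj_eq_zero hf' hi hf.2 hξ h0
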